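/- Let $A$ be a finite-dimensional algebra over a field $K$ with Jacobson radical $J$, whose irreducible modules $L(\lambda)$ (up to isomorphism, without repetition) are indexed by a poset $\Lambda$. Let $P(\lambda)$ and $I(\lambda)$ be the projective cover and the injective hull of $L(\lambda)$; let $\Delta(\lambda)$ be the maximal quotient of $P(\lambda)$, and $\nabla(\lambda)$ the maximal submodule of $I(\lambda)$, all of whose composition factors are of the form $L(\mu)$ with $\mu\le\lambda$. Assume that $A$ is quasi-hereditary: for every $\lambda$, $\operatorname{End}_A\Delta(\lambda)=K$, and $P(\lambda)$ has a finite filtration with top factor $\Delta(\lambda)$ and all other factors of the form $\Delta(\mu)$ with $\mu>\lambda$. A tilting module for $A$ is a finitely generated module that has both a finite filtration with factors of the form $\Delta(\mu)$ and a finite filtration with factors of the form $\nabla(\mu)$. Filter $A$ by $J^iA=J^i$ for $i\ge 0$ and $J^iA=A$ for $i<0$. A filtration of an $A$-module $M$ is a family of subspaces $F^iM$ ($i\in\mathbb Z$) that spans $M$ and satisfies $(J^iA)(F^jM)\subseteq F^{i+j}M$. Its shift $M\langle r\rangle$ has $F^i(M\langle r\rangle)=F^{i-r}M$, and a subquotient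 $M'/M''$ of $M$ carries the filtration $F^i(M'/M'')=(F^iM\cap M'+M'')/M''$. The radical filtration of $M$ is $J^iM=J^i\cdot M$ for $i\geq 0$ and $J^iM=M$ for $i<0$; its socle filtration is $J^{\vee(-i)}M=\operatorname{soc}^iM=\{m : J^i m=0\}$ for $i\ge0$ and $J^{\vee(-i)}M=0$ for $i<0$. For a filtered module put $\operatorname{Rees}(M)=\bigoplus_{i\in\mathbb Z}(F^iM)t^i$, a graded module over the Rees algebra $\operatorname{Rees}(A)=\bigoplus_{i\in\mathbb Z}(J^iA)t^i$; write $\operatorname{Rees}$ for the radical and $\operatorname{Rees}^\vee$ for the socle filtration. In the category of filtered modules, $P(\lambda)$ with the radical filtration is the projective cover of $L(\lambda)$, and dually $I(\lambda)$ with the socle filtration is its injective hull. Accordingly the standard and costandard modules of $\operatorname{Rees}(A)$ are $\operatorname{Rees}(\Delta(\lambda))$ and $\operatorname{Rees}^\vee(\nabla(\lambda))$, up to grade shift. $\operatorname{Rees}(A)$ is called quasi-hereditary if for every $\lambda$ the degree-preserving endomorphisms of $\operatorname{Rees}(\Delta(\lambda))$ are the scalars in $K$, and $\operatorname{Rees}(P(\lambda))$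 has a finite filtration by graded submodules with top factor a grade shift of $\operatorname{Rees}(\Delta(\lambda))$ and all other factors grade shifts of modules $\operatorname{Rees}(\Delta(\mu))$ with $\mu>\lambda$. For a finitely generated $A$-module $T$, $\operatorname{Rees}(T)$ is called a tilting module for $\operatorname{Rees}(A)$ if it has a finite filtration by graded submodules whose factors are grade shifts of modules $\operatorname{Rees}(\Delta(\mu))$, and another whose factors are grade shifts of modules $\operatorname{Rees}^\vee(\nabla(\mu))$. A $\Delta$-$L$ subquotient of a module $T$ is a subquotient $M'/M''$ with a non-split extension $0\to L(\mu)\to M'/M''\to W\to 0$, where $W$ is a quotient of $\Delta(\lambda)$ and $\mu>\lambda$. An $L$-$\nabla$ subquotient is a subquotient $M'/M''$ with a non-split extension $0\to U\to M'/M''\to L(\mu)\to 0$, where $U$ is a submodule of $\nabla(\lambda)$ and $\mu>\lambda$. Give $T$ its radical filtration and $M'/M''$ the induced filtration. A $\Delta$-$L$ subquotient $M'/M''$ is called stretched if it is not isomorphic, as a filtered module, to a shift of a quotient of $P(\lambda)$ with its radical filtration; an $L$-$\nabla$ subquotient $M'/M''$ is called stretched if it is not isomorphic, as a filtered module, to a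 shift of a submodule of $I(\lambda)$ with its socle filtration. **Theorem.** Suppose that $A$ and $\operatorname{Rees}(A)$ are quasi-hereditary. If a tilting module $T$ for $A$ has no stretched $\Delta$-$L$ subquotients and no stretched $L$-$\nabla$ subquotients, then $\operatorname{Rees}(T)$ is a tilting module for $\operatorname{Rees}(A)$. -/

import Mathlib

open DirectSum

universe u w v

/-! ### The radical filtration of an algebra, and filtered modules -/

section Filtrations

/-- The radical filtration `J^i A`: the `i`-th power of the Jacobson radical for `i ≥ 0`, and
`A` itself for `i < 0`. -/
def radPow (A : Type u) [Ring A] (i : ℤ) : Ideal A := Ring.jacobson A ^ i.toNat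

theorem radPow_mul_mem {A : Type u} [Ring A] {m n : ℕ} {k : ℕ} (h : k ≤ m + n) {a b : A}
    (ha : a ∈ Ring.jacobson A ^ m) (hb : b ∈ Ring.jacobson A ^ n) :
    a * b ∈ Ring.jacobson A ^ k := by
  have h1 : a * b ∈ Ring.jacobson A ^ (m + n) := by
    rw [Ideal.IsTwoSided.pow_add]
    exact Ideal.mul_mem_mul ha hb
  exact Ideal.pow_le_pow_right h h1

instance radPow.gradedMonoid (A : Type u) [Ring A] : SetLike.GradedMonoid (radPow A) where
  one_mem := by simp [radPow, Submodule.pow_zero]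
  mul_mem := fun i j a b ha hb => by
    unfold radPow at *
    exact radPow_mul_mem (by omega) ha hb

/-- A filtration on an `A`-module `M`, where `A` carries its radical filtration. The subspaces
`F^i M` are automatically `A`-submodules because `J^0 A = A`. -/
structure ModFiltration (A : Type u) [Ring A] (M : Type v) [AddCommGroup M] [Module A M] where
  toFun : ℤ → Submodule A M
  smul_mem : ∀ (i j : ℤ) (a : A) (m : M), a ∈ radPow A i → m ∈ toFun j → a • m ∈ toFun (i + j)
  iSup_eq_top : ⨆ i, toFun i = ⊤

variable {A : Type u} [Ring A] {M : Type v} [AddCommGroup M] [Module A M]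

/-- The shift `M⟨r⟩`, with `F^i (M⟨r⟩) = F^(i-r) M`. -/
def ModFiltration.shift (F : ModFiltration A M) (r : ℤ) : ModFiltration A M where
  toFun i := F.toFun (i - r)
  smul_mem i j a m ha hm := by
    have := F.smul_mem i (j - r) a m ha hm
    rwa [show i + j - r = i + (j - r) by ring]
  iSup_eq_top := by
    rw [← F.iSup_eq_top]
    exact (Equiv.subRight r).iSup_comp (g := F.toFun)

theorem ModFiltration.antitone (F : ModFiltration A M) : Antitone F.toFun := by
  intro i j hij m hm
  have := F.smul_mem (i - j) j 1 m (by
    have : (i - j).toNat = 0 := by omega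
    simp [radPow, this, Submodule.pow_zero]) hm
  simpa using this

/-- The filtration `F^i N = F^i M ∩ N` induced on a submodule `N`. -/
def ModFiltration.sub (F : ModFiltration A M) (N : Submodule A M) : ModFiltration A N where
  toFun i := (F.toFun i).comap N.subtype
  smul_mem i j a m ha hm := F.smul_mem i j a m ha hm
  iSup_eq_top := by
    rw [eq_top_iff]
    rintro ⟨x, hx⟩ -
    have hx' : x ∈ ⨆ i, F.toFun i := by rw [F.iSup_eq_top]; trivial
    rw [Submodule.mem_iSup_of_directed _ F.antitone.directed_le] at hx'
    obtain ⟨i, hi⟩ := hx'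
    exact Submodule.mem_iSup_of_mem i hi

/-- The filtration `F^i (M/N) = (F^i M + N)/N` induced on a quotient `M/N`. -/
def ModFiltration.quot (F : ModFiltration A M) (N : Submodule A M) : ModFiltration A (M ⧸ N) where
  toFun i := (F.toFun i).map N.mkQ
  smul_mem i j a m ha hm := by
    obtain ⟨x, hx, rfl⟩ := hm
    exact ⟨a • x, F.smul_mem i j a x ha hx, by simp⟩
  iSup_eq_top := by
    rw [← Submodule.map_iSup, F.iSup_eq_top, Submodule.map_top, Submodule.range_mkQ]

/-- The subquotient `M'/M''` of `M` (used when `M'' ≤ M'`). -/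
abbrev Subquot (M'' M' : Submodule A M) : Type v := M' ⧸ M''.submoduleOf M'

/-- The filtration `F^i (M'/M'') = (F^i M ∩ M' + M'')/M''` induced on a subquotient. -/
def ModFiltration.subquot (F : ModFiltration A M) (M'' M' : Submodule A M) :
    ModFiltration A (Subquot M'' M') :=
  (F.sub M').quot (M''.submoduleOf M')

/-- Two filtered modules are isomorphic as filtered modules. -/
def FilteredIso {N : Type w} [AddCommGroup N] [Module A N]
    (F : ModFiltration A M) (G : ModFiltration A N) : Prop :=
  ∃ e : M ≃ₗ[A] N, ∀ i, (F.toFun i).map e.toLinearMap = G.toFun i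

/-- The radical filtration of a module: `J^i M = J(A)^i M` for `i ≥ 0`, `J^i M = M` for `i < 0`. -/
def radFiltration (A : Type u) [Ring A] (M : Type v) [AddCommGroup M] [Module A M] :
    ModFiltration A M where
  toFun i := radPow A i • (⊤ : Submodule A M)
  smul_mem i j a m ha hm := by
    have h : a • m ∈ radPow A i • radPow A j • (⊤ : Submodule A M) := Submodule.smul_mem_smul ha hm
    rw [← Submodule.smul_assoc] at h
    refine Submodule.smul_mono_left ?_ h
    rw [Ideal.smul_eq_mul, Ideal.mul_le]
    exact fun x hx y hy => SetLike.mul_mem_graded hx hy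
  iSup_eq_top := by
    rw [eq_top_iff]
    refine le_trans ?_ (le_iSup _ 0)
    simp [radPow, Submodule.pow_zero]

/-- The `i`-th socle `soc^i M = {m | J(A)^i m = 0}`. -/
def socPow (A : Type u) [Ring A] (M : Type v) [AddCommGroup M] [Module A M] (i : ℕ) :
    Submodule A M where
  carrier := {m | ∀ a ∈ Ring.jacobson A ^ i, a • m = 0}
  add_mem' hx hy a ha := by rw [smul_add, hx a ha, hy a ha, add_zero]
  zero_mem' a _ := smul_zero a
  smul_mem' c x hx a ha := by
    rw [← mul_smul]
    exact hx _ (Ideal.mul_mem_right c _ ha)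

/-- The socle filtration of a module over a finite-dimensional algebra:
`F^(-i) M = soc^i M` for `i ≥ 0`, and `F^j M = 0` for `j > 0`. -/
def socFiltration (K : Type w) (A : Type u) [Field K] [Ring A] [Algebra K A]
    [FiniteDimensional K A] (M : Type v) [AddCommGroup M] [Module A M] :
    ModFiltration A M where
  toFun i := socPow A M (-i).toNat
  smul_mem i j a m ha hm b hb := by
    rw [← mul_smul]
    exact hm _ (radPow_mul_mem (by omega) hb ha)
  iSup_eq_top := by
    have : IsArtinianRing A := IsArtinianRing.of_finite K A
    obtain ⟨n, hn⟩ := IsArtinianRing.isNilpotent_jacobson_bot (R := A)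
    rw [Ideal.jacobson_bot] at hn
    rw [eq_top_iff]
    refine le_trans ?_ (le_iSup _ (-(n : ℤ)))
    intro m _ a ha
    have h0 : (- -(n : ℤ)).toNat = n := by simp
    rw [h0, hn] at ha
    rw [show a = 0 by simpa using ha, zero_smul]

end Filtrations

/-! ### The Rees algebra and Rees modules -/

section Rees

/-- The Rees algebra `⨁_{i ∈ ℤ} J^i A` of the radical filtration, as a `ℤ`-graded ring. -/
abbrev ReesAlgebra (A : Type u) [Ring A] : Type u := ⨁ i : ℤ, radPow A i

variable {A : Type u} [Ring A] {M : Type v} [AddCommGroup M] [Module A M]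

instance ModFiltration.gradedSMul (F : ModFiltration A M) :
    SetLike.GradedSMul (radPow A) F.toFun where
  smul_mem := fun _ _ _ _ ha hm => F.smul_mem _ _ _ _ ha hm

/-- The graded module `⨁_{i ∈ ℤ} F^i M` over the Rees algebra; `a ∈ J^i A` in degree `i` sends
`m ∈ F^j M` in degree `j` to `a • m ∈ F^(i+j) M` in degree `i + j`. -/
abbrev Rees (F : ModFiltration A M) : Type v := ⨁ i : ℤ, F.toFun i

noncomputable instance Rees.module (F : ModFiltration A M) : Module (ReesAlgebra A) (Rees F) :=
  DirectSum.Gmodule.module (fun i => radPow A i) (fun i => F.toFun i)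

/-- `x` is homogeneous of degree `i`. -/
def Rees.IsHomogeneousOfDegree {F : ModFiltration A M} (i : ℤ) (x : Rees F) : Prop :=
  ∃ m : F.toFun i, DirectSum.of (fun i => F.toFun i) i m = x

/-- A graded submodule: it contains the homogeneous components of its elements. -/
def Rees.IsGradedSubmodule {F : ModFiltration A M} (X : Submodule (ReesAlgebra A) (Rees F)) :
    Prop :=
  ∀ x ∈ X, ∀ i, DirectSum.of (fun i => F.toFun i) i (x i) ∈ X

/-- For graded submodules `Y ≤ X` of `Rees F`: the graded module `X/Y` is isomorphic to `Rees G`,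
i.e. there is a degree-preserving surjection `X → Rees G` with kernel `Y`. -/
def Rees.SubquotIso {N : Type w} [AddCommGroup N] [Module A N] {F : ModFiltration A M}
    (Y X : Submodule (ReesAlgebra A) (Rees F)) (G : ModFiltration A N) : Prop :=
  ∃ φ : X →ₗ[ReesAlgebra A] Rees G, Function.Surjective φ ∧
    (∀ x : X, φ x = 0 ↔ (x : Rees F) ∈ Y) ∧
    ∀ (x : X) (i : ℤ), Rees.IsHomogeneousOfDegree i (x : Rees F) →
      Rees.IsHomogeneousOfDegree i (φ x)

/-- `Rees F` has a finite filtration by graded submodules whose successive quotients, from the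
bottom to the top, are grade shifts of the modules `Rees (G λ)`, with `λ` running through the
list `l`. -/
def Rees.HasFiltration {Λ : Type w} {D : Λ → Type v} [∀ lam, AddCommGroup (D lam)]
    [∀ lam, Module A (D lam)] (F : ModFiltration A M) (G : ∀ lam, ModFiltration A (D lam))
    (l : List Λ) : Prop :=
  ∃ X : ℕ → Submodule (ReesAlgebra A) (Rees F),
    X 0 = ⊥ ∧ X l.length = ⊤ ∧ (∀ k, Rees.IsGradedSubmodule (X k)) ∧
    ∀ (k : ℕ) (hk : k < l.length), X k ≤ X (k + 1) ∧
      ∃ s : ℤ, Rees.SubquotIso (X k) (X (k + 1)) ((G l[k]).shift s)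

end Rees

/-- `M` has a finite filtration by submodules whose successive quotients, from the bottom to the
top, are isomorphic to the modules `D λ`, with `λ` running through the list `l`. -/
def HasModFiltration {A : Type u} [Ring A] {M : Type v} [AddCommGroup M] [Module A M]
    {Λ : Type w} (D : Λ → Type v) [∀ lam, AddCommGroup (D lam)] [∀ lam, Module A (D lam)]
    (l : List Λ) : Prop :=
  ∃ X : ℕ → Submodule A M, X 0 = ⊥ ∧ X l.length = ⊤ ∧
    ∀ (k : ℕ) (hk : k < l.length), X k ≤ X (k + 1) ∧
      Nonempty (Subquot (X k) (X (k + 1)) ≃ₗ[A] D l[k])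

/-! ### Irreducible, projective, injective, standard and costandard modules -/

/-- The irreducible `A`-modules `L λ`, indexed without repetition by `Λ`, with a projective cover
`π λ : P λ → L λ` and an injective hull `ι λ : L λ → I λ` of each of them. -/
structure WeightSystem (A : Type u) [Ring A] (Λ : Type w) where
  L : Λ → ModuleCat.{u} A
  P : Λ → ModuleCat.{u} A
  I : Λ → ModuleCat.{u} A
  π : ∀ lam, P lam →ₗ[A] L lam
  ι : ∀ lam, L lam →ₗ[A] I lam
  simple : ∀ lam, IsSimpleModule A (L lam)
  complete : ∀ (S : Type u) [AddCommGroup S] [Module A S], IsSimpleModule A S →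
    ∃ lam, Nonempty (S ≃ₗ[A] L lam)
  irredundant : ∀ lam mu, Nonempty (L lam ≃ₗ[A] L mu) → lam = mu
  projective : ∀ lam, Module.Projective A (P lam)
  π_surjective : ∀ lam, Function.Surjective (π lam)
  π_superfluous : ∀ lam (N : Submodule A (P lam)), N ⊔ LinearMap.ker (π lam) = ⊤ → N = ⊤
  injective : ∀ lam, Module.Injective A (I lam)
  ι_injective : ∀ lam, Function.Injective (ι lam)
  ι_essential : ∀ lam (N : Submodule A (I lam)), N ⊓ LinearMap.range (ι lam) = ⊥ → N = ⊥

namespace WeightSystem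

variable {A : Type u} [Ring A] {Λ : Type w} [PartialOrder Λ] (S : WeightSystem A Λ)

/-- All composition factors (irreducible subquotients) of `M` are among the `L μ` with `μ ≤ λ`. -/
def FactorsLE (lam : Λ) (M : Type u) [AddCommGroup M] [Module A M] : Prop :=
  ∀ (M'' M' : Submodule A M) (mu : Λ), M'' ≤ M' → Nonempty (Subquot M'' M' ≃ₗ[A] S.L mu) →
    mu ≤ lam

/-- The kernel of `P λ → Δ λ`. -/
def stdKer (lam : Λ) : Submodule A (S.P lam) :=
  sInf {N | S.FactorsLE lam (S.P lam ⧸ N)}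

/-- The standard module `Δ λ`: the maximal quotient of `P λ` all of whose composition factors
are among the `L μ` with `μ ≤ λ`. -/
abbrev Std (lam : Λ) : Type u := S.P lam ⧸ S.stdKer lam

/-- `∇ λ` as a submodule of `I λ`. -/
def costdSub (lam : Λ) : Submodule A (S.I lam) :=
  sSup {N | S.FactorsLE lam N}

/-- The costandard module `∇ λ`: the maximal submodule of `I λ` all of whose composition factors
are among the `L μ` with `μ ≤ λ`. -/
abbrev Costd (lam : Λ) : Type u := S.costdSub lam

variable (K : Type v) [Field K] [Algebra K A]

/-- `A` is quasi-hereditary: `End_A (Δ λ) = K`, and `P λ` has a `Δ`-filtration with top factor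
`Δ λ` and all other factors of the form `Δ μ` with `μ > λ`. -/
def IsQuasiHereditary : Prop :=
  ∀ lam : Λ,
    (∀ f : S.Std lam →ₗ[A] S.Std lam, ∃ c : K, ∀ x, f x = algebraMap K A c • x) ∧
    ∃ l : List Λ, (∀ mu ∈ l, lam < mu) ∧
      HasModFiltration (A := A) (M := S.P lam) S.Std (l ++ [lam])

/-- The Rees algebra of `A` is quasi-hereditary as a graded algebra, with projective covers
`Rees (P λ)` and standard modules `Rees (Δ λ)` (up to grade shift): the graded endomorphisms of
`Rees (Δ λ)` are the scalars in `K`, and `Rees (P λ)` has a filtration by graded submodules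
with top factor `Rees (Δ λ)` and all other factors grade shifts of `Rees (Δ μ)` with `μ > λ`. -/
def IsReesQuasiHereditary : Prop :=
  ∀ lam : Λ,
    (∀ f : Rees (radFiltration A (S.Std lam)) →ₗ[ReesAlgebra A]
        Rees (radFiltration A (S.Std lam)),
      (∀ x i, Rees.IsHomogeneousOfDegree i x → Rees.IsHomogeneousOfDegree i (f x)) →
      ∃ c : K, ∀ x i, ((f x) i : S.Std lam) = algebraMap K A c • (x i : S.Std lam)) ∧
    ∃ l : List Λ, (∀ mu ∈ l, lam < mu) ∧
      Rees.HasFiltration (radFiltration A (S.P lam)) (fun mu => radFiltration A (S.Std mu))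
        (l ++ [lam])

/-- A tilting module for `A`: it has a `Δ`-filtration and a `∇`-filtration. -/
def IsTilting (T : Type u) [AddCommGroup T] [Module A T] : Prop :=
  (∃ l : List Λ, HasModFiltration (A := A) (M := T) S.Std l) ∧
  (∃ l : List Λ, HasModFiltration (A := A) (M := T) S.Costd l)

/-- `Rees F` is a tilting module for the Rees algebra of `A`: it has finite filtrations by graded
submodules with factors grade shifts of standard modules, respectively of costandard modules.
The filtered projective cover of `L λ` is `P λ` with the radical filtration, and dually its
filtered injective hull is `I λ` with the socle filtration. Accordingly the standard modules of
the Rees algebra are formed from `Δ λ`, a quotient of `P λ`, with its radical filtration, and the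
costandard ones from `∇ λ`, a submodule of `I λ`, with its socle filtration. -/
def IsReesTilting [FiniteDimensional K A] {T : Type u} [AddCommGroup T] [Module A T]
    (F : ModFiltration A T) : Prop :=
  (∃ l : List Λ, Rees.HasFiltration F (fun lam => radFiltration A (S.Std lam)) l) ∧
  (∃ l : List Λ, Rees.HasFiltration F (fun lam => socFiltration K A (S.Costd lam)) l)

/-- `E` is a non-trivial extension of `W` by `L μ` (so `0 → L μ → E → W → 0` is non-split),
for some quotient `W` of `Δ λ`, where `μ > λ`. -/
def IsStdIrr (lam mu : Λ) (E : Type u) [AddCommGroup E] [Module A E] : Prop :=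
  lam < mu ∧ ∃ N : Submodule A E, Nonempty (N ≃ₗ[A] S.L mu) ∧
    (∃ Q : Submodule A (S.Std lam), Nonempty ((E ⧸ N) ≃ₗ[A] (S.Std lam ⧸ Q))) ∧
    ¬ ∃ C : Submodule A E, IsCompl N C

/-- `E` is a non-trivial extension of `L μ` by `U` (so `0 → U → E → L μ → 0` is non-split),
for some submodule `U` of `∇ λ`, where `μ > λ`. -/
def IsIrrCostd (lam mu : Λ) (E : Type u) [AddCommGroup E] [Module A E] : Prop :=
  lam < mu ∧ ∃ N : Submodule A E, (∃ U : Submodule A (S.Costd lam), Nonempty (N ≃ₗ[A] U)) ∧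
    Nonempty ((E ⧸ N) ≃ₗ[A] S.L mu) ∧
    ¬ ∃ C : Submodule A E, IsCompl N C

/-- `M` has a stretched `Δ`-`L` subquotient: one which, with the filtration induced from the
radical filtration of `M`, is not isomorphic as a filtered module to a shifted quotient of
the filtered projective cover `P λ`. -/
def HasStretchedStdIrr (M : Type u) [AddCommGroup M] [Module A M] : Prop :=
  ∃ (M'' M' : Submodule A M) (lam mu : Λ), M'' ≤ M' ∧ S.IsStdIrr lam mu (Subquot M'' M') ∧
    ¬ ∃ (Q : Submodule A (S.P lam)) (r : ℤ),
      FilteredIso ((radFiltration A M).subquot M'' M')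
        (((radFiltration A (S.P lam)).quot Q).shift r)

/-- `M` has a stretched `L`-`∇` subquotient: one which, with the filtration induced from the
radical filtration of `M`, is not isomorphic as a filtered module to a shifted submodule of
the filtered injective hull `I λ`. -/
def HasStretchedIrrCostd [FiniteDimensional K A] (M : Type u) [AddCommGroup M] [Module A M] :
    Prop :=
  ∃ (M'' M' : Submodule A M) (lam mu : Λ), M'' ≤ M' ∧ S.IsIrrCostd lam mu (Subquot M'' M') ∧
    ¬ ∃ (Q : Submodule A (S.I lam)) (r : ℤ),
      FilteredIso ((radFiltration A M).subquot M'' M')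
        (((socFiltration K A (S.I lam)).sub Q).shift r)

end WeightSystem

/-! ### Factoring, extending and lifting linear maps -/

section Maps

variable {A : Type u} [Ring A]

/-! The proof is an `Ext` criterion in the category of filtered modules, phrased without derived
functors. Filtered `Ext¹(Δ(μ), M)` obstructs extending filtered maps from `stdKer μ = ker (P(μ) →
Δ(μ))` to `P(μ)`, and filtered `Ext¹(M, ∇(μ))` obstructs lifting filtered maps `M → I(μ)/∇(μ)` to
`I(μ)`. `StdExtends` and `CostdLifts` say that these obstructions vanish for all shifts.

No stretching implies vanishing. Since `T` has a `∇`-filtration, a filtered map `f : stdKer μ → T`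
has some extension `g : P(μ) → T`. An irreducible quotient `L(ν)` of the image of `f` determines a
`Δ`-`L` subquotient of `T`. If `g` were not filtered, the top of this subquotient and `L(ν)` would
lie further apart in it than `P(μ)` allows, so it would be stretched
(`stdExtends_of_not_hasStretchedStdIrr`). The dual is `costdLifts_of_not_hasStretchedIrrCostd`.

Vanishing implies filtrations. Take `λ` minimal with `L(λ) ⊆ T`. The embedding of `L(λ)` extends to
`∇(λ)` one composition factor `L(κ)` at a time: `StdExtends` extends over `P(κ)`, and the remaining
discrepancy is a map `rad Δ(κ) → T`, which is zero by minimality (`StdExtends.exists_costd`). To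
repeat this for `T/∇(λ)`, one needs filtered `Ext²(Δ, ∇) = 0`, that is, `Ext¹(stdKer μ, ∇) = 0`
(`StdExtends.quot`). This is where quasi-heredity of `Rees(A)` enters: it filters `stdKer μ`
strictly by shifted standard modules, and filtered `Ext¹(Δ, ∇) = 0` already follows from
quasi-heredity of `A` (`costdLifts_std`). Dually, `CostdLifts.exists_std` and `CostdLifts.ker` split
standard quotients off the top.

Finally, filtrations of a Rees module with Rees modules as factors correspond to chains of
submodules whose subquotients carry the right induced filtrations, because Rees modules have no
torsion under lowering of degrees (`Rees.HasFiltration.exists_steps`,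
`Rees.hasFiltration_of_steps`). -/

theorem LinearMap.exists_factor_of_surjective {M N Q : Type*} [AddCommGroup M] [Module A M]
    [AddCommGroup N] [Module A N] [AddCommGroup Q] [Module A Q] (s : M →ₗ[A] N)
    (hs : Function.Surjective s) (h : M →ₗ[A] Q) (hk : ∀ x, s x = 0 → h x = 0) :
    ∃ h' : N →ₗ[A] Q, ∀ x, h' (s x) = h x := by
  refine ⟨(LinearMap.ker s).liftQ h (fun x hx => hk x hx) ∘ₗ
    (s.quotKerEquivOfSurjective hs).symm.toLinearMap, fun x => ?_⟩
  have : (s.quotKerEquivOfSurjective hs).symm (s x) = (LinearMap.ker s).mkQ x := by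
    rw [LinearEquiv.symm_apply_eq]; rfl
  rw [LinearMap.comp_apply, LinearEquiv.coe_coe, this]
  exact Submodule.liftQ_apply _ _ _

theorem LinearMap.exists_lift_of_injective {M N Q : Type*} [AddCommGroup M] [Module A M]
    [AddCommGroup N] [Module A N] [AddCommGroup Q] [Module A Q] (j : M →ₗ[A] N)
    (hj : Function.Injective j) (h : Q →ₗ[A] N) (hr : ∀ x, ∃ y, j y = h x) :
    ∃ h' : Q →ₗ[A] M, ∀ x, j (h' x) = h x := by
  refine ⟨(LinearEquiv.ofInjective j hj).symm.toLinearMap ∘ₗ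
    h.codRestrict (LinearMap.range j) (fun x => hr x), fun x => ?_⟩
  have := (LinearEquiv.ofInjective j hj).apply_symm_apply
    (h.codRestrict (LinearMap.range j) (fun x => hr x) x)
  exact congrArg Subtype.val this

theorem Module.Injective.exists_extend {I M N : Type u} [AddCommGroup I] [Module A I]
    [AddCommGroup M] [Module A M] [AddCommGroup N] [Module A N] (hI : Module.Injective A I)
    (j : N →ₗ[A] M) (f : N →ₗ[A] I) (hk : ∀ x, j x = 0 → f x = 0) :
    ∃ g : M →ₗ[A] I, ∀ x, g (j x) = f x := by
  obtain ⟨f', hf'⟩ := LinearMap.exists_factor_of_surjective j.rangeRestrict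
    j.surjective_rangeRestrict f (fun x hx => hk x (by simpa using congrArg Subtype.val hx))
  obtain ⟨g, hg⟩ := hI.out (LinearMap.range j).subtype Subtype.val_injective f'
  exact ⟨g, fun x => by rw [← hf', ← hg]; rfl⟩

theorem Module.Projective.exists_lift {P M N : Type*} [AddCommGroup P] [Module A P]
    [AddCommGroup M] [Module A M] [AddCommGroup N] [Module A N] (hP : Module.Projective A P)
    (q : M →ₗ[A] N) (g : P →ₗ[A] N) (hr : ∀ x, ∃ y, q y = g x) :
    ∃ h : P →ₗ[A] M, ∀ x, q (h x) = g x := by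
  obtain ⟨h, hh⟩ := Module.projective_lifting_property q.rangeRestrict
    (g.codRestrict (LinearMap.range q) hr) q.surjective_rangeRestrict
  exact ⟨h, fun x => congrArg Subtype.val (LinearMap.congr_fun hh x)⟩

/-- Two maps out of `M` and `P` that agree where `i : M → V` and `p : P → V` meet glue to a map
out of `V = i M + p P`. -/
theorem LinearMap.exists_glue {M P V Q : Type*} [AddCommGroup M] [Module A M]
    [AddCommGroup P] [Module A P] [AddCommGroup V] [Module A V] [AddCommGroup Q] [Module A Q]
    (i : M →ₗ[A] V) (p : P →ₗ[A] V) (hsurj : ∀ y, ∃ m x, y = i m + p x)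
    (f : M →ₗ[A] Q) (g : P →ₗ[A] Q) (hfg : ∀ m x, i m = p x → f m = g x) :
    ∃ h : V →ₗ[A] Q, (∀ m, h (i m) = f m) ∧ ∀ x, h (p x) = g x := by
  obtain ⟨h, hh⟩ := LinearMap.exists_factor_of_surjective (i.coprod p)
    (fun y => by obtain ⟨m, x, rfl⟩ := hsurj y; exact ⟨(m, x), by simp⟩) (f.coprod g)
    (fun ⟨m, x⟩ hx => by
      have h1 : i m = p (-x) := by
        simp only [LinearMap.coprod_apply] at hx
        rw [map_neg]; exact eq_neg_of_add_eq_zero_left hx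
      have := hfg _ _ h1
      simp [this])
  exact ⟨h, fun m => by simpa using hh (m, 0), fun x => by simpa using hh (0, x)⟩

end Maps

/-! ### Projective covers, injective hulls and composition factors -/

namespace WeightSystem

variable {A : Type u} [Ring A] {Λ : Type w} (S : WeightSystem A Λ)

instance isSimpleModule_L (lam : Λ) : IsSimpleModule A (S.L lam) := S.simple lam

theorem ker_π_isCoatom (lam : Λ) : IsCoatom (LinearMap.ker (S.π lam)) := by
  rw [← isSimpleModule_iff_isCoatom]
  exact IsSimpleModule.congr ((S.π lam).quotKerEquivOfSurjective (S.π_surjective lam))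

/-- A superfluous coatom is the unique maximal submodule: `P lam` is local. -/
theorem le_ker_π_of_ne_top {lam : Λ} {N : Submodule A (S.P lam)} (hN : N ≠ ⊤) :
    N ≤ LinearMap.ker (S.π lam) := by
  by_contra h
  refine hN (S.π_superfluous lam N ?_)
  rw [sup_comm]
  exact (S.ker_π_isCoatom lam).2 _ (left_lt_sup.2 h)

theorem ker_le_ker_π {lam : Λ} {M : Type*} [AddCommGroup M] [Module A M]
    {h : S.P lam →ₗ[A] M} (hh : h ≠ 0) : LinearMap.ker h ≤ LinearMap.ker (S.π lam) :=
  S.le_ker_π_of_ne_top (fun h0 => hh (LinearMap.ker_eq_top.1 h0))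

/-- `P lam` is cyclic, generated by any element outside the kernel of `π`. -/
theorem exists_gen (lam : Λ) : ∃ e : S.P lam, S.π lam e ≠ 0 ∧ Submodule.span A {e} = ⊤ := by
  have := IsSimpleModule.nontrivial A (S.L lam)
  obtain ⟨l, hl⟩ := exists_ne (0 : S.L lam)
  obtain ⟨e, rfl⟩ := S.π_surjective lam l
  refine ⟨e, hl, ?_⟩
  by_contra h
  exact hl (S.le_ker_π_of_ne_top h (Submodule.mem_span_singleton_self e))

instance finite_P (lam : Λ) : Module.Finite A (S.P lam) := by
  obtain ⟨e, -, he⟩ := S.exists_gen lam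
  exact ⟨⟨{e}, by simpa using he⟩⟩

theorem ι_le_of_ne_bot {lam : Λ} {N : Submodule A (S.I lam)} (hN : N ≠ ⊥) :
    LinearMap.range (S.ι lam) ≤ N := by
  have hs : IsSimpleModule A (LinearMap.range (S.ι lam)) :=
    IsSimpleModule.congr (LinearEquiv.ofInjective _ (S.ι_injective lam)).symm
  rw [isSimpleModule_iff_isAtom] at hs
  have h1 : N ⊓ LinearMap.range (S.ι lam) ≠ ⊥ := fun h => hN (S.ι_essential lam N h)
  have h2 := (hs.le_iff_eq h1).1 inf_le_right
  exact inf_eq_right.1 h2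

/-- A nonzero kernel, carried into `I lam` by `e`, would contain the simple socle; so injectivity
need only be tested there. -/
theorem injective_of_comp_ι {lam : Λ} {M N : Type*} [AddCommGroup M] [Module A M]
    [AddCommGroup N] [Module A N] (e : N →ₗ[A] S.I lam) {h : N →ₗ[A] M}
    (hh : ∀ x : N, e x ∈ LinearMap.range (S.ι lam) → h x = 0 → x = 0)
    (he : Function.Injective e) : Function.Injective h := by
  rw [← LinearMap.ker_eq_bot]
  by_contra hne
  have h1 : (LinearMap.ker h).map e ≠ ⊥ := fun h0 => hne
    (Submodule.map_injective_of_injective he (h0.trans (Submodule.map_bot _).symm))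
  have h2 := S.ι_le_of_ne_bot h1
  have := IsSimpleModule.nontrivial A (S.L lam)
  obtain ⟨l, hl⟩ := exists_ne (0 : S.L lam)
  obtain ⟨y, hy, hy'⟩ := h2 ⟨l, rfl⟩
  have h3 := hh y (by rw [hy']; exact ⟨l, rfl⟩) hy
  rw [h3, map_zero] at hy'
  exact hl (S.ι_injective lam (by rw [← hy', map_zero]))

theorem eq_of_map_ne_zero {nu kap : Λ} {h : S.P nu →ₗ[A] S.L kap} (hh : h ≠ 0) : nu = kap := by
  apply S.irredundant
  have h1 : Function.Surjective h := LinearMap.surjective_of_ne_zero hh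
  have h2 : LinearMap.ker h = LinearMap.ker (S.π nu) := by
    have hc : IsCoatom (LinearMap.ker h) := by
      rw [← isSimpleModule_iff_isCoatom]
      exact IsSimpleModule.congr (h.quotKerEquivOfSurjective h1)
    exact ((hc.le_iff_eq (S.ker_π_isCoatom nu).1).1 (S.ker_le_ker_π hh)).symm
  exact ⟨((S.π nu).quotKerEquivOfSurjective (S.π_surjective nu)).symm ≪≫ₗ
    Submodule.quotEquivOfEq _ _ h2.symm ≪≫ₗ h.quotKerEquivOfSurjective h1⟩

variable [PartialOrder Λ]

/-- `L nu` is a composition factor exactly when `P nu` maps nontrivially: the image of such a map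
has top `L nu`, and conversely `π` lifts through a subquotient. In this form, closure under
submodules, quotients and extensions is formal from projectivity. -/
theorem factorsLE_iff {lam : Λ} {M : Type u} [AddCommGroup M] [Module A M] :
    S.FactorsLE lam M ↔ ∀ (nu : Λ) (h : S.P nu →ₗ[A] M), h ≠ 0 → nu ≤ lam := by
  constructor
  · intro hM nu h hh
    refine hM ((LinearMap.ker (S.π nu)).map h) (LinearMap.range h) nu LinearMap.map_le_range ⟨?_⟩
    let k : S.P nu →ₗ[A] Subquot ((LinearMap.ker (S.π nu)).map h) (LinearMap.range h) :=
      Submodule.mkQ _ ∘ₗ h.rangeRestrict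
    have hk : Function.Surjective k :=
      (Submodule.mkQ_surjective _).comp h.surjective_rangeRestrict
    have hker : LinearMap.ker k = LinearMap.ker (S.π nu) := by
      ext x
      have : x ∈ LinearMap.ker k ↔ h x ∈ (LinearMap.ker (S.π nu)).map h := by
        rw [LinearMap.mem_ker, LinearMap.comp_apply, Submodule.mkQ_apply,
          Submodule.Quotient.mk_eq_zero]
        rfl
      rw [this]
      constructor
      · rintro ⟨y, hy, hxy⟩
        have : x - y ∈ LinearMap.ker h := by simp [hxy]
        have h2 := add_mem (S.ker_le_ker_π hh this) hy
        simpa using h2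
      · exact fun hx => ⟨x, hx, rfl⟩
    exact (k.quotKerEquivOfSurjective hk).symm ≪≫ₗ Submodule.quotEquivOfEq _ _ hker ≪≫ₗ
      (S.π nu).quotKerEquivOfSurjective (S.π_surjective nu)
  · rintro hM M'' M' mu - ⟨e⟩
    obtain ⟨h, hh⟩ := (S.projective mu).exists_lift
      (e.toLinearMap ∘ₗ Submodule.mkQ _) (S.π mu) (fun y => by
      obtain ⟨z, hz⟩ := e.surjective (S.π mu y)
      obtain ⟨z, rfl⟩ := Submodule.mkQ_surjective _ z
      exact ⟨z, hz⟩)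
    refine hM mu (M'.subtype ∘ₗ h) (fun h0 => ?_)
    obtain ⟨y, hy, -⟩ := S.exists_gen mu
    have h1 : h y = 0 := Subtype.val_injective (by simpa using LinearMap.congr_fun h0 y)
    apply hy
    rw [← hh, h1, map_zero]

namespace FactorsLE

variable {S} {lam : Λ} {M N Q : Type u} [AddCommGroup M] [Module A M] [AddCommGroup N] [Module A N]
  [AddCommGroup Q] [Module A Q]

theorem of_injective (hN : S.FactorsLE lam N) (j : M →ₗ[A] N) (hj : Function.Injective j) :
    S.FactorsLE lam M := by
  rw [factorsLE_iff] at *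
  refine fun nu h hh => hN nu (j ∘ₗ h) (fun h0 => hh ?_)
  ext x
  exact hj (by simpa using LinearMap.congr_fun h0 x)

theorem of_surjective (hM : S.FactorsLE lam M) (q : M →ₗ[A] N) (hq : Function.Surjective q) :
    S.FactorsLE lam N := by
  rw [factorsLE_iff] at *
  intro nu h hh
  obtain ⟨h', hh'⟩ := (S.projective nu).exists_lift q h (fun x => hq _)
  refine hM nu h' (fun h0 => hh ?_)
  ext x
  rw [← hh', h0]; simp

theorem of_exact (hM : S.FactorsLE lam M) (hQ : S.FactorsLE lam Q) (j : M →ₗ[A] N)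
    (q : N →ₗ[A] Q) (hjq : ∀ x, q x = 0 → ∃ y, j y = x) :
    S.FactorsLE lam N := by
  rw [factorsLE_iff] at *
  intro nu h hh
  by_cases h0 : q ∘ₗ h = 0
  · obtain ⟨h', hh'⟩ := (S.projective nu).exists_lift j h
      (fun x => hjq _ (by simpa using LinearMap.congr_fun h0 x))
    refine hM nu h' (fun h0 => hh ?_)
    ext x
    rw [← hh', h0]; simp
  · exact hQ nu _ h0

theorem le_of_injective (hM : S.FactorsLE lam M) {nu : Λ} (j : S.L nu →ₗ[A] M)
    (hj : Function.Injective j) : nu ≤ lam := by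
  rw [factorsLE_iff] at hM
  refine hM nu (j ∘ₗ S.π nu) (fun h0 => ?_)
  obtain ⟨y, hy, -⟩ := S.exists_gen nu
  exact hy (hj (by simpa using LinearMap.congr_fun h0 y))

theorem le_of_ne_zero (hM : S.FactorsLE lam M) {nu : Λ} (q : M →ₗ[A] S.L nu) (hq : q ≠ 0) :
    nu ≤ lam :=
  (hM.of_surjective q (LinearMap.surjective_of_ne_zero hq)).le_of_injective LinearMap.id
    Function.injective_id

end FactorsLE

/-- The infimum defining `stdKer` belongs to its own family: for `nu` not below `lam`, a map `P nu →
Δ(lam)` lifted to `P lam` lands in every member. -/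
theorem factorsLE_std (lam : Λ) : S.FactorsLE lam (S.Std lam) := by
  rw [factorsLE_iff]
  intro nu h hh
  by_contra hle
  apply hh
  obtain ⟨h', hh'⟩ := (S.projective nu).exists_lift (S.stdKer lam).mkQ h
    (fun x => Submodule.mkQ_surjective _ _)
  ext x
  rw [← hh', LinearMap.zero_apply, Submodule.mkQ_apply, Submodule.Quotient.mk_eq_zero, stdKer,
    Submodule.mem_sInf]
  intro N hN
  rw [Set.mem_ofPred_eq, factorsLE_iff] at hN
  by_contra hx
  refine hle (hN nu (N.mkQ ∘ₗ h') (fun h0 => hx ?_))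
  simpa using LinearMap.congr_fun h0 x

theorem stdKer_le {lam : Λ} {N : Submodule A (S.P lam)} (h : S.FactorsLE lam (S.P lam ⧸ N)) :
    S.stdKer lam ≤ N := sInf_le h

theorem stdKer_le_ker {lam : Λ} {M : Type u} [AddCommGroup M] [Module A M]
    (hM : S.FactorsLE lam M) (h : S.P lam →ₗ[A] M) : S.stdKer lam ≤ LinearMap.ker h := by
  apply S.stdKer_le
  exact hM.of_injective ((LinearMap.ker h).liftQ h le_rfl)
    (LinearMap.ker_eq_bot.1 (Submodule.ker_liftQ_eq_bot _ _ _ le_rfl))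

/-- The sum `∇(lam)` is a quotient of the direct sum of its summands; a map from `P nu` lifts there,
and its components can be tested one by one. -/
theorem factorsLE_costdSub (lam : Λ) : S.FactorsLE lam (S.costdSub lam) := by
  rw [factorsLE_iff]
  intro nu h hh
  by_contra hle
  apply hh
  let s := {N : Submodule A (S.I lam) | S.FactorsLE lam N}
  let q : (⨁ N : s, (N : Submodule A (S.I lam))) →ₗ[A] S.I lam :=
    DirectSum.toModule A s _ (fun N => N.1.subtype)
  obtain ⟨h', hh'⟩ := (S.projective nu).exists_lift q ((S.costdSub lam).subtype ∘ₗ h)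
    (fun x => by
      have h1 : ((h x : S.costdSub lam) : S.I lam) ∈ ⨆ N : s, (N : Submodule A (S.I lam)) := by
        rw [← sSup_eq_iSup']; exact (h x).2
      rw [Submodule.mem_iSup_iff_exists_dfinsupp] at h1
      exact h1)
  have h0 : h' = 0 := by
    ext x N
    have hN := N.2
    rw [Set.mem_ofPred_eq, factorsLE_iff] at hN
    by_contra hx
    refine hle (hN nu (DirectSum.component A s _ N ∘ₗ h') (fun h0 => hx ?_))
    exact congrArg Subtype.val (LinearMap.congr_fun h0 x)
  ext x
  have := hh' x
  rw [h0] at this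
  simpa using this.symm

theorem le_costdSub {lam : Λ} {N : Submodule A (S.I lam)} (h : S.FactorsLE lam N) :
    N ≤ S.costdSub lam := le_sSup h

theorem factorsLE_L (lam : Λ) : S.FactorsLE lam (S.L lam) := by
  rw [factorsLE_iff]
  exact fun nu h hh => (S.eq_of_map_ne_zero hh).le

theorem stdKer_le_ker_π (lam : Λ) : S.stdKer lam ≤ LinearMap.ker (S.π lam) :=
  S.stdKer_le_ker (S.factorsLE_L lam) _

theorem range_ι_le (lam : Λ) : LinearMap.range (S.ι lam) ≤ S.costdSub lam :=
  S.le_costdSub ((S.factorsLE_L lam).of_injective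
    (LinearEquiv.ofInjective _ (S.ι_injective lam)).symm.toLinearMap (LinearEquiv.injective _))

end WeightSystem

/-! ### Maps of filtered modules -/

section Filtered

variable {A : Type u} [Ring A]

/-- The radical filtration is generated in degree `0`, so being filtered is a single condition on
the image. -/
theorem ModFiltration.map_mem_of_mem_rad {P M : Type*} [AddCommGroup P] [Module A P]
    [AddCommGroup M] [Module A M] (F : ModFiltration A M) {r : ℤ} {g : P →ₗ[A] M}
    (hg : ∀ x, g x ∈ F.toFun r) {i : ℤ} {x : P} (hx : x ∈ (radFiltration A P).toFun i) :
    g x ∈ F.toFun (i + r) := by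
  refine Submodule.smul_induction_on hx (fun a ha y _ => ?_) (fun y z hy hz => ?_)
  · rw [map_smul]; exact F.smul_mem _ _ _ _ ha (hg y)
  · rw [map_add]; exact add_mem hy hz

theorem radFiltration_map {P M : Type*} [AddCommGroup P] [Module A P]
    [AddCommGroup M] [Module A M] {g : P →ₗ[A] M} (hg : Function.Surjective g) (i : ℤ) :
    ((radFiltration A P).toFun i).map g = (radFiltration A M).toFun i := by
  simp only [radFiltration, Submodule.map_smul'']
  rw [Submodule.map_top, LinearMap.range_eq_top.2 hg]

theorem radFiltration_of_nonpos {P : Type*} [AddCommGroup P] [Module A P] {i : ℤ} (hi : i ≤ 0)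
    (x : P) : x ∈ (radFiltration A P).toFun i := by
  have : i.toNat = 0 := by omega
  simp [radFiltration, radPow, this, Submodule.pow_zero]

theorem radFiltration_le_of_smul {P : Type*} [AddCommGroup P] [Module A P] {N : Submodule A P}
    {i : ℤ} (h : ∀ a ∈ radPow A i, ∀ x : P, a • x ∈ N) : (radFiltration A P).toFun i ≤ N := by
  intro x hx
  exact Submodule.smul_induction_on hx (fun a ha y _ => h a ha y) (fun y z hy hz => add_mem hy hz)

theorem socPow_mono {M : Type*} [AddCommGroup M] [Module A M] {i j : ℕ} (h : i ≤ j) :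
    socPow A M i ≤ socPow A M j :=
  fun _ hx a ha => hx a (Ideal.pow_le_pow_right h ha)

theorem socPow_zero {M : Type*} [AddCommGroup M] [Module A M] {i : ℕ} (h : i = 0) {x : M}
    (hx : x ∈ socPow A M i) : x = 0 := by
  simpa using hx 1 (by simp [h, Submodule.pow_zero])

theorem map_mem_socPow {M N : Type*} [AddCommGroup M] [Module A M] [AddCommGroup N] [Module A N]
    (g : M →ₗ[A] N) {i : ℕ} {x : M} (hx : x ∈ socPow A M i) : g x ∈ socPow A N i := by
  intro a ha
  rw [← map_smul, hx a ha, map_zero]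

/-- Dual to `map_mem_of_mem_rad`: a map into a module with its socle filtration, shifted by `n`, is
filtered as soon as it kills `F^n`. This is why `CostdLifts` asks only for that vanishing. -/
theorem ModFiltration.map_mem_socPow {M N : Type*} [AddCommGroup M] [Module A M]
    [AddCommGroup N] [Module A N] (F : ModFiltration A M) {n : ℤ} {g : M →ₗ[A] N}
    (hg : ∀ x ∈ F.toFun n, g x = 0) {i : ℤ} {x : M} (hx : x ∈ F.toFun i) :
    g x ∈ socPow A N (n - i).toNat := by
  intro a ha
  rw [← map_smul]
  apply hg
  have := F.smul_mem (n - i) i a x ha hx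
  simpa using this

/-- Injectivity in the filtered category: filtered maps to `I` are those killing `F^n`, so the
extension is made over `M / F^n`. -/
theorem Module.Injective.exists_extend_filtered {I M N : Type u} [AddCommGroup I] [Module A I]
    [AddCommGroup M] [Module A M] [AddCommGroup N] [Module A N] (hI : Module.Injective A I)
    (F : ModFiltration A M) (n : ℤ) (j : N →ₗ[A] M) (f : N →ₗ[A] I)
    (hk : ∀ x, j x ∈ F.toFun n → f x = 0) :
    ∃ g : M →ₗ[A] I, (∀ x ∈ F.toFun n, g x = 0) ∧ ∀ x, g (j x) = f x := by
  obtain ⟨g, hg⟩ := hI.exists_extend ((F.toFun n).mkQ ∘ₗ j) f (fun x hx => hk x (by simpa using hx))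
  refine ⟨g ∘ₗ (F.toFun n).mkQ, fun x hx => ?_, hg⟩
  have : (F.toFun n).mkQ x = 0 := by simpa using hx
  rw [LinearMap.comp_apply, this, map_zero]

/-- `N'/N`, with the filtration induced by `F`, is isomorphic to a shift of `D`. -/
def ModFiltration.IsStep {M D : Type*} [AddCommGroup M] [Module A M] [AddCommGroup D] [Module A D]
    (F : ModFiltration A M) (G : ModFiltration A D) (N N' : Submodule A M) : Prop :=
  N ≤ N' ∧ ∃ (s : ℤ) (q : N' →ₗ[A] D), Function.Surjective q ∧ (∀ x, q x = 0 ↔ (x : M) ∈ N) ∧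
    ∀ i d, d ∈ G.toFun (i - s) ↔ ∃ x : N', (x : M) ∈ F.toFun i ∧ q x = d

end Filtered

theorem HasModFiltration.exists_steps {A : Type u} [Ring A] {M : Type v} [AddCommGroup M]
    [Module A M] {Λ : Type w} {D : Λ → Type v} [∀ lam, AddCommGroup (D lam)]
    [∀ lam, Module A (D lam)] {l : List Λ} (h : HasModFiltration (A := A) (M := M) D l) :
    ∃ X : ℕ → Submodule A M, X 0 = ⊥ ∧ X l.length = ⊤ ∧
      ∀ (k : ℕ) (hk : k < l.length), X k ≤ X (k + 1) ∧
        ∃ q : X (k + 1) →ₗ[A] D l[k], Function.Surjective q ∧ ∀ x, q x = 0 ↔ (x : M) ∈ X k := by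
  obtain ⟨X, h0, h1, h2⟩ := h
  refine ⟨X, h0, h1, fun k hk => ⟨(h2 k hk).1, ?_⟩⟩
  obtain ⟨e⟩ := (h2 k hk).2
  refine ⟨e.toLinearMap ∘ₗ Submodule.mkQ _, e.surjective.comp (Submodule.mkQ_surjective _),
    fun x => ?_⟩
  rw [LinearMap.comp_apply, LinearEquiv.coe_coe, e.map_eq_zero_iff, Submodule.mkQ_apply,
    Submodule.Quotient.mk_eq_zero]
  rfl

/-! ### Consequences of quasi-heredity for irreducible subquotients -/

namespace WeightSystem

variable {A : Type u} [Ring A] {Λ : Type w} (S : WeightSystem A Λ)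

theorem exists_map_L_ne_zero (M : Type u) [AddCommGroup M] [Module A M] [Module.Finite A M]
    [Nontrivial M] : ∃ (kap : Λ) (q : M →ₗ[A] S.L kap), q ≠ 0 ∧ Function.Surjective q := by
  obtain ⟨C, hC, -⟩ := (eq_top_or_exists_le_coatom (⊥ : Submodule A M)).resolve_left bot_ne_top
  have hs := isSimpleModule_iff_isCoatom.2 hC
  obtain ⟨kap, ⟨e⟩⟩ := S.complete (M ⧸ C) hs
  have h1 : Function.Surjective (e.toLinearMap ∘ₗ C.mkQ) :=
    e.surjective.comp (Submodule.mkQ_surjective _)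
  refine ⟨kap, _, fun h0 => ?_, h1⟩
  have := IsSimpleModule.nontrivial A (S.L kap)
  obtain ⟨l, hl⟩ := exists_ne (0 : S.L kap)
  obtain ⟨y, rfl⟩ := h1 l
  exact hl (by rw [h0]; rfl)

theorem exists_injective_L [IsArtinianRing A] (M : Type u) [AddCommGroup M] [Module A M]
    [Nontrivial M] : ∃ (kap : Λ) (j : S.L kap →ₗ[A] M), Function.Injective j := by
  obtain ⟨x, hx⟩ := exists_ne (0 : M)
  let N := Submodule.span A {x}
  have : Nontrivial N := ⟨⟨⟨x, Submodule.mem_span_singleton_self x⟩, 0,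
    fun h => hx (congrArg Subtype.val h)⟩⟩
  have : IsArtinian A N := isArtinian_span_of_finite A (Set.finite_singleton x)
  obtain ⟨C, hC, -⟩ := (eq_bot_or_exists_atom_le (⊤ : Submodule A N)).resolve_left top_ne_bot
  have hs := isSimpleModule_iff_isAtom.2 hC
  obtain ⟨kap, ⟨e⟩⟩ := S.complete C hs
  exact ⟨kap, N.subtype ∘ₗ C.subtype ∘ₗ e.symm.toLinearMap, N.injective_subtype.comp
    (C.injective_subtype.comp e.symm.injective)⟩

variable [PartialOrder Λ]

/-- Multiplicity one: nothing in the radical of `Δ kap` is covered by `P kap`. -/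
theorem map_rad_std_eq_zero {K : Type v} [Field K] [Algebra K A] (hA : S.IsQuasiHereditary K)
    {kap : Λ} (h : S.P kap →ₗ[A] S.Std kap)
    (hr : ∀ x, h x ∈ (LinearMap.ker (S.π kap)).map (S.stdKer kap).mkQ) : h = 0 := by
  obtain ⟨f, hf⟩ := LinearMap.exists_factor_of_surjective (S.stdKer kap).mkQ
    (Submodule.mkQ_surjective _) h
    (fun x hx => S.stdKer_le_ker (S.factorsLE_std kap) h (by simpa using hx))
  obtain ⟨c, hc⟩ := (hA kap).1 f
  by_cases hc0 : c = 0
  · ext x; rw [← hf, hc, hc0]; simp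
  · exfalso
    obtain ⟨e, he, -⟩ := S.exists_gen kap
    obtain ⟨y, hy, hxy⟩ := hr (algebraMap K A c⁻¹ • e)
    rw [← hf, hc, map_smul, ← mul_smul, ← map_mul, mul_inv_cancel₀ hc0, map_one, one_smul] at hxy
    have h1 : y - e ∈ S.stdKer kap := (Submodule.Quotient.eq _).1 hxy
    have h2 := sub_mem hy (S.stdKer_le_ker_π kap h1)
    simp only [sub_sub_cancel, LinearMap.mem_ker] at h2
    exact he h2

/-- The multiplicity of `L kap` in `∇(kap)` is also one; this is deduced from the statement for
`Δ(kap)`, since no hypothesis concerns `I` directly. -/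
theorem map_costd_mem_range_ι {K : Type v} [Field K] [Algebra K A] (hA : S.IsQuasiHereditary K)
    {kap : Λ} (h : S.P kap →ₗ[A] S.I kap) (hr : ∀ x, h x ∈ S.costdSub kap) (x : S.P kap) :
    h x ∈ LinearMap.range (S.ι kap) := by
  have hK : ∀ x ∈ S.stdKer kap, h x = 0 := fun x hx => by
    have := S.stdKer_le_ker (S.factorsLE_costdSub kap) (h.codRestrict _ hr) hx
    simpa using congrArg Subtype.val this
  by_cases h0 : ∀ x ∈ LinearMap.ker (S.π kap), h x = 0
  · obtain ⟨l, hl⟩ := LinearMap.exists_factor_of_surjective (S.π kap) (S.π_surjective kap) h h0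
    rcases eq_bot_or_eq_top ((LinearMap.range (S.ι kap)).comap l) with h1 | h1
    · by_contra hx
      have h2 : LinearMap.range l ≠ ⊥ := fun h3 => hx (by
        have : l = 0 := LinearMap.range_eq_bot.1 h3
        rw [← hl, this]; simp)
      obtain ⟨e, he, -⟩ := S.exists_gen kap
      obtain ⟨y, hy⟩ := S.ι_le_of_ne_bot h2 ⟨S.π kap e, rfl⟩
      have h4 : y ∈ (LinearMap.range (S.ι kap)).comap l := ⟨S.π kap e, hy.symm⟩
      rw [h1, Submodule.mem_bot] at h4
      rw [h4, map_zero] at hy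
      exact he (S.ι_injective kap (by rw [← hy, map_zero]))
    · rw [← hl]
      have : S.π kap x ∈ (LinearMap.range (S.ι kap)).comap l := by rw [h1]; trivial
      exact this
  -- Now `h (ker π)` contains the socle, so `ι ∘ π` lifts to `p : P → ker π`. By multiplicity one in
  -- `Δ`, `p` lands in `stdKer`, which `h` kills.
  · exfalso
    push Not at h0
    obtain ⟨x0, hx0, hx0'⟩ := h0
    have h2 : (LinearMap.ker (S.π kap)).map h ≠ ⊥ := fun h3 => hx0' (by
      have : h x0 ∈ (LinearMap.ker (S.π kap)).map h := ⟨x0, hx0, rfl⟩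
      rwa [h3] at this)
    obtain ⟨p, hp⟩ := (S.projective kap).exists_lift (h ∘ₗ (LinearMap.ker (S.π kap)).subtype)
      (S.ι kap ∘ₗ S.π kap) (fun x => by
        obtain ⟨y, hy, hy'⟩ := S.ι_le_of_ne_bot h2 ⟨S.π kap x, rfl⟩
        exact ⟨⟨y, hy⟩, hy'⟩)
    have h3 := S.map_rad_std_eq_zero hA ((S.stdKer kap).mkQ ∘ₗ
      (LinearMap.ker (S.π kap)).subtype ∘ₗ p) (fun x => ⟨p x, (p x).2, rfl⟩)
    obtain ⟨e, he, -⟩ := S.exists_gen kap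
    have h4 : ((p e : LinearMap.ker (S.π kap)) : S.P kap) ∈ S.stdKer kap := by
      simpa using LinearMap.congr_fun h3 e
    have h5 := hp e
    simp only [LinearMap.comp_apply, Submodule.subtype_apply, hK _ h4] at h5
    exact he (S.ι_injective kap (by rw [← h5, map_zero]))

theorem ker_eq_stdKer [IsNoetherianRing A] {mu : Λ} (q : S.P mu →ₗ[A] S.Std mu)
    (hq : Function.Surjective q) (x : S.P mu) : q x = 0 ↔ x ∈ S.stdKer mu := by
  have hle := S.stdKer_le_ker (S.factorsLE_std mu) q
  refine ⟨fun hx => ?_, fun hx => hle hx⟩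
  let f : S.Std mu →ₗ[A] S.Std mu := (S.stdKer mu).liftQ q hle
  have hf : Function.Surjective f := fun y => by
    obtain ⟨x, rfl⟩ := hq y
    exact ⟨(S.stdKer mu).mkQ x, Submodule.liftQ_apply _ _ _⟩
  have hi := IsNoetherian.injective_of_surjective_endomorphism f hf
  have : (S.stdKer mu).mkQ x = 0 := hi (by
    rw [map_zero]; exact (Submodule.liftQ_apply _ _ _).trans hx)
  simpa using this

/-- The irreducible quotients of the kernel of `P mu → Δ mu` are larger than `mu`. -/
theorem lt_of_map_stdKer_ne_zero [IsNoetherianRing A] {K : Type v} [Field K] [Algebra K A]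
    (hA : S.IsQuasiHereditary K) {mu nu : Λ} (q : S.stdKer mu →ₗ[A] S.L nu) (hq : q ≠ 0) :
    mu < nu := by
  by_contra hlt
  obtain ⟨l, hl, hX⟩ := (hA mu).2
  obtain ⟨X, hX0, hXl, hX⟩ := hX.exists_steps
  simp only [List.length_append, List.length_cons, List.length_nil, zero_add] at hXl hX
  have hKX : ∀ x, x ∈ X l.length ↔ x ∈ S.stdKer mu := by
    obtain ⟨-, hp⟩ := hX l.length (by omega)
    have hlast : (l ++ [mu])[l.length]'(by simp) = mu := by simp
    rw [hlast, hXl] at hp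
    obtain ⟨p, hp, hpk⟩ := hp
    let p' : S.P mu →ₗ[A] S.Std mu := p ∘ₗ LinearMap.id.codRestrict ⊤ (fun _ => trivial)
    intro x
    rw [← S.ker_eq_stdKer p' (fun y => by
      obtain ⟨x, rfl⟩ := hp y
      exact ⟨x, rfl⟩)]
    exact (hpk ⟨x, trivial⟩).symm
  -- On a factor `Δ(κ)` of `stdKer mu`, a nonzero map to `L nu` would force `κ = nu`, although `κ >
  -- mu`.
  have hv : ∀ k ≤ l.length, ∀ x : S.stdKer mu, (x : S.P mu) ∈ X k → q x = 0 := by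
    intro k
    induction k with
    | zero =>
      intro _ x hx
      rw [hX0, Submodule.mem_bot] at hx
      rw [show x = 0 from Subtype.ext hx, map_zero]
    | succ k ih =>
      intro hk x hx
      obtain ⟨-, p, hp, hpk⟩ := hX k (by omega)
      have hle : ∀ j, k + 1 ≤ j → j ≤ l.length → X (k + 1) ≤ X j := by
        intro j hj
        induction j, hj using Nat.le_induction with
        | base => exact fun _ => le_rfl
        | succ j hj ih => exact fun h => (ih (by omega)).trans (hX j (by omega)).1
      have hin : ∀ y : X (k + 1), (y : S.P mu) ∈ S.stdKer mu := fun y =>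
        (hKX y).1 (hle l.length hk le_rfl y.2)
      obtain ⟨f, hf⟩ := LinearMap.exists_factor_of_surjective p hp
        (q ∘ₗ (X (k + 1)).subtype.codRestrict _ hin) (fun y hy =>
          ih (by omega) ⟨y, hin y⟩ ((hpk y).1 hy))
      have hf0 : f ∘ₗ (S.stdKer _).mkQ = 0 := by
        by_contra h0
        have h1 := S.eq_of_map_ne_zero h0
        apply hlt
        rw [← h1]
        apply hl
        rw [List.getElem_append_left (by omega)]
        exact List.getElem_mem _
      obtain ⟨z, hz⟩ := Submodule.mkQ_surjective _ (p ⟨x, hx⟩)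
      have h2 := hf ⟨x, hx⟩
      rw [← hz] at h2
      exact h2.symm.trans (LinearMap.congr_fun hf0 z)
  apply hq
  ext x
  exact hv _ le_rfl x ((hKX x).2 x.2)

theorem FactorsLE.mono {lam mu : Λ} (h : lam ≤ mu) {M : Type u} [AddCommGroup M] [Module A M]
    (hM : S.FactorsLE lam M) : S.FactorsLE mu M :=
  fun M'' M' nu hle he => (hM M'' M' nu hle he).trans h

theorem exists_map_stdKer_of_ne_zero [IsNoetherianRing A] {nu lam : Λ} {M : Type u}
    [AddCommGroup M] [Module A M] (hM : S.FactorsLE lam M) (f : S.stdKer nu →ₗ[A] M) (hf : f ≠ 0) :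
    ∃ (kap : Λ) (q : S.stdKer nu →ₗ[A] S.L kap), q ≠ 0 ∧ kap ≤ lam := by
  have : Nontrivial (LinearMap.range f) := by
    rw [Submodule.nontrivial_iff_ne_bot]
    exact fun h => hf (LinearMap.range_eq_bot.1 h)
  obtain ⟨kap, q, hq, -⟩ := S.exists_map_L_ne_zero (LinearMap.range f)
  refine ⟨kap, q ∘ₗ f.rangeRestrict, fun h0 => hq ?_,
    (hM.of_injective (LinearMap.range f).subtype Subtype.val_injective).le_of_ne_zero q hq⟩
  ext x
  obtain ⟨y, rfl⟩ := f.surjective_rangeRestrict x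
  exact LinearMap.congr_fun h0 y

/-- `L nu ⊆ I mu / ∇ mu` implies `mu < nu`. -/
theorem lt_of_map_costd [IsNoetherianRing A] {K : Type v} [Field K] [Algebra K A]
    (hA : S.IsQuasiHereditary K) {mu nu : Λ} (h : S.P nu →ₗ[A] S.I mu)
    (h0 : ∃ x, h x ∉ S.costdSub mu) (h1 : ∀ x ∈ LinearMap.ker (S.π nu), h x ∈ S.costdSub mu) :
    mu < nu := by
  -- If `nu ≤ mu`, the image of `h` is an extension of a quotient of `L nu` by a submodule of
  -- `∇(mu)`, hence lies in `∇(mu)` by maximality.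
  have key : ¬ nu ≤ mu := fun hle => by
    obtain ⟨x, hx⟩ := h0
    apply hx
    refine S.le_costdSub (N := LinearMap.range h) ?_ ⟨x, rfl⟩
    let g := (S.costdSub mu).mkQ ∘ₗ h
    obtain ⟨t, ht⟩ := LinearMap.exists_factor_of_surjective (S.π nu) (S.π_surjective nu)
      g.rangeRestrict (fun x hx => Subtype.ext (by simpa [g] using h1 x hx))
    have hQ : S.FactorsLE mu (LinearMap.range g) :=
      ((S.factorsLE_L nu).mono S hle).of_surjective t (fun y => by
        obtain ⟨x, rfl⟩ := g.surjective_rangeRestrict y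
        exact ⟨_, ht x⟩)
    have hM : S.FactorsLE mu (LinearMap.range h ⊓ S.costdSub mu : Submodule A (S.I mu)) :=
      (S.factorsLE_costdSub mu).of_injective (Submodule.inclusion inf_le_right)
        (Submodule.inclusion_injective _)
    refine hM.of_exact hQ (Submodule.inclusion inf_le_left)
      (((S.costdSub mu).mkQ ∘ₗ (LinearMap.range h).subtype).codRestrict _ ?_) ?_
    · rintro ⟨_, y, rfl⟩; exact ⟨y, rfl⟩
    · rintro ⟨y, hy⟩ hxy
      have := congrArg Subtype.val hxy
      exact ⟨⟨y, hy, by simpa using this⟩, rfl⟩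
  -- Either the image of `h` is a quotient of `Δ(nu)` containing `L mu`, or `stdKer nu` maps
  -- nontrivially to `∇(mu)`; the latter yields some `kap` with `nu < kap ≤ mu`, against `key`.
  by_cases hK : ∀ x ∈ S.stdKer nu, h x = 0
  · obtain ⟨t, ht⟩ := LinearMap.exists_factor_of_surjective (S.stdKer nu).mkQ
      (Submodule.mkQ_surjective _) h (fun x hx => hK x (by simpa using hx))
    have hR : LinearMap.range t ≠ ⊥ := fun hb => by
      obtain ⟨x, hx⟩ := h0
      rw [LinearMap.range_eq_bot] at hb
      rw [← ht, hb] at hx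
      exact hx (zero_mem _)
    have hle : mu ≤ nu := ((S.factorsLE_std nu).of_surjective t.rangeRestrict
      t.surjective_rangeRestrict).le_of_injective
        ((S.ι mu).codRestrict _ (fun x => S.ι_le_of_ne_bot hR ⟨x, rfl⟩))
        (fun x y hxy => S.ι_injective mu (congrArg Subtype.val hxy))
    exact lt_of_le_of_ne hle (fun h => key h.ge)
  · exfalso
    let f : S.stdKer nu →ₗ[A] S.costdSub mu := (h ∘ₗ (S.stdKer nu).subtype).codRestrict _
      (fun x => h1 x (S.stdKer_le_ker_π nu x.2))
    obtain ⟨kap, q, hq, hle⟩ := S.exists_map_stdKer_of_ne_zero (S.factorsLE_costdSub mu) f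
      (fun h2 => hK (fun x hx => congrArg Subtype.val (LinearMap.congr_fun h2 ⟨x, hx⟩)))
    exact key ((S.lt_of_map_stdKer_ne_zero hA q hq).le.trans hle)

end WeightSystem

/-! ### Vanishing of filtered `Ext¹` and its behaviour in filtrations -/

namespace WeightSystem

variable {A : Type u} [Ring A] {Λ : Type w} (S : WeightSystem A Λ) [PartialOrder Λ]

/-- `Ext¹(Δ mu, M) = 0` for the filtered module `M` and all shifts of all `Δ mu`: filtered maps
from the kernel of `P mu → Δ mu` extend to `P mu`. -/
def StdExtends {M : Type u} [AddCommGroup M] [Module A M] (F : ModFiltration A M) : Prop :=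
  ∀ (mu : Λ) (r : ℤ) (f : S.stdKer mu →ₗ[A] M),
    (∀ (i : ℤ) (x : S.stdKer mu), (x : S.P mu) ∈ (radFiltration A (S.P mu)).toFun i →
      f x ∈ F.toFun (i + r)) →
    ∃ g : S.P mu →ₗ[A] M, (∀ x, g x ∈ F.toFun r) ∧ ∀ x : S.stdKer mu, g x = f x

/-- `Ext¹(M, ∇ mu) = 0` for the filtered module `M` and all shifts of all `∇ mu`: filtered maps
from `M` to `I mu / ∇ mu` lift to `I mu`. -/
def CostdLifts {M : Type u} [AddCommGroup M] [Module A M] (F : ModFiltration A M) : Prop :=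
  ∀ (mu : Λ) (n : ℤ) (f : M →ₗ[A] S.I mu ⧸ S.costdSub mu),
    (∀ (i : ℤ), ∀ x ∈ F.toFun i,
      ∃ y ∈ socPow A (S.I mu) (n - i).toNat, (S.costdSub mu).mkQ y = f x) →
    ∃ g : M →ₗ[A] S.I mu, (∀ x ∈ F.toFun n, g x = 0) ∧ ∀ x, (S.costdSub mu).mkQ (g x) = f x

section

variable {S} {K : Type v} [Field K] [Algebra K A]

/-- Filtered `Ext¹(Δ(mu), ∇(lam)) = 0`. A nonzero `f` forces `mu < lam`; then any extension of `f`
to `I lam` has image an extension of a quotient of `Δ(mu)` by part of `∇(lam)`, so it stays in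
`∇(lam)`. -/
theorem IsQuasiHereditary.extend_costd [IsNoetherianRing A] (hA : S.IsQuasiHereditary K)
    {mu lam : Λ} (n : ℤ)
    (f : S.stdKer mu →ₗ[A] S.I lam) (hf : ∀ x, f x ∈ S.costdSub lam)
    (hn : ∀ x : S.stdKer mu, (x : S.P mu) ∈ (radFiltration A (S.P mu)).toFun n → f x = 0) :
    ∃ g : S.P mu →ₗ[A] S.I lam, (∀ x, g x ∈ S.costdSub lam) ∧
      (∀ x ∈ (radFiltration A (S.P mu)).toFun n, g x = 0) ∧ ∀ x : S.stdKer mu, g x = f x := by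
  by_cases h0 : f = 0
  · exact ⟨0, fun x => zero_mem _, fun _ _ => rfl, fun x => by rw [h0]; rfl⟩
  obtain ⟨g, hg0, hg⟩ := (S.injective lam).exists_extend_filtered (radFiltration A (S.P mu)) n
    (S.stdKer mu).subtype f hn
  refine ⟨g, fun x => ?_, hg0, hg⟩
  obtain ⟨kap, q, hq, hle⟩ := S.exists_map_stdKer_of_ne_zero (S.factorsLE_costdSub lam)
    (f.codRestrict _ hf) (fun h => h0 (by
      ext x; exact congrArg Subtype.val (LinearMap.congr_fun h x)))
  have hlt := (S.lt_of_map_stdKer_ne_zero hA q hq).le.trans hle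
  refine S.le_costdSub (N := LinearMap.range g) ?_ ⟨x, rfl⟩
  have hM : S.FactorsLE lam (LinearMap.range g ⊓ S.costdSub lam : Submodule A (S.I lam)) :=
    (S.factorsLE_costdSub lam).of_injective (Submodule.inclusion inf_le_right)
      (Submodule.inclusion_injective _)
  let k := (S.costdSub lam).mkQ ∘ₗ g
  obtain ⟨t, ht⟩ := LinearMap.exists_factor_of_surjective (S.stdKer mu).mkQ
    (Submodule.mkQ_surjective _) k.rangeRestrict (fun x hx => Subtype.ext (by
      have : x ∈ S.stdKer mu := by simpa using hx
      have h1 := hg ⟨x, this⟩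
      simp only [Submodule.subtype_apply] at h1
      simpa [k, h1] using hf ⟨x, this⟩))
  have hQ : S.FactorsLE lam (LinearMap.range k) :=
    ((S.factorsLE_std mu).mono S hlt).of_surjective t (fun y => by
      obtain ⟨x, rfl⟩ := k.surjective_rangeRestrict y
      exact ⟨_, ht x⟩)
  refine hM.of_exact hQ (Submodule.inclusion inf_le_left)
    (((S.costdSub lam).mkQ ∘ₗ (LinearMap.range g).subtype).codRestrict _ ?_) ?_
  · rintro ⟨_, y, rfl⟩; exact ⟨y, rfl⟩
  · rintro ⟨y, hy⟩ hxy
    have := congrArg Subtype.val hxy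
    exact ⟨⟨y, hy, by simpa using this⟩, rfl⟩

/-- The same vanishing computed from the injective side: lift over `P lam`, then correct by
`extend_costd` so that `stdKer lam` is killed. -/
theorem IsQuasiHereditary.costdLifts_std [IsNoetherianRing A] (hA : S.IsQuasiHereditary K)
    (lam : Λ) :
    S.CostdLifts (radFiltration A (S.Std lam)) := by
  intro mu n f hf
  -- Lifting into `soc^n` makes `h` kill `rad^n`, which is the required filteredness.
  obtain ⟨h, hh⟩ := (S.projective lam).exists_lift
    ((S.costdSub mu).mkQ ∘ₗ (socPow A (S.I mu) n.toNat).subtype) (f ∘ₗ (S.stdKer lam).mkQ)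
    (fun x => by
      obtain ⟨y, hy, hxy⟩ := hf 0 ((S.stdKer lam).mkQ x) (radFiltration_of_nonpos le_rfl _)
      rw [sub_zero] at hy
      exact ⟨⟨y, hy⟩, hxy⟩)
  have hn : (radFiltration A (S.P lam)).toFun n ≤ LinearMap.ker h :=
    radFiltration_le_of_smul (fun a ha x => by
      rw [LinearMap.mem_ker, map_smul]
      exact Subtype.ext ((h x).2 a ha))
  obtain ⟨g, hg1, hg2, hg3⟩ := hA.extend_costd n
    ((socPow A (S.I mu) n.toNat).subtype ∘ₗ h ∘ₗ (S.stdKer lam).subtype) (fun x => by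
      have h1 := hh x
      have h2 : (S.stdKer lam).mkQ (x : S.P lam) = 0 := by simp
      rw [LinearMap.comp_apply, LinearMap.comp_apply, h2, map_zero] at h1
      simpa using h1)
    (fun x hx => congrArg Subtype.val (hn hx))
  obtain ⟨t, ht⟩ := LinearMap.exists_factor_of_surjective (S.stdKer lam).mkQ
    (Submodule.mkQ_surjective _) ((socPow A (S.I mu) n.toNat).subtype ∘ₗ h - g) (fun x hx => by
      have : x ∈ S.stdKer lam := by simpa using hx
      have h1 := hg3 ⟨x, this⟩
      rw [LinearMap.sub_apply, h1]
      simp)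
  refine ⟨t, fun x hx => ?_, fun x => ?_⟩
  · rw [← radFiltration_map (Submodule.mkQ_surjective (S.stdKer lam))] at hx
    obtain ⟨y, hy, rfl⟩ := hx
    rw [ht, LinearMap.sub_apply, hg2 y hy, LinearMap.comp_apply, hn hy]
    simp
  · obtain ⟨y, rfl⟩ := Submodule.mkQ_surjective _ x
    have h1 := hh y
    have h2 : (S.costdSub mu).mkQ (g y) = 0 := by simpa using hg1 y
    rw [ht, LinearMap.sub_apply, map_sub, h2, sub_zero]
    exact h1

/-- The middle term of the long exact sequence for `N → N' → D`. Strictness of `q` is what makes the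
induced map on `D` filtered. -/
theorem CostdLifts.of_step {M D : Type u} [AddCommGroup M] [Module A M] [AddCommGroup D]
    [Module A D] {F : ModFiltration A M} {G : ModFiltration A D} {N N' : Submodule A M}
    (hstep : F.IsStep G N N') (hN : S.CostdLifts (F.sub N)) (hG : S.CostdLifts G) :
    S.CostdLifts (F.sub N') := by
  obtain ⟨hle, s, q, hq, hker, hstrict⟩ := hstep
  intro mu n f hf
  obtain ⟨g, hg0, hg⟩ := hN mu n (f ∘ₗ Submodule.inclusion hle) (fun i x hx => hf i _ hx)
  obtain ⟨g', hg0', hg'⟩ := (S.injective mu).exists_extend_filtered (F.sub N') n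
    (Submodule.inclusion hle) g (fun x hx => hg0 x hx)
  obtain ⟨t, ht⟩ := LinearMap.exists_factor_of_surjective q hq (f - (S.costdSub mu).mkQ ∘ₗ g')
    (fun x hx => by
      have h1 := hg ⟨x, (hker x).1 hx⟩
      rw [← hg'] at h1
      rw [LinearMap.sub_apply, LinearMap.comp_apply, sub_eq_zero]
      exact h1.symm)
  obtain ⟨l, hl0, hl⟩ := hG mu (n - s) t (fun i d hd => by
    obtain ⟨x, hx, rfl⟩ := (hstrict (i + s) d).1 (by simpa using hd)
    obtain ⟨y, hy, hxy⟩ := hf (i + s) x hx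
    have h2 := (F.sub N').map_mem_socPow hg0' (i := i + s) (x := x) hx
    rw [show n - s - i = n - (i + s) by ring]
    exact ⟨y - g' x, sub_mem hy h2, by rw [ht, map_sub, hxy]; rfl⟩)
  refine ⟨g' + l ∘ₗ q, fun x hx => ?_, fun x => ?_⟩
  · rw [LinearMap.add_apply, hg0' x hx, LinearMap.comp_apply,
      hl0 _ ((hstrict n _).2 ⟨x, hx, rfl⟩), add_zero]
  · rw [LinearMap.add_apply, map_add, LinearMap.comp_apply, hl, ht, LinearMap.sub_apply]
    simp

theorem CostdLifts.of_subsingleton {M : Type u} [AddCommGroup M] [Module A M] [Subsingleton M]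
    (F : ModFiltration A M) : S.CostdLifts F :=
  fun _ _ _ _ => ⟨0, fun _ _ => rfl, fun x => by rw [Subsingleton.elim x 0]; simp⟩

theorem CostdLifts.of_steps [IsNoetherianRing A] (hA : S.IsQuasiHereditary K) {M : Type u}
    [AddCommGroup M] [Module A M] (F : ModFiltration A M) (X : ℕ → Submodule A M) (l : List Λ)
    (h0 : X 0 = ⊥)
    (hX : ∀ (k : ℕ) (hk : k < l.length),
      F.IsStep (radFiltration A (S.Std l[k])) (X k) (X (k + 1))) (k : ℕ) (hk : k ≤ l.length) :
    S.CostdLifts (F.sub (X k)) := by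
  induction k with
  | zero => rw [h0]; exact CostdLifts.of_subsingleton _
  | succ k ih => exact .of_step (hX k hk) (ih (by omega)) (hA.costdLifts_std _)

end

end WeightSystem

/-- A chain of submodules from `N` to `N'` with filtered subquotients as in the list. -/
inductive ModFiltration.Chain {A : Type u} [Ring A] {M : Type v} [AddCommGroup M] [Module A M]
    {Λ : Type w} {D : Λ → Type v} [∀ lam, AddCommGroup (D lam)] [∀ lam, Module A (D lam)]
    (F : ModFiltration A M) (G : ∀ lam, ModFiltration A (D lam)) :
    Submodule A M → List Λ → Submodule A M → Prop
  | nil (N : Submodule A M) : Chain F G N [] N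
  | cons {N N' N'' : Submodule A M} {lam : Λ} {l : List Λ} :
      F.IsStep (G lam) N N' → Chain F G N' l N'' → Chain F G N (lam :: l) N''

namespace ModFiltration.Chain

variable {A : Type u} [Ring A] {M : Type v} [AddCommGroup M] [Module A M]
  {Λ : Type w} {D : Λ → Type v} [∀ lam, AddCommGroup (D lam)] [∀ lam, Module A (D lam)]
  {F : ModFiltration A M} {G : ∀ lam, ModFiltration A (D lam)} {N N' N'' : Submodule A M}

/-- Costandard filtrations grow upwards from `⊥` by this lemma; standard ones grow downwards from
`⊤` by `cons`. -/
theorem snoc {lam : Λ} {l : List Λ} (h : F.Chain G N l N') (hs : F.IsStep (G lam) N' N'') :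
    F.Chain G N (l ++ [lam]) N'' := by
  induction h with
  | nil => exact .cons hs (.nil _)
  | cons h1 _ ih => exact .cons h1 (ih hs)

theorem exists_steps {l : List Λ} (h : F.Chain G N l N') :
    ∃ X : ℕ → Submodule A M, X 0 = N ∧ X l.length = N' ∧
      ∀ (k : ℕ) (hk : k < l.length), F.IsStep (G l[k]) (X k) (X (k + 1)) := by
  induction h with
  | nil N => exact ⟨fun _ => N, rfl, rfl, fun k hk => absurd hk (by simp)⟩
  | @cons N N' N'' lam l h1 _ ih =>
    obtain ⟨X, h0, hl, hX⟩ := ih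
    refine ⟨fun k => Nat.casesOn k N X, rfl, hl, fun k hk => ?_⟩
    cases k with
    | zero => simpa [h0] using h1
    | succ k => exact hX k (by simpa using hk)

end ModFiltration.Chain

/-! ### Filtrations of Rees modules -/

namespace Rees

variable {A : Type u} [Ring A] {M : Type v} [AddCommGroup M] [Module A M]
  {F : ModFiltration A M}

theorem of_smul_of (i j : ℤ) (a : radPow A i) (m : F.toFun j) :
    (DirectSum.of (fun i => radPow A i) i a • DirectSum.of (fun i => F.toFun i) j m : Rees F) =
      DirectSum.of (fun i => F.toFun i) (i + j)
        ⟨(a : A) • (m : M), F.smul_mem i j a m a.2 m.2⟩ :=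
  DirectSum.Gmodule.of_smul_of _ _ _ _

theorem of_smul_apply (i k : ℤ) (a : radPow A i) (x : Rees F) :
    (((DirectSum.of (fun i => radPow A i) i a • x : Rees F) k : F.toFun k) : M) =
      (a : A) • (x (k - i) : M) := by
  induction x using DirectSum.induction_on with
  | zero => simp
  | of j m =>
    rw [of_smul_of, DirectSum.coe_of_apply, DirectSum.coe_of_apply]
    by_cases h : i + j = k
    · rw [if_pos h, if_pos (by omega)]
    · rw [if_neg h, if_neg (by omega)]; simp
  | add x y hx hy =>
    rw [smul_add, DirectSum.add_apply, DirectSum.add_apply]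
    simp only [Submodule.coe_add, hx, hy, smul_add]

theorem of_smul_mem {X : Submodule (ReesAlgebra A) (Rees F)} {i j k : ℤ} {m : M}
    {hm : m ∈ F.toFun j} (h : DirectSum.of (fun i => F.toFun i) j ⟨m, hm⟩ ∈ X) {a : A}
    (ha : a ∈ radPow A i) (hk : k = i + j) (hm' : a • m ∈ F.toFun k) :
    DirectSum.of (fun i => F.toFun i) k ⟨a • m, hm'⟩ ∈ X := by
  subst hk
  have := X.smul_mem (DirectSum.of (fun i => radPow A i) i ⟨a, ha⟩) h
  rwa [of_smul_of] at this

theorem one_mem_radPow {i : ℤ} (hi : i ≤ 0) : (1 : A) ∈ radPow A i := by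
  have : i.toNat = 0 := by omega
  simp [radPow, this, Submodule.pow_zero]

/-- Multiplication by `1`, placed in the nonpositive degree `k - j`, lowers degrees. -/
theorem of_mem_of_le {X : Submodule (ReesAlgebra A) (Rees F)} {j k : ℤ} {m : M}
    {hm : m ∈ F.toFun j} (h : DirectSum.of (fun i => F.toFun i) j ⟨m, hm⟩ ∈ X) (hk : k ≤ j)
    (hm' : m ∈ F.toFun k) : DirectSum.of (fun i => F.toFun i) k ⟨m, hm'⟩ ∈ X := by
  have := of_smul_mem (i := k - j) (k := k) h (one_mem_radPow (by omega)) (by ring)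
    (by rwa [one_smul])
  simpa using this

/-- The submodule of `M` of all elements that occur in a submodule of `Rees F`. -/
def underlying (X : Submodule (ReesAlgebra A) (Rees F)) : Submodule A M where
  carrier := {m | ∃ (i : ℤ) (h : m ∈ F.toFun i), DirectSum.of (fun i => F.toFun i) i ⟨m, h⟩ ∈ X}
  zero_mem' := ⟨0, zero_mem _, by
    rw [show (⟨0, zero_mem _⟩ : F.toFun 0) = 0 from rfl, map_zero]; exact zero_mem _⟩
  add_mem' := by
    rintro m m' ⟨i, h, hi⟩ ⟨j, h', hj⟩
    have h1 := of_mem_of_le hi (min_le_left i j) (F.antitone (min_le_left i j) h)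
    have h2 := of_mem_of_le hj (min_le_right i j) (F.antitone (min_le_right i j) h')
    refine ⟨min i j, add_mem (F.antitone (min_le_left i j) h)
      (F.antitone (min_le_right i j) h'), ?_⟩
    have := add_mem h1 h2
    rwa [← map_add] at this
  smul_mem' := by
    rintro a m ⟨i, h, hi⟩
    exact ⟨i, Submodule.smul_mem _ _ h,
      of_smul_mem hi (i := 0) (by simp [radPow, Submodule.pow_zero]) (by ring) _⟩

/-- Homogeneous elements of `F` that occur in `X` in some degree occur in all possible degrees. -/
def IsSaturated (X : Submodule (ReesAlgebra A) (Rees F)) : Prop :=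
  ∀ (i : ℤ) (m : M) (h : m ∈ F.toFun i), m ∈ underlying X →
    DirectSum.of (fun i => F.toFun i) i ⟨m, h⟩ ∈ X

end Rees

theorem ModFiltration.exists_mem {A : Type u} [Ring A] {M : Type v} [AddCommGroup M] [Module A M]
    (F : ModFiltration A M) (m : M) : ∃ i, m ∈ F.toFun i := by
  have : m ∈ ⨆ i, F.toFun i := by rw [F.iSup_eq_top]; trivial
  rwa [Submodule.mem_iSup_of_directed _ F.antitone.directed_le] at this

theorem ModFiltration.exists_mem_pair {A : Type u} [Ring A] {M : Type v} [AddCommGroup M]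
    [Module A M] (F : ModFiltration A M) (m m' : M) : ∃ i, m ∈ F.toFun i ∧ m' ∈ F.toFun i := by
  obtain ⟨i, hi⟩ := F.exists_mem m
  obtain ⟨j, hj⟩ := F.exists_mem m'
  exact ⟨min i j, F.antitone (min_le_left i j) hi, F.antitone (min_le_right i j) hj⟩

namespace Rees

variable {A : Type u} [Ring A] {M : Type v} [AddCommGroup M] [Module A M]
  {F : ModFiltration A M} {D : Type v} [AddCommGroup D] [Module A D] {G : ModFiltration A D}
  {X Y : Submodule (ReesAlgebra A) (Rees F)}

theorem eq_of_isHomogeneous {i : ℤ} {x : Rees F} (hx : IsHomogeneousOfDegree i x) :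
    x = DirectSum.of (fun i => F.toFun i) i (x i) := by
  obtain ⟨m, rfl⟩ := hx
  rw [DirectSum.of_eq_same]

theorem apply_of_isHomogeneous {i j : ℤ} (hij : j ≠ i) {x : Rees F}
    (hx : IsHomogeneousOfDegree i x) : x j = 0 := by
  obtain ⟨m, rfl⟩ := hx
  exact DirectSum.of_eq_of_ne _ _ _ hij

/-- Linearity over `1` in degree `j - i`: the value of `f` on `m` does not depend on the degree in
which `m` is placed. -/
theorem map_of_of_le (f : X →ₗ[ReesAlgebra A] Rees G) {i j : ℤ} (hij : j ≤ i) {m : M}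
    (hi : m ∈ F.toFun i) (hj : m ∈ F.toFun j)
    (hX : DirectSum.of (fun i => F.toFun i) i ⟨m, hi⟩ ∈ X)
    (hX' : DirectSum.of (fun i => F.toFun i) j ⟨m, hj⟩ ∈ X) :
    ((f ⟨_, hX'⟩ j : G.toFun j) : D) = f ⟨_, hX⟩ i := by
  let t : ReesAlgebra A :=
    DirectSum.of (fun i => radPow A i) (j - i) ⟨1, one_mem_radPow (by omega)⟩
  have h1 : (⟨_, hX'⟩ : X) = t • ⟨_, hX⟩ := by
    refine Subtype.ext ?_
    rw [Submodule.coe_smul]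
    simp only [t, of_smul_of]
    refine DirectSum.ext fun k => Subtype.ext ?_
    rw [DirectSum.coe_of_apply, DirectSum.coe_of_apply]
    by_cases h : j = k
    · rw [if_pos h, if_pos (by omega)]; simp
    · rw [if_neg h, if_neg (by omega)]; rfl
  rw [h1, map_smul]
  simp only [t]
  rw [of_smul_apply, one_smul, show j - (j - i) = i by ring]

theorem map_apply (hX : IsGradedSubmodule X) (f : X →ₗ[ReesAlgebra A] Rees G)
    (hf : ∀ (x : X) (i : ℤ), IsHomogeneousOfDegree i (x : Rees F) → IsHomogeneousOfDegree i (f x))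
    (x : X) (i : ℤ) : f x i = f ⟨_, hX x x.2 i⟩ i := by
  classical
  have h1 : x = ∑ j ∈ (x : Rees F).support, ⟨_, hX x x.2 j⟩ := by
    refine Subtype.ext ?_
    rw [AddSubmonoidClass.coe_finsetSum]
    exact (DirectSum.sum_support_of _).symm
  conv_lhs => rw [h1]
  rw [map_sum, DirectSum.sum_apply]
  refine Finset.sum_eq_single i (fun j _ hj => ?_) (fun hi => ?_)
  · exact apply_of_isHomogeneous hj.symm (hf _ _ ⟨_, rfl⟩)
  · have h2 : (x : Rees F) i = 0 := by simpa using hi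
    have h3 : (⟨_, hX x x.2 i⟩ : X) = 0 := Subtype.ext (by simp [h2])
    rw [h3, map_zero]; rfl

/-- Lowering of degrees is injective on `Rees G`, so an element of `X` that falls into `Y` in a
lower degree already lay in `Y`. -/
theorem IsSaturated.of_subquotIso (hYX : Y ≤ X) (hX : IsSaturated X) (h : SubquotIso Y X G) :
    IsSaturated Y := by
  obtain ⟨f, -, hker, hf⟩ := h
  rintro i m hi ⟨j, hj, hm⟩
  have h1 := hX i m hi ⟨j, hj, hYX hm⟩
  refine (hker ⟨_, h1⟩).1 ?_
  rw [eq_of_isHomogeneous (hf _ _ ⟨_, rfl⟩)]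
  suffices h : f ⟨_, h1⟩ i = 0 by rw [h, map_zero]
  rcases le_total i j with hij | hij
  · rw [(hker ⟨_, h1⟩).2 (of_mem_of_le hm hij hi)]; rfl
  · have h2 := map_of_of_le f hij hi hj h1 (hYX hm)
    rw [(hker ⟨_, hYX hm⟩).2 hm] at h2
    exact Subtype.ext h2.symm

/-- Dehomogenize: `q m` is the value of `f` on `m` placed in any admissible degree. Saturation of
`X` makes every such placement available, and surjectivity in each degree gives strictness. -/
theorem isStep_of_subquotIso (hYX : Y ≤ X) (hgX : IsGradedSubmodule X) (hX : IsSaturated X)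
    {s : ℤ} (h : SubquotIso Y X (G.shift s)) : F.IsStep G (underlying Y) (underlying X) := by
  have hY := hX.of_subquotIso hYX h
  obtain ⟨f, hsurj, hker, hf⟩ := h
  refine ⟨fun m ⟨i, hi, hm⟩ => ⟨i, hi, hYX hm⟩, s, ?_⟩
  choose c hc using F.exists_mem
  let q0 : underlying X → D := fun m => f ⟨_, hX (c m) m (hc m) m.2⟩ (c m)
  have hq0 : ∀ (m : underlying X) (i : ℤ) (hi : (m : M) ∈ F.toFun i),
      q0 m = f ⟨_, hX i m hi m.2⟩ i := by
    intro m i hi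
    rcases le_total i (c m) with h | h
    · exact (map_of_of_le f h _ _ _ _).symm
    · exact map_of_of_le f h _ _ _ _
  let q : underlying X →ₗ[A] D :=
    { toFun := q0
      map_add' := fun m m' => by
        obtain ⟨i, hi, hi'⟩ := F.exists_mem_pair m m'
        rw [hq0 m i hi, hq0 m' i hi', hq0 (m + m') i (add_mem hi hi'), ← Submodule.coe_add,
          ← DirectSum.add_apply, ← map_add]
        congr 3
        refine Subtype.ext ?_
        exact map_add _ (⟨_, hi⟩ : F.toFun i) ⟨_, hi'⟩
      map_smul' := fun a m => by
        obtain ⟨i, hi⟩ := F.exists_mem m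
        have ha : a ∈ radPow A 0 := by simp [radPow, Submodule.pow_zero]
        have h1 := F.smul_mem 0 i a m ha hi
        have h2 : (⟨_, hX (0 + i) (a • m : underlying X) h1 (a • m).2⟩ : X) =
            DirectSum.of (fun i => radPow A i) 0 ⟨a, ha⟩ • ⟨_, hX i m hi m.2⟩ := by
          refine Subtype.ext ?_
          exact (of_smul_of (F := F) 0 i ⟨a, ha⟩ ⟨(m : M), hi⟩).symm
        rw [hq0 m i hi, hq0 (a • m) (0 + i) h1, h2, map_smul, of_smul_apply,
          show 0 + i - 0 = i by ring]
        rfl }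
  have hq : ∀ (m : underlying X) (i : ℤ) (hi : (m : M) ∈ F.toFun i),
      q m = f ⟨_, hX i m hi m.2⟩ i := hq0
  have hstrict : ∀ i d, d ∈ G.toFun (i - s) ↔
      ∃ x : underlying X, (x : M) ∈ F.toFun i ∧ q x = d := by
    intro i d
    constructor
    · intro hd
      obtain ⟨x, hx⟩ := hsurj (DirectSum.of (fun i => (G.shift s).toFun i) i ⟨d, hd⟩)
      have h1 := hgX x x.2 i
      refine ⟨⟨(x : Rees F) i, i, ((x : Rees F) i).2, h1⟩, ((x : Rees F) i).2, ?_⟩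
      rw [hq _ i ((x : Rees F) i).2]
      have h2 := map_apply hgX f hf x i
      rw [hx, DirectSum.of_eq_same] at h2
      exact (congrArg Subtype.val h2).symm
    · rintro ⟨x, hx, rfl⟩
      rw [hq x i hx]
      exact (f _ i).2
  refine ⟨q, fun d => ?_, fun m => ?_, hstrict⟩
  · obtain ⟨i, hi⟩ := (G.shift s).exists_mem d
    obtain ⟨x, -, hx⟩ := (hstrict i d).1 hi
    exact ⟨x, hx⟩
  · obtain ⟨i, hi⟩ := F.exists_mem m
    rw [hq m i hi]
    have h1 : f ⟨_, hX i m hi m.2⟩ = 0 ↔ _ := hker _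
    have h2 := eq_of_isHomogeneous (hf ⟨_, hX i m hi m.2⟩ i ⟨_, rfl⟩)
    constructor
    · intro h0
      rw [show f ⟨_, hX i m hi m.2⟩ i = 0 from Subtype.ext h0, map_zero] at h2
      exact ⟨i, hi, h1.1 h2⟩
    · intro hm
      rw [h1.2 (hY i m hi hm)]; rfl

theorem HasFiltration.exists_steps {Λ : Type w} {D : Λ → Type v} [∀ lam, AddCommGroup (D lam)]
    [∀ lam, Module A (D lam)] {G : ∀ lam, ModFiltration A (D lam)} {l : List Λ}
    (h : HasFiltration F G l) :
    ∃ X : ℕ → Submodule A M, X 0 = ⊥ ∧ X l.length = ⊤ ∧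
      ∀ (k : ℕ) (hk : k < l.length), F.IsStep (G l[k]) (X k) (X (k + 1)) := by
  obtain ⟨X, h0, hl, hg, hX⟩ := h
  -- Saturation is clear at the top and descends, since each factor is torsion-free.
  have hsat : ∀ k ≤ l.length, IsSaturated (X k) := by
    intro k hk
    induction hk using Nat.decreasingInduction with
    | of_succ k hk ih =>
      obtain ⟨s, hs⟩ := (hX k hk).2
      exact ih.of_subquotIso (hX k hk).1 hs
    | self => rw [hl]; exact fun _ _ _ _ => trivial
  refine ⟨fun k => underlying (X k), ?_, ?_, fun k hk => ?_⟩
  · rw [eq_bot_iff]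
    rintro m ⟨i, hi, hm⟩
    rw [h0, Submodule.mem_bot] at hm
    have := DirectSum.of_injective (β := fun i => F.toFun i) i (hm.trans (map_zero _).symm)
    exact congrArg Subtype.val this
  · rw [eq_top_iff]
    rintro m -
    obtain ⟨i, hi⟩ := F.exists_mem m
    exact ⟨i, hi, by rw [hl]; trivial⟩
  · obtain ⟨hle, s, hs⟩ := hX k hk
    exact isStep_of_subquotIso hle (hg _) (hsat _ hk) hs

/-- The submodule of `Rees F` of elements with components in `N`. -/
def ofSubmodule (F : ModFiltration A M) (N : Submodule A M) :
    Submodule (ReesAlgebra A) (Rees F) where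
  carrier := {x | ∀ i, (x i : M) ∈ N}
  zero_mem' := fun _ => zero_mem _
  add_mem' := fun hx hy i => by
    rw [DirectSum.add_apply, Submodule.coe_add]; exact add_mem (hx i) (hy i)
  smul_mem' := by
    intro r x hx
    induction r using DirectSum.induction_on with
    | zero => intro i; rw [zero_smul]; exact zero_mem _
    | of j a => intro i; rw [of_smul_apply]; exact N.smul_mem _ (hx _)
    | add r r' h h' =>
      intro i
      rw [add_smul, DirectSum.add_apply, Submodule.coe_add]
      exact add_mem (h i) (h' i)

theorem subquotIso_of_isStep {N N' : Submodule A M} (h : F.IsStep G N N') :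
    ∃ s : ℤ, SubquotIso (ofSubmodule F N) (ofSubmodule F N') (G.shift s) := by
  classical
  obtain ⟨hle, s, q, hq, hker, hstrict⟩ := h
  let g : ∀ i, F.toFun i → (G.shift s).toFun i := fun i m =>
    if h : (m : M) ∈ N' then ⟨q ⟨m, h⟩, (hstrict i _).2 ⟨⟨m, h⟩, m.2, rfl⟩⟩ else 0
  have hg : ∀ i (m : F.toFun i) (h : (m : M) ∈ N'),
      ((g i m : (G.shift s).toFun i) : D) = q ⟨m, h⟩ :=
    fun i m h => by simp only [g, dif_pos h]
  have hg0 : ∀ i, g i 0 = 0 := fun i => Subtype.ext ((hg i 0 (zero_mem _)).trans (map_zero q))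
  let f0 : ofSubmodule F N' → Rees (G.shift s) := fun x => DFinsupp.mapRange g hg0 (x : Rees F)
  have hf0 : ∀ x i, ((f0 x i : (G.shift s).toFun i) : D) = q ⟨(x : Rees F) i, x.2 i⟩ :=
    fun x i => by
      rw [← hg i]
      exact congrArg Subtype.val (DFinsupp.mapRange_apply g hg0 (x : Rees F) i)
  have hadd : ∀ x y, f0 (x + y) = f0 x + f0 y := fun x y =>
    DirectSum.ext fun i => Subtype.ext (by
      rw [DirectSum.add_apply, Submodule.coe_add, hf0, hf0, hf0, ← map_add]; rfl)
  let f : ofSubmodule F N' →ₗ[ReesAlgebra A] Rees (G.shift s) :=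
    { toFun := f0
      map_add' := hadd
      map_smul' := fun r x => by
        rw [RingHom.id_apply]
        induction r using DirectSum.induction_on with
        | zero =>
          rw [zero_smul, zero_smul]
          exact DirectSum.ext fun i => Subtype.ext ((hf0 0 i).trans (map_zero q))
        | of j a =>
          refine DirectSum.ext fun i => Subtype.ext ?_
          rw [of_smul_apply, hf0, hf0, ← map_smul]
          congr 1
          exact Subtype.ext (of_smul_apply _ _ _ _)
        | add r r' h h' => rw [add_smul, add_smul, hadd, h, h'] }
  refine ⟨s, f, fun y => ?_, fun x => ?_, ?_⟩
  -- Zero is lifted to zero so that the componentwise choice has finite support.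
  · have hc : ∀ i (d : (G.shift s).toFun i), ∃ m : F.toFun i, (d = 0 → m = 0) ∧
        ∃ h : (m : M) ∈ N', q ⟨m, h⟩ = d := by
      intro i d
      by_cases hd : d = 0
      · exact ⟨0, fun _ => rfl, zero_mem _, by rw [hd]; exact map_zero q⟩
      · obtain ⟨x, hx, hxd⟩ := (hstrict i d).1 d.2
        exact ⟨⟨x, hx⟩, fun h => absurd h hd, x.2, hxd⟩
    choose c hc0 hcN hcq using hc
    let x : Rees F := DFinsupp.mapRange c (fun i => hc0 i 0 rfl) y
    have hx : ∀ i, x i = c i (y i) := fun i => DFinsupp.mapRange_apply _ _ _ _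
    refine ⟨⟨x, fun i => by rw [hx]; exact hcN i _⟩, DirectSum.ext fun i => Subtype.ext ?_⟩
    refine (hf0 _ i).trans ?_
    rw [← hcq]
    congr 2
  · constructor
    · intro h i
      refine (hker ⟨_, x.2 i⟩).1 ?_
      rw [← hf0, show f0 x = 0 from h]; rfl
    · intro h
      exact DirectSum.ext fun i => Subtype.ext ((hf0 x i).trans ((hker ⟨_, x.2 i⟩).2 (h i)))
  · rintro ⟨-, hx⟩ i ⟨m, rfl⟩
    exact ⟨g i m, (DFinsupp.mapRange_single (hf := hg0)).symm⟩

theorem hasFiltration_of_steps {Λ : Type w} {D : Λ → Type v} [∀ lam, AddCommGroup (D lam)]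
    [∀ lam, Module A (D lam)] {G : ∀ lam, ModFiltration A (D lam)} {l : List Λ}
    (X : ℕ → Submodule A M) (h0 : X 0 = ⊥) (hl : X l.length = ⊤)
    (hX : ∀ (k : ℕ) (hk : k < l.length), F.IsStep (G l[k]) (X k) (X (k + 1))) :
    HasFiltration F G l := by
  refine ⟨fun k => ofSubmodule F (X k), ?_, ?_, fun k x hx i j => ?_, fun k hk => ⟨?_, ?_⟩⟩
  · rw [eq_bot_iff]
    exact fun x hx => DirectSum.ext fun i => Subtype.ext (by simpa [h0] using hx i)
  · rw [eq_top_iff]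
    exact fun x _ i => by rw [hl]; trivial
  · rw [DirectSum.coe_of_apply]
    split_ifs
    · exact hx i
    · exact zero_mem _
  · exact fun x hx i => (hX k hk).1 (hx i)
  · exact subquotIso_of_isStep (hX k hk)

end Rees

/-! ### Costandard filtrations -/

namespace WeightSystem

variable {A : Type u} [Ring A] {Λ : Type w} (S : WeightSystem A Λ)

theorem eq_of_map_L_ne_zero {kap lam : Λ} {j : S.L kap →ₗ[A] S.L lam} (hj : j ≠ 0) :
    kap = lam := by
  refine S.eq_of_map_ne_zero (h := j ∘ₗ S.π kap) (fun h0 => hj ?_)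
  ext x
  obtain ⟨y, rfl⟩ := S.π_surjective kap x
  exact LinearMap.congr_fun h0 y

/-- There are only finitely many irreducible modules. -/
theorem finite_index (S : WeightSystem A Λ) [IsArtinianRing A] [IsNoetherianRing A] :
    Finite Λ := by
  -- Noetherian induction on left ideals: with `N'/N ≅ L kap`, an irreducible quotient of `A/N` is
  -- either one of `A/N'` or `L kap`.
  have key : ∀ N : Submodule A A,
      {lam | ∃ q : A →ₗ[A] S.L lam, q ≠ 0 ∧ N ≤ LinearMap.ker q}.Finite := by
    intro N
    induction N using IsNoetherian.induction with
    | hgt N ih =>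
      by_cases hN : N = ⊤
      · refine Set.finite_empty.subset ?_
        rintro lam ⟨q, hq, hNq⟩
        rw [hN, top_le_iff] at hNq
        exact hq (LinearMap.ker_eq_top.1 hNq)
      · have : Nontrivial (A ⧸ N) := Submodule.Quotient.nontrivial_iff.2 hN
        obtain ⟨kap, j, hj⟩ := S.exists_injective_L (A ⧸ N)
        let N' := (LinearMap.range j).comap N.mkQ
        have hlt : N < N' := by
          have hle : N ≤ N' := fun x hx => ⟨0, by rw [map_zero]; symm; simpa using hx⟩
          refine lt_of_le_of_ne hle (fun h => ?_)
          have := IsSimpleModule.nontrivial A (S.L kap)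
          obtain ⟨l, hl⟩ := exists_ne (0 : S.L kap)
          obtain ⟨y, hy⟩ := Submodule.mkQ_surjective N (j l)
          have h1 : y ∈ N := by rw [h]; exact ⟨l, hy.symm⟩
          have h2 : N.mkQ y = 0 := by simpa using h1
          exact hl (hj (by rw [← hy, h2, map_zero]))
        refine ((ih N' hlt).union (Set.finite_singleton kap)).subset ?_
        rintro lam ⟨q, hq, hNq⟩
        by_cases hN' : N' ≤ LinearMap.ker q
        · exact Or.inl ⟨q, hq, hN'⟩
        · right
          refine (S.eq_of_map_L_ne_zero (j := N.liftQ q hNq ∘ₗ j) (fun h0 => hN' ?_)).symm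
          rintro x ⟨l, hl⟩
          have h1 := LinearMap.congr_fun h0 l
          rw [LinearMap.comp_apply, hl, LinearMap.zero_apply] at h1
          exact h1
  refine Set.finite_univ_iff.1 ((key ⊥).subset ?_)
  rintro lam -
  have := IsSimpleModule.nontrivial A (S.L lam)
  obtain ⟨l, hl⟩ := exists_ne (0 : S.L lam)
  exact ⟨LinearMap.toSpanSingleton A _ l, fun h0 => hl (by simpa using LinearMap.congr_fun h0 1),
    bot_le⟩

/-- The degree of an irreducible submodule of a filtered module. -/
theorem exists_degree {T : Type*} [AddCommGroup T] [Module A T] (F : ModFiltration A T)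
    (hF : ∃ n, F.toFun n = ⊥) {lam : Λ} (j : S.L lam →ₗ[A] T) (hj : Function.Injective j) :
    ∃ n, (∀ l, j l ∈ F.toFun n → l = 0) ∧ ∀ l, j l ∈ F.toFun (n - 1) := by
  have := IsSimpleModule.nontrivial A (S.L lam)
  obtain ⟨l, hl⟩ := exists_ne (0 : S.L lam)
  obtain ⟨b, hb⟩ := F.exists_mem (j l)
  obtain ⟨n0, hn0⟩ := hF
  obtain ⟨n, hn, hmin⟩ := Int.exists_least_of_bdd (P := fun n => ∀ l, j l ∈ F.toFun n → l = 0)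
    ⟨b, fun z hz => by
      by_contra hlt
      exact hl (hz l (F.antitone (by omega) hb))⟩
    ⟨n0, fun l hl => hj (by rw [hn0, Submodule.mem_bot] at hl; rw [hl, map_zero])⟩
  refine ⟨n, hn, ?_⟩
  rcases eq_bot_or_eq_top ((F.toFun (n - 1)).comap j) with h | h
  · exfalso
    have := hmin (n - 1) (fun l hl => by
      have : l ∈ (F.toFun (n - 1)).comap j := hl
      rwa [h] at this)
    omega
  · intro l
    have : l ∈ (F.toFun (n - 1)).comap j := by rw [h]; trivial
    exact this

variable [PartialOrder Λ] {S} {K : Type v} [Field K] [Algebra K A]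

theorem StdExtends.of_ker_eq {T M N : Type u} [AddCommGroup T] [Module A T] [AddCommGroup M]
    [Module A M] [AddCommGroup N] [Module A N] {F : ModFiltration A T} {G : ModFiltration A M}
    {H : ModFiltration A N} (p : T →ₗ[A] M) (q : T →ₗ[A] N) (hp : Function.Surjective p)
    (hq : Function.Surjective q) (hpq : ∀ x, p x = 0 ↔ q x = 0)
    (hG : ∀ i, (F.toFun i).map p = G.toFun i) (hH : ∀ i, (F.toFun i).map q = H.toFun i)
    (h : S.StdExtends G) : S.StdExtends H := by
  obtain ⟨e, he⟩ := LinearMap.exists_factor_of_surjective p hp q (fun x => (hpq x).1)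
  obtain ⟨e', he'⟩ := LinearMap.exists_factor_of_surjective q hq p (fun x => (hpq x).2)
  have hee : ∀ y, e (e' y) = y := fun y => by
    obtain ⟨x, rfl⟩ := hq y
    rw [he', he]
  have heG : ∀ i, ∀ y ∈ G.toFun i, e y ∈ H.toFun i := fun i y hy => by
    rw [← hG] at hy
    obtain ⟨x, hx, rfl⟩ := hy
    rw [he, ← hH]
    exact ⟨x, hx, rfl⟩
  have heH : ∀ i, ∀ y ∈ H.toFun i, e' y ∈ G.toFun i := fun i y hy => by
    rw [← hH] at hy
    obtain ⟨x, hx, rfl⟩ := hy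
    rw [he', ← hG]
    exact ⟨x, hx, rfl⟩
  intro mu r f hf
  obtain ⟨g, hg, hgf⟩ := h mu r (e' ∘ₗ f) (fun i x hx => heH _ _ (hf i x hx))
  exact ⟨e ∘ₗ g, fun x => heG _ _ (hg x), fun x => by
    rw [LinearMap.comp_apply, hgf, LinearMap.comp_apply, hee]⟩

/-- Extension of a filtered map from `N` to an extension `V` of `L kap` by `N`. -/
theorem StdExtends.extend_L [IsArtinianRing A] (hA : S.IsQuasiHereditary K) {T V N : Type u}
    [AddCommGroup T] [Module A T] [AddCommGroup V] [Module A V] [AddCommGroup N] [Module A N]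
    {F : ModFiltration A T} (hE : S.StdExtends F) {lam kap : Λ}
    (hmin : ∀ nu, nu < lam → ∀ j : S.L nu →ₗ[A] T, j = 0) (hle : kap ≤ lam)
    (i : N →ₗ[A] V) (hi : Function.Injective i) (t : V →ₗ[A] S.L kap)
    (ht : Function.Surjective t) (hit : ∀ y, t y = 0 ↔ ∃ x, i x = y) {m0 : ℕ}
    (hm0 : socPow A V m0 = ⊤) (n : ℤ) (f : N →ₗ[A] T)
    (hf : ∀ k x, i x ∈ socPow A V (n - k).toNat → f x ∈ F.toFun k) :
    ∃ f' : V →ₗ[A] T, (∀ x, f' (i x) = f x) ∧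
      ∀ k y, y ∈ socPow A V (n - k).toNat → f' y ∈ F.toFun k := by
  classical
  -- The least such `m` is the socle layer of `V` in which `L kap` first appears; it determines the
  -- degree in which `P kap` is mapped to `V`.
  have hex : ∃ m, ∃ y ∈ socPow A V m, t y ≠ 0 := by
    have := IsSimpleModule.nontrivial A (S.L kap)
    obtain ⟨l, hl⟩ := exists_ne (0 : S.L kap)
    obtain ⟨y, rfl⟩ := ht l
    exact ⟨m0, y, by rw [hm0]; trivial, hl⟩
  obtain ⟨m, ⟨y0, hy0, hty0⟩, hmm⟩ := Nat.findX hex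
  -- Positivity lets `m ≤ (n - k).toNat` give `k ≤ n - m` despite the truncation.
  have hmpos : 0 < m := Nat.pos_of_ne_zero fun h => hty0 (by rw [socPow_zero h hy0, map_zero])
  have hsurj : Function.Surjective (t ∘ₗ (socPow A V m).subtype) :=
    LinearMap.surjective_of_ne_zero fun h0 => hty0 (LinearMap.congr_fun h0 ⟨y0, hy0⟩)
  obtain ⟨p, hp⟩ := (S.projective kap).exists_lift (t ∘ₗ (socPow A V m).subtype) (S.π kap)
    (fun x => hsurj _)
  let p' : S.P kap →ₗ[A] V := (socPow A V m).subtype ∘ₗ p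
  have hp' : ∀ x, t (p' x) = S.π kap x := hp
  have hpn : ∀ x ∈ (radFiltration A (S.P kap)).toFun m, p' x = 0 := fun x hx =>
    radFiltration_le_of_smul (N := LinearMap.ker p') (fun a ha x => by
      rw [LinearMap.mem_ker, map_smul]
      exact (p x).2 a ha) hx
  obtain ⟨c, hc⟩ := LinearMap.exists_lift_of_injective i hi
    (p' ∘ₗ (LinearMap.ker (S.π kap)).subtype) (fun x => (hit _).1 ((hp' _).trans x.2))
  obtain ⟨g, hg, hgf⟩ := hE kap (n - m)
    (f ∘ₗ c ∘ₗ Submodule.inclusion (S.stdKer_le_ker_π kap)) (fun k x hx => by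
      apply hf
      rw [LinearMap.comp_apply, hc]
      have := (radFiltration A (S.P kap)).map_mem_socPow hpn hx
      rwa [show n - (k + (n - m)) = m - k by ring])
  let d : LinearMap.ker (S.π kap) →ₗ[A] T := f ∘ₗ c - g ∘ₗ (LinearMap.ker (S.π kap)).subtype
  have hdK : ∀ x : LinearMap.ker (S.π kap), (x : S.P kap) ∈ S.stdKer kap → d x = 0 :=
    fun x hx => by
      have := hgf ⟨x, hx⟩
      simp only [d, LinearMap.sub_apply, LinearMap.comp_apply, Submodule.subtype_apply, this]
      exact sub_self _
  -- The discrepancy `d` kills `stdKer kap`, so it factors through `rad Δ(kap)`. An irreducible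
  -- submodule of its image would be some `L nu` with `nu < kap ≤ lam`, which `hmin` excludes.
  have hd : d = 0 := by
    by_contra hd
    have : Nontrivial (LinearMap.range d) := by
      rw [Submodule.nontrivial_iff_ne_bot]
      exact fun h => hd (LinearMap.range_eq_bot.1 h)
    obtain ⟨nu, j, hj⟩ := S.exists_injective_L (LinearMap.range d)
    obtain ⟨b, hb⟩ := (S.projective nu).exists_lift d.rangeRestrict (j ∘ₗ S.π nu)
      (fun x => d.surjective_rangeRestrict _)
    have hb0 : (S.stdKer kap).mkQ ∘ₗ (LinearMap.ker (S.π kap)).subtype ∘ₗ b ≠ 0 := fun h0 => by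
      obtain ⟨e, he, -⟩ := S.exists_gen nu
      have h1 : ((b e : LinearMap.ker (S.π kap)) : S.P kap) ∈ S.stdKer kap := by
        simpa using LinearMap.congr_fun h0 e
      have h2 := hb e
      rw [show d.rangeRestrict (b e) = 0 from Subtype.ext (hdK _ h1)] at h2
      exact he (hj (by rw [map_zero]; exact h2.symm))
    have hle' : nu ≤ kap := S.factorsLE_iff.1 (S.factorsLE_std kap) nu _ hb0
    have hne : nu ≠ kap := by
      rintro rfl
      exact hb0 (S.map_rad_std_eq_zero hA _ (fun x => ⟨_, (b x).2, rfl⟩))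
    have hz := hmin nu ((lt_of_le_of_ne hle' hne).trans_le hle)
      ((LinearMap.range d).subtype ∘ₗ j)
    have := IsSimpleModule.nontrivial A (S.L nu)
    obtain ⟨l, hl⟩ := exists_ne (0 : S.L nu)
    exact hl (hj (Subtype.ext (by simpa using LinearMap.congr_fun hz l)))
  obtain ⟨f', hf'i, hf'p⟩ := LinearMap.exists_glue i p' (fun y => by
      obtain ⟨x, hx⟩ := S.π_surjective kap (t y)
      obtain ⟨z, hz⟩ := (hit (y - p' x)).1 (by rw [map_sub, hp', hx, sub_self])
      exact ⟨z, x, by rw [hz, sub_add_cancel]⟩) f g (fun z x hzx => by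
      have hx : S.π kap x = 0 := by rw [← hp', ← hzx]; exact (hit _).2 ⟨z, rfl⟩
      have h1 : c ⟨x, hx⟩ = z := hi (by rw [hc, hzx]; rfl)
      have h2 := LinearMap.congr_fun hd ⟨x, hx⟩
      simp only [d, LinearMap.sub_apply, LinearMap.comp_apply, h1, LinearMap.zero_apply,
        sub_eq_zero] at h2
      exact h2)
  refine ⟨f', hf'i, fun k y hy => ?_⟩
  -- From layer `m` on, `y` splits into parts from `N` and from `P kap`, both in the right socle
  -- layer; below it, minimality of `m` puts `y` in `N`.
  by_cases hmk : m ≤ (n - k).toNat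
  · obtain ⟨x, hx⟩ := S.π_surjective kap (t y)
    obtain ⟨z, hz⟩ := (hit (y - p' x)).1 (by rw [map_sub, hp', hx, sub_self])
    have h1 : y = i z + p' x := by rw [hz, sub_add_cancel]
    rw [h1, map_add, hf'i, hf'p]
    refine add_mem (hf _ _ ?_) (F.antitone (by omega) (hg x))
    rw [hz]
    exact sub_mem hy (socPow_mono hmk (p x).2)
  · have h0 : t y = 0 := by
      by_contra h0
      exact hmm (n - k).toNat (by omega) ⟨y, hy, h0⟩
    obtain ⟨x, rfl⟩ := (hit y).1 h0
    rw [hf'i]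
    exact hf _ _ hy

theorem exists_socPow_eq_top [IsArtinianRing A] :
    ∃ m, ∀ (M : Type u) [AddCommGroup M] [Module A M], socPow A M m = ⊤ := by
  obtain ⟨n, hn⟩ := IsArtinianRing.isNilpotent_jacobson_bot (R := A)
  rw [Ideal.jacobson_bot] at hn
  refine ⟨n, fun M _ _ => eq_top_iff.2 fun x _ a ha => ?_⟩
  rw [hn] at ha
  rw [show a = 0 by simpa using ha, zero_smul]

/-- A filtered module with `Ext¹(Δ, T) = 0` contains a shifted costandard module. -/
theorem StdExtends.exists_costd [IsArtinianRing A] [IsNoetherianRing A]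
    (hA : S.IsQuasiHereditary K) {T : Type u} [AddCommGroup T] [Module A T] [Module.Finite A T]
    [Nontrivial T] {F : ModFiltration A T} (hF : ∃ n, F.toFun n = ⊥) (hE : S.StdExtends F) :
    ∃ (lam : Λ) (n : ℤ) (f : S.costdSub lam →ₗ[A] T), Function.Injective f ∧
      ∀ k x, f x ∈ F.toFun k ↔ x ∈ socPow A (S.costdSub lam) (n - k).toNat := by
  have := S.finite_index
  obtain ⟨m0, hm0⟩ := exists_socPow_eq_top (A := A)
  obtain ⟨lam, ⟨j0, hj0⟩, hlam⟩ := WellFounded.has_min (wellFounded_lt (α := Λ))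
    {lam | ∃ j : S.L lam →ₗ[A] T, Function.Injective j} (by
      obtain ⟨kap, j, hj⟩ := S.exists_injective_L T
      exact ⟨kap, j, hj⟩)
  have hmin : ∀ nu, nu < lam → ∀ j : S.L nu →ₗ[A] T, j = 0 := fun nu hnu j => by
    by_contra hj
    exact hlam nu ⟨j, LinearMap.injective_of_ne_zero hj⟩ hnu
  obtain ⟨n, hn, hn1⟩ := S.exists_degree F hF j0 hj0
  let W := S.costdSub lam
  let i0 : S.L lam →ₗ[A] W := (S.ι lam).codRestrict _ (fun x => S.range_ι_le lam ⟨x, rfl⟩)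
  have hi0 : Function.Injective i0 := fun x y h => S.ι_injective lam (congrArg Subtype.val h)
  -- A maximal partial extension is sought through its image, because `T` is Noetherian while this
  -- is not known of `I lam`.
  let s : Set (Submodule A T) := {R | ∃ (U : Submodule A W) (f : U →ₗ[A] T),
    (∀ l, ∃ h : i0 l ∈ U, f ⟨i0 l, h⟩ = j0 l) ∧
    (∀ k (x : U), (x : W) ∈ socPow A W (n - k).toNat → f x ∈ F.toFun k) ∧
    LinearMap.range f = R}
  have hs : s.Nonempty := by
    let e := LinearEquiv.ofInjective i0 hi0
    refine ⟨_, LinearMap.range i0, j0 ∘ₗ e.symm.toLinearMap, fun l => ⟨⟨l, rfl⟩, ?_⟩, ?_, rfl⟩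
    · have : e.symm ⟨i0 l, ⟨l, rfl⟩⟩ = l := by rw [LinearEquiv.symm_apply_eq]; rfl
      simp [this]
    · intro k x hx
      by_cases hk : k ≤ n - 1
      · exact F.antitone hk (hn1 _)
      · have h0 : x = 0 := Subtype.ext (socPow_zero (by omega) hx)
        rw [h0, map_zero]; exact zero_mem _
  obtain ⟨R, ⟨U, f, hfi, hff, rfl⟩, hmax⟩ := set_has_maximal_iff_noetherian.2 inferInstance s hs
  have hinj : ∀ (U : Submodule A W) (f : U →ₗ[A] T)
      (_ : ∀ l, ∃ h : i0 l ∈ U, f ⟨i0 l, h⟩ = j0 l), Function.Injective f := by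
    intro U f hf
    refine S.injective_of_comp_ι (W.subtype ∘ₗ U.subtype) ?_
      (W.injective_subtype.comp U.injective_subtype)
    rintro x ⟨l, hl⟩ hx
    obtain ⟨h, hfl⟩ := hf l
    have : x = ⟨i0 l, h⟩ := Subtype.ext (Subtype.ext hl.symm)
    rw [this, hfl] at hx
    have hl0 : l = 0 := hj0 (by rw [hx, map_zero])
    rw [this]
    exact Subtype.ext (by simp [hl0])
  have hU : U = ⊤ := by
    by_contra hU
    have : Nontrivial (W ⧸ U) := Submodule.Quotient.nontrivial_iff.2 hU
    obtain ⟨kap, j, hj⟩ := S.exists_injective_L (W ⧸ U)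
    have hle : kap ≤ lam := ((S.factorsLE_costdSub lam).of_surjective U.mkQ
      (Submodule.mkQ_surjective U)).le_of_injective j hj
    let U' := (LinearMap.range j).comap U.mkQ
    have hUU : U ≤ U' := fun x hx => ⟨0, by rw [map_zero]; symm; simpa using hx⟩
    obtain ⟨t, ht⟩ := LinearMap.exists_lift_of_injective j hj (U.mkQ ∘ₗ U'.subtype)
      (fun x => x.2)
    have hts : Function.Surjective t := fun l => by
      obtain ⟨y, hy⟩ := Submodule.mkQ_surjective U (j l)
      exact ⟨⟨y, l, hy.symm⟩, hj (by rw [ht]; exact hy)⟩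
    have hker : ∀ y, t y = 0 ↔ ∃ x, Submodule.inclusion hUU x = y := fun y => by
      rw [← hj.eq_iff, ht, map_zero]
      constructor
      · intro h
        exact ⟨⟨y, by simpa using h⟩, rfl⟩
      · rintro ⟨x, rfl⟩
        simp
    obtain ⟨f', hf', hff'⟩ := hE.extend_L hA hmin hle (Submodule.inclusion hUU)
      (Submodule.inclusion_injective hUU) t hts hker (hm0 U') n f (fun k x hx =>
        hff k x (map_mem_socPow U'.subtype hx))
    have hfi' : ∀ l, ∃ h : i0 l ∈ U', f' ⟨i0 l, h⟩ = j0 l := fun l => by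
      obtain ⟨h, hl⟩ := hfi l
      exact ⟨hUU h, by rw [← hl, ← hf']; rfl⟩
    refine hmax (LinearMap.range f') ⟨U', f', hfi', fun k x hx => hff' k x ?_, rfl⟩ ?_
    · exact fun a ha => Subtype.ext (hx a ha)
    · refine lt_of_le_of_ne ?_ (fun h => ?_)
      · rintro _ ⟨x, rfl⟩; exact ⟨_, hf' x⟩
      · have := IsSimpleModule.nontrivial A (S.L kap)
        obtain ⟨l, hl⟩ := exists_ne (0 : S.L kap)
        obtain ⟨y, rfl⟩ := hts l
        obtain ⟨x, hx⟩ : f' y ∈ LinearMap.range f := by rw [h]; exact ⟨y, rfl⟩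
        rw [← hf'] at hx
        exact hl ((hker y).2 ⟨x, hinj U' f' hfi' hx⟩)
  let g : W →ₗ[A] T := f ∘ₗ LinearMap.id.codRestrict U (fun x => by rw [hU]; trivial)
  have hgi : ∀ l, g (i0 l) = j0 l := fun l => (hfi l).2
  refine ⟨lam, n, g, (hinj U f hfi).comp (fun x y h => congrArg Subtype.val h), fun k x =>
    ⟨fun hx a ha => ?_, fun hx => hff k _ hx⟩⟩
  -- Strictness: if `J^(n-k)` does not kill `x`, its multiples reach the socle, and `f x ∈ F^k`
  -- would place a nonzero socle element in `F^n`, contrary to the choice of `n`.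
  by_contra hax
  have h1 : (Submodule.span A {a • x}).map W.subtype ≠ ⊥ := fun h0 => hax (by
    have : W.subtype (a • x) ∈ (Submodule.span A {a • x}).map W.subtype :=
      ⟨_, Submodule.mem_span_singleton_self _, rfl⟩
    rw [h0, Submodule.mem_bot] at this
    exact Subtype.ext this)
  have := IsSimpleModule.nontrivial A (S.L lam)
  obtain ⟨l, hl⟩ := exists_ne (0 : S.L lam)
  obtain ⟨z, hz, hzl⟩ := S.ι_le_of_ne_bot h1 ⟨l, rfl⟩
  obtain ⟨b, rfl⟩ := Submodule.mem_span_singleton.1 hz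
  have h2 : b • a • x = i0 l := Subtype.ext hzl
  apply hl
  apply hn
  rw [← hgi, ← h2, map_smul, map_smul]
  have := F.smul_mem (n - k) k a (g x) ha hx
  exact Submodule.smul_mem _ _ (by simpa using this)

/-- `T` is the pullback of `T/∇(lam)` and `I lam` over `I lam/∇(lam)`. So a map to `T/∇(lam)` lifts
to `T` once its image in `I lam/∇(lam)` lifts to `I lam`; for maps from `stdKer mu` this is `hK`,
the vanishing of `Ext²(Δ, ∇)`. -/
theorem StdExtends.quot {T : Type u} [AddCommGroup T] [Module A T] {F : ModFiltration A T}
    (hE : S.StdExtends F)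
    (hK : ∀ mu, S.CostdLifts ((radFiltration A (S.P mu)).sub (S.stdKer mu)))
    {lam : Λ} {n : ℤ} {f : S.costdSub lam →ₗ[A] T}
    (hf : ∀ k x, f x ∈ F.toFun k ↔ x ∈ socPow A (S.costdSub lam) (n - k).toNat) :
    S.StdExtends (F.quot (LinearMap.range f)) := by
  intro mu r q hq
  obtain ⟨h, hh0, hh⟩ := (S.injective lam).exists_extend_filtered F n f (S.costdSub lam).subtype
    (fun x hx => by
      rw [hf] at hx
      rw [socPow_zero (by simp) hx, map_zero])
  obtain ⟨h', hh'⟩ := LinearMap.exists_factor_of_surjective (LinearMap.range f).mkQ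
    (Submodule.mkQ_surjective _) ((S.costdSub lam).mkQ ∘ₗ h) (fun x hx => by
      have : x ∈ LinearMap.range f := by simpa using hx
      obtain ⟨y, rfl⟩ := this
      rw [LinearMap.comp_apply, hh]
      simp)
  obtain ⟨g, hg0, hg⟩ := hK mu lam (n - r) (h' ∘ₗ q) (fun i x hx => by
    obtain ⟨t, ht, htq⟩ := hq i x hx
    refine ⟨h t, ?_, ?_⟩
    · rw [show n - r - i = n - (i + r) by ring]
      exact F.map_mem_socPow hh0 ht
    · rw [LinearMap.comp_apply, ← htq, hh']; rfl)
  have key : ∀ (x : S.stdKer mu) (t : T), (LinearMap.range f).mkQ t = q x →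
      ∃ y, (S.costdSub lam).subtype y = h t - g x := fun x t ht => by
    have h1 := hg x
    rw [LinearMap.comp_apply, ← ht, hh', LinearMap.comp_apply, eq_comm, ← sub_eq_zero,
      ← map_sub] at h1
    exact ⟨⟨h t - g x, (Submodule.Quotient.mk_eq_zero _).1 h1⟩, rfl⟩
  obtain ⟨q', hq'⟩ := LinearMap.exists_lift_of_injective ((LinearMap.range f).mkQ.prod h)
    (by
      rw [← LinearMap.ker_eq_bot, eq_bot_iff]
      rintro t ht
      rw [LinearMap.mem_ker, LinearMap.prod_apply, Function.prod_apply, Prod.mk_eq_zero] at ht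
      have : t ∈ LinearMap.range f := by simpa using ht.1
      obtain ⟨y, rfl⟩ := this
      have h1 := ht.2
      rw [hh] at h1
      rw [show y = 0 from Subtype.ext h1, map_zero]
      exact zero_mem _) (q.prod g)
    (fun x => by
      obtain ⟨t, ht⟩ := Submodule.mkQ_surjective _ (q x)
      obtain ⟨y, hy⟩ := key x t ht
      refine ⟨t - f y, Prod.ext ?_ ?_⟩
      · have : (LinearMap.range f).mkQ (f y) = 0 := by simp
        change (LinearMap.range f).mkQ (t - f y) = q x
        rw [map_sub, ht, this, sub_zero]
      · change h (t - f y) = g x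
        rw [map_sub, hh, hy, sub_sub_cancel])
  have hq1 : ∀ x, (LinearMap.range f).mkQ (q' x) = q x := fun x => congrArg Prod.fst (hq' x)
  have hq2 : ∀ x, h (q' x) = g x := fun x => congrArg Prod.snd (hq' x)
  obtain ⟨G, hG, hGq⟩ := hE mu r q' (fun i x hx => by
    obtain ⟨t, ht, htq⟩ := hq i x hx
    obtain ⟨y, hy⟩ := key x t htq
    have h1 : t - q' x ∈ LinearMap.range f := by
      refine (Submodule.Quotient.mk_eq_zero _).1 ?_
      change (LinearMap.range f).mkQ (t - q' x) = 0
      rw [map_sub, htq, hq1, sub_self]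
    obtain ⟨z, hz⟩ := h1
    have hzy : z = y := Subtype.ext (by
      have := hh z
      rw [hz, map_sub, hq2, ← hy] at this
      exact this.symm)
    have h2 : h t - g x ∈ socPow A (S.I lam) (n - (i + r)).toNat := by
      refine sub_mem (F.map_mem_socPow hh0 ht) ?_
      have := ((radFiltration A (S.P mu)).sub (S.stdKer mu)).map_mem_socPow hg0 (x := x) hx
      rwa [show n - (i + r) = n - r - i by ring]
    -- The lift differs from a representative in the right degree by an element of `∇(lam)`;
    -- strictness of `f` places that element in the same degree.
    have h3 : f z ∈ F.toFun (i + r) := by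
      rw [hf, hzy]
      intro a ha
      exact Subtype.ext (by rw [← hy] at h2; exact h2 a ha)
    rw [hz] at h3
    have := sub_mem ht h3
    rwa [sub_sub_cancel] at this)
  exact ⟨(LinearMap.range f).mkQ ∘ₗ G, fun x => ⟨_, hG x, rfl⟩, fun x => by
    rw [LinearMap.comp_apply, hGq, hq1]⟩

theorem StdExtends.exists_chain [FiniteDimensional K A] (hA : S.IsQuasiHereditary K)
    (hK : ∀ mu, S.CostdLifts ((radFiltration A (S.P mu)).sub (S.stdKer mu)))
    {T : Type u} [AddCommGroup T] [Module A T] [Module.Finite A T] {F : ModFiltration A T}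
    (hF : ∃ n, F.toFun n = ⊥) (hE : S.StdExtends F) :
    ∃ l, F.Chain (fun lam => socFiltration K A (S.Costd lam)) ⊥ l ⊤ := by
  have : IsArtinianRing A := IsArtinianRing.of_finite K A
  have : IsNoetherianRing A := IsNoetherianRing.of_finite K A
  let s : Set (Submodule A T) := {N | (∃ l, F.Chain (fun lam => socFiltration K A (S.Costd lam))
    ⊥ l N) ∧ S.StdExtends (F.quot N)}
  have hs : s.Nonempty := ⟨⊥, ⟨[], .nil _⟩, .of_ker_eq (F := F) LinearMap.id (Submodule.mkQ ⊥)
    Function.surjective_id (Submodule.mkQ_surjective _) (fun x => by simp)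
    (fun i => Submodule.map_id _) (fun i => rfl) hE⟩
  obtain ⟨N, ⟨⟨l, hl⟩, hN⟩, hmax⟩ := set_has_maximal_iff_noetherian.2 inferInstance s hs
  by_cases hNt : N = ⊤
  · exact ⟨l, hNt ▸ hl⟩
  exfalso
  have : Nontrivial (T ⧸ N) := Submodule.Quotient.nontrivial_iff.2 hNt
  obtain ⟨lam, n, f, hfi, hf⟩ := hN.exists_costd hA (by
    obtain ⟨n, hn⟩ := hF
    exact ⟨n, by simp [ModFiltration.quot, hn]⟩)
  let N' := (LinearMap.range f).comap N.mkQ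
  have hle : N ≤ N' := fun x hx => ⟨0, by rw [map_zero]; symm; simpa using hx⟩
  obtain ⟨q, hq⟩ := LinearMap.exists_lift_of_injective f hfi (N.mkQ ∘ₗ N'.subtype) (fun x => x.2)
  have hqs : Function.Surjective q := fun d => by
    obtain ⟨y, hy⟩ := Submodule.mkQ_surjective N (f d)
    exact ⟨⟨y, d, hy.symm⟩, hfi (by rw [hq]; exact hy)⟩
  have hstep : F.IsStep (socFiltration K A (S.Costd lam)) N N' := by
    refine ⟨hle, n, q, hqs, fun x => ?_, fun i d => ?_⟩
    · rw [← hfi.eq_iff, hq, map_zero]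
      simp
    · have h1 : d ∈ (socFiltration K A (S.Costd lam)).toFun (i - n) ↔
          f d ∈ (F.quot N).toFun i := by
        rw [hf, ← neg_sub i n]; rfl
      rw [h1]
      constructor
      · rintro ⟨x, hx, hxd⟩
        exact ⟨⟨x, d, hxd.symm⟩, hx, hfi (by rw [hq]; exact hxd)⟩
      · rintro ⟨x, hx, rfl⟩
        rw [hq]
        exact ⟨x, hx, rfl⟩
  refine hmax N' ⟨⟨l ++ [lam], hl.snoc hstep⟩, ?_⟩ ?_
  · refine .of_ker_eq (F := F) ((LinearMap.range f).mkQ ∘ₗ N.mkQ) N'.mkQ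
      ((Submodule.mkQ_surjective _).comp (Submodule.mkQ_surjective _))
      (Submodule.mkQ_surjective _) (fun x => ?_) (fun i => ?_) (fun i => rfl) (hN.quot hK hf)
    · simp [N']
    · rw [Submodule.map_comp]; rfl
  · refine lt_of_le_of_ne hle (fun h => ?_)
    obtain ⟨kap, j⟩ : ∃ d, f d ≠ 0 := by
      have := IsSimpleModule.nontrivial A (S.L lam)
      obtain ⟨e, he⟩ := exists_ne (0 : S.L lam)
      refine ⟨⟨S.ι lam e, S.range_ι_le lam ⟨e, rfl⟩⟩, fun h0 => he (S.ι_injective lam ?_)⟩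
      have h1 := hfi (h0.trans (map_zero f).symm)
      rw [map_zero]
      exact congrArg Subtype.val h1
    obtain ⟨y, hy⟩ := hqs kap
    have h2 : (y : T) ∈ N := by rw [h]; exact y.2
    apply j
    rw [← hy, hq]
    simpa using h2

end WeightSystem

/-! ### Standard filtrations -/

namespace WeightSystem

variable {A : Type u} [Ring A] {Λ : Type w} {S : WeightSystem A Λ} [PartialOrder Λ]
  {K : Type v} [Field K] [Algebra K A]

theorem CostdLifts.of_equiv {M N : Type u} [AddCommGroup M] [Module A M] [AddCommGroup N]
    [Module A N] {F : ModFiltration A M} {G : ModFiltration A N} (e : M ≃ₗ[A] N)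
    (he : ∀ i x, x ∈ F.toFun i ↔ e x ∈ G.toFun i) (h : S.CostdLifts F) : S.CostdLifts G := by
  intro mu n f hf
  obtain ⟨g, hg0, hg⟩ := h mu n (f ∘ₗ e.toLinearMap) (fun i x hx => hf i _ ((he i x).1 hx))
  refine ⟨g ∘ₗ e.symm.toLinearMap, fun x hx => hg0 _ ((he n _).2 (by simpa using hx)), fun x => ?_⟩
  rw [LinearMap.comp_apply, hg]
  simp

/-- Lifting of a filtered map to `N` to an extension `V` of `N` by `L kap`. -/
theorem CostdLifts.lift_L [IsNoetherianRing A] (hA : S.IsQuasiHereditary K) {T V N : Type u}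
    [AddCommGroup T] [Module A T] [Module.Finite A T] [AddCommGroup V] [Module A V]
    [AddCommGroup N] [Module A N] {F : ModFiltration A T} (hE : S.CostdLifts F) {lam kap : Λ}
    (hmin : ∀ nu, nu < lam → ∀ q : T →ₗ[A] S.L nu, q = 0) (hle : kap ≤ lam)
    (p : V →ₗ[A] N) (hp : Function.Surjective p) (j : S.L kap →ₗ[A] V)
    (hj : Function.Injective j) (hjp : ∀ y, p y = 0 ↔ ∃ x, j x = y)
    (hV : ∃ n, (radFiltration A V).toFun n = ⊥) (s : ℤ) (f : T →ₗ[A] N)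
    (hf : ∀ i, ∀ x ∈ F.toFun i, f x ∈ (radFiltration A N).toFun (i - s)) :
    ∃ f' : T →ₗ[A] V, (∀ x, p (f' x) = f x) ∧
      ∀ i, ∀ x ∈ F.toFun i, f' x ∈ (radFiltration A V).toFun (i - s) := by
  have hpf : ∀ i, ∀ x ∈ F.toFun i, ∃ y ∈ (radFiltration A V).toFun (i - s), p y = f x := by
    intro i x hx
    have := hf i x hx
    rwa [← radFiltration_map hp] at this
  -- With `p1` extending `ι` along `j`, `V` is the pullback of `N` and `I kap` over `I kap / L kap`.
  -- A lift of `f` to `V` thus amounts to a compatible map `T → I kap`.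
  obtain ⟨n1, hn, hn1⟩ := S.exists_degree _ hV j hj
  obtain ⟨p1, hp10, hp1⟩ := (S.injective kap).exists_extend_filtered (radFiltration A V) n1 j
    (S.ι kap) (fun x hx => by rw [hn x hx, map_zero])
  have hpp : ∀ y, p y = 0 → p1 y ∈ LinearMap.range (S.ι kap) := fun y hy => by
    obtain ⟨x, rfl⟩ := (hjp y).1 hy
    exact ⟨x, (hp1 x).symm⟩
  obtain ⟨q1, hq1⟩ := LinearMap.exists_factor_of_surjective p hp
    ((LinearMap.range (S.ι kap)).mkQ ∘ₗ p1)
    (fun y hy => (Submodule.Quotient.mk_eq_zero _).2 (hpp y hy))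
  obtain ⟨q2, hq2⟩ := LinearMap.exists_factor_of_surjective p hp
    ((S.costdSub kap).mkQ ∘ₗ p1)
    (fun y hy => (Submodule.Quotient.mk_eq_zero _).2 (S.range_ι_le kap (hpp y hy)))
  obtain ⟨g, hg0, hg⟩ := hE kap (n1 + s) (q2 ∘ₗ f) (fun i x hx => by
    obtain ⟨y, hy, hyx⟩ := hpf i x hx
    refine ⟨p1 y, ?_, ?_⟩
    · rw [show n1 + s - i = n1 - (i - s) by ring]
      exact (radFiltration A V).map_mem_socPow hp10 hy
    · rw [LinearMap.comp_apply, ← hyx, hq2]; rfl)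
  let d : T →ₗ[A] S.I kap ⧸ LinearMap.range (S.ι kap) :=
    q1 ∘ₗ f - (LinearMap.range (S.ι kap)).mkQ ∘ₗ g
  have hdp : ∀ x y, p y = f x → d x = (LinearMap.range (S.ι kap)).mkQ (p1 y - g x) :=
    fun x y hyx => by
      simp only [d, LinearMap.sub_apply, LinearMap.comp_apply, ← hyx, hq1, map_sub]
  have hdc : ∀ x, ∃ z : S.costdSub kap, (LinearMap.range (S.ι kap)).mkQ z = d x := fun x => by
    obtain ⟨y, hy⟩ := hp (f x)
    refine ⟨⟨p1 y - g x, (Submodule.Quotient.mk_eq_zero _).1 ?_⟩, (hdp x y hy).symm⟩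
    change (S.costdSub kap).mkQ (p1 y - g x) = 0
    rw [map_sub, hg, LinearMap.comp_apply, ← hy, hq2, LinearMap.comp_apply, sub_self]
  -- `CostdLifts` gives compatibility only modulo `∇(kap)`. The error lies in `∇(kap)/L kap`, whose
  -- composition factors are `L nu` with `nu < kap`, and `T` has no such irreducible quotient.
  have hd : d = 0 := by
    by_contra hd
    have : Nontrivial (LinearMap.range d) := by
      rw [Submodule.nontrivial_iff_ne_bot]
      exact fun h => hd (LinearMap.range_eq_bot.1 h)
    obtain ⟨nu, e, he, hes⟩ := S.exists_map_L_ne_zero (LinearMap.range d)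
    obtain ⟨b, hb⟩ := (S.projective nu).exists_lift (e ∘ₗ d.rangeRestrict) (S.π nu)
      (fun x => hes.comp d.surjective_rangeRestrict _)
    obtain ⟨c, hc⟩ := (S.projective nu).exists_lift
      ((LinearMap.range (S.ι kap)).mkQ ∘ₗ (S.costdSub kap).subtype) (d ∘ₗ b) (fun x => hdc _)
    obtain ⟨y, hy, -⟩ := S.exists_gen nu
    have hdb : d (b y) ≠ 0 := fun h0 => by
      have h1 := hb y
      rw [LinearMap.comp_apply, show d.rangeRestrict (b y) = 0 from Subtype.ext h0,
        map_zero] at h1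
      exact hy h1.symm
    have hle' : nu ≤ kap := S.factorsLE_iff.1 (S.factorsLE_costdSub kap) nu c (fun h0 => hdb (by
      have := hc y
      rw [h0] at this
      simpa using this.symm))
    have hne : nu ≠ kap := by
      rintro rfl
      have h1 := S.map_costd_mem_range_ι hA ((S.costdSub nu).subtype ∘ₗ c) (fun x => (c x).2) y
      exact hdb ((hc y).symm.trans ((Submodule.Quotient.mk_eq_zero _).2 h1))
    have hz := hmin nu ((lt_of_le_of_ne hle' hne).trans_le hle) (e ∘ₗ d.rangeRestrict)
    apply he
    ext x
    obtain ⟨z, rfl⟩ := d.surjective_rangeRestrict x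
    exact LinearMap.congr_fun hz z
  have key : ∀ x y, p y = f x → ∃ z, S.ι kap z = p1 y - g x := fun x y hy => by
    have := hdp x y hy
    rw [hd] at this
    exact (Submodule.Quotient.mk_eq_zero _).1 this.symm
  obtain ⟨f', hf'⟩ := LinearMap.exists_lift_of_injective (p.prod p1) (by
      rw [← LinearMap.ker_eq_bot, eq_bot_iff]
      intro y hy
      rw [LinearMap.mem_ker, LinearMap.prod_apply, Function.prod_apply, Prod.mk_eq_zero] at hy
      obtain ⟨x, rfl⟩ := (hjp y).1 hy.1
      have h1 := hy.2
      rw [hp1] at h1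
      rw [S.ι_injective kap (h1.trans (map_zero _).symm), map_zero]
      exact zero_mem _) (f.prod g) (fun x => by
      obtain ⟨y, hy⟩ := hp (f x)
      obtain ⟨z, hz⟩ := key x y hy
      refine ⟨y - j z, Prod.ext ?_ ?_⟩
      · change p (y - j z) = f x
        rw [map_sub, (hjp (j z)).2 ⟨z, rfl⟩, sub_zero, hy]
      · change p1 (y - j z) = g x
        rw [map_sub, hp1, hz, sub_sub_cancel])
  have hf1 : ∀ x, p (f' x) = f x := fun x => congrArg Prod.fst (hf' x)
  have hf2 : ∀ x, p1 (f' x) = g x := fun x => congrArg Prod.snd (hf' x)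
  refine ⟨f', hf1, fun i x hx => ?_⟩
  obtain ⟨y, hy, hyx⟩ := hpf i x hx
  obtain ⟨z, hz⟩ := (hjp (y - f' x)).1 (by rw [map_sub, hyx, hf1, sub_self])
  have h1 : j z ∈ (radFiltration A V).toFun (i - s) := by
    -- Below degree `n1` all of `j (L kap)` is available; from `n1` on, both `p1 y` and `g x`
    -- vanish, so `z = 0`.
    by_cases hi : i - s ≤ n1 - 1
    · exact (radFiltration A V).antitone hi (hn1 z)
    · have h2 : S.ι kap z = 0 := by
        rw [← hp1, hz, map_sub, hf2, hg0 x (F.antitone (by omega) hx), sub_zero]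
        exact hp10 y ((radFiltration A V).antitone (by omega) hy)
      rw [S.ι_injective kap (h2.trans (map_zero _).symm), map_zero]
      exact zero_mem _
  rw [hz] at h1
  have := sub_mem hy h1
  rwa [sub_sub_cancel] at this

theorem exists_radFiltration_eq_bot [IsArtinianRing A] :
    ∃ n, ∀ (M : Type u) [AddCommGroup M] [Module A M], (radFiltration A M).toFun n = ⊥ := by
  obtain ⟨n, hn⟩ := IsArtinianRing.isNilpotent_jacobson_bot (R := A)
  rw [Ideal.jacobson_bot] at hn
  refine ⟨n, fun M _ _ => ?_⟩
  simp [radFiltration, radPow, hn]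

/-- A filtered module with `Ext¹(T, ∇) = 0` has a shifted standard module as a quotient. -/
theorem CostdLifts.exists_std [IsArtinianRing A] [IsNoetherianRing A]
    (hA : S.IsQuasiHereditary K) {T : Type u} [AddCommGroup T] [Module A T] [Module.Finite A T]
    [Nontrivial T] {F : ModFiltration A T} (hF : ∃ n, F.toFun n = ⊥) (hE : S.CostdLifts F) :
    ∃ (lam : Λ) (s : ℤ) (f : T →ₗ[A] S.Std lam), Function.Surjective f ∧
      ∀ i d, d ∈ (radFiltration A (S.Std lam)).toFun (i - s) ↔ ∃ x ∈ F.toFun i, f x = d := by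
  have := S.finite_index
  obtain ⟨n0, hn0⟩ := exists_radFiltration_eq_bot (A := A)
  obtain ⟨lam, ⟨q0, hq0⟩, hlam⟩ := WellFounded.has_min (wellFounded_lt (α := Λ))
    {lam | ∃ q : T →ₗ[A] S.L lam, q ≠ 0} (by
      obtain ⟨kap, q, hq, -⟩ := S.exists_map_L_ne_zero T
      exact ⟨kap, q, hq⟩)
  have hmin : ∀ nu, nu < lam → ∀ q : T →ₗ[A] S.L nu, q = 0 := fun nu hnu q => by
    by_contra hq
    exact hlam nu ⟨q, hq⟩ hnu
  -- `s` is the degree of the quotient `L lam`, and hence the shift of `Δ(lam)`.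
  obtain ⟨s, ⟨x0, hx0, hqx0⟩, hs⟩ := Int.exists_greatest_of_bdd
    (P := fun i => ∃ x ∈ F.toFun i, q0 x ≠ 0) (by
      obtain ⟨n, hn⟩ := hF
      refine ⟨n, fun i ⟨x, hx, hqx⟩ => ?_⟩
      by_contra hi
      have := F.antitone (show n ≤ i by omega) hx
      rw [hn, Submodule.mem_bot] at this
      exact hqx (by rw [this, map_zero])) (by
      obtain ⟨x, hx⟩ : ∃ x, q0 x ≠ 0 := by
        by_contra h
        push Not at h
        exact hq0 (LinearMap.ext h)
      obtain ⟨i, hi⟩ := F.exists_mem x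
      exact ⟨i, x, hi, hx⟩)
  -- Quotients of `Δ(lam)` to which `q0` lifts as a filtered map; a minimal `U` is shown to be
  -- `stdKer lam` by lifting over one more irreducible submodule.
  let Z : Set (Submodule A (S.P lam)) := {U | S.stdKer lam ≤ U ∧ ∃ f : T →ₗ[A] S.P lam ⧸ U,
    (∀ x y, U.mkQ y = f x → S.π lam y = q0 x) ∧
    ∀ i, ∀ x ∈ F.toFun i, f x ∈ (radFiltration A (S.P lam ⧸ U)).toFun (i - s)}
  have hZ : Z.Nonempty := by
    let e := (S.π lam).quotKerEquivOfSurjective (S.π_surjective lam)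
    refine ⟨LinearMap.ker (S.π lam), S.stdKer_le_ker_π lam, e.symm.toLinearMap ∘ₗ q0,
      fun x y hxy => ?_, fun i x hx => ?_⟩
    · rw [LinearMap.comp_apply, LinearEquiv.coe_coe, LinearEquiv.eq_symm_apply] at hxy
      exact hxy
    · by_cases hi : i ≤ s
      · exact radFiltration_of_nonpos (by omega) _
      · have : q0 x = 0 := by
          by_contra h
          exact hi (hs i ⟨x, hx, h⟩)
        rw [LinearMap.comp_apply, this, map_zero]
        exact zero_mem _
  obtain ⟨U, ⟨hKU, f, hfq, hff⟩, hUmin⟩ := IsArtinian.set_has_minimal Z hZ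
  have hU : U = S.stdKer lam := by
    by_contra hne
    have : Nontrivial (U ⧸ (S.stdKer lam).submoduleOf U) := by
      rw [Submodule.Quotient.nontrivial_iff, Ne, Submodule.submoduleOf_eq_top]
      exact fun h => hne (le_antisymm h hKU)
    obtain ⟨kap, q, hq, hqs⟩ := S.exists_map_L_ne_zero (U ⧸ (S.stdKer lam).submoduleOf U)
    let t : U →ₗ[A] S.L kap := q ∘ₗ Submodule.mkQ _
    have hts : Function.Surjective t := hqs.comp (Submodule.mkQ_surjective _)
    have htK : ∀ x : U, (x : S.P lam) ∈ S.stdKer lam → t x = 0 := fun x hx => by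
      have : ((S.stdKer lam).submoduleOf U).mkQ x = 0 := (Submodule.Quotient.mk_eq_zero _).2 hx
      rw [LinearMap.comp_apply, this, map_zero]
    have hle : kap ≤ lam := by
      obtain ⟨b, hb⟩ := (S.projective kap).exists_lift t (S.π kap) (fun x => hts _)
      refine S.factorsLE_iff.1 (S.factorsLE_std lam) kap
        ((S.stdKer lam).mkQ ∘ₗ U.subtype ∘ₗ b) (fun h0 => ?_)
      obtain ⟨e, he, -⟩ := S.exists_gen kap
      apply he
      rw [← hb]
      exact htK _ ((Submodule.Quotient.mk_eq_zero _).1 (LinearMap.congr_fun h0 e))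
    let U' : Submodule A (S.P lam) := (LinearMap.ker t).map U.subtype
    have hU' : ∀ x : U, (x : S.P lam) ∈ U' ↔ t x = 0 := fun x => by
      constructor
      · rintro ⟨y, hy, hyx⟩
        rw [← show y = x from Subtype.ext hyx]; exact hy
      · exact fun h => ⟨x, h, rfl⟩
    have hUU : U' ≤ U := by rintro _ ⟨y, -, rfl⟩; exact y.2
    obtain ⟨j, hj⟩ := LinearMap.exists_factor_of_surjective t hts (U'.mkQ ∘ₗ U.subtype)
      (fun x hx => (Submodule.Quotient.mk_eq_zero _).2 ((hU' x).2 hx))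
    obtain ⟨p, hp⟩ := LinearMap.exists_factor_of_surjective U'.mkQ (Submodule.mkQ_surjective _)
      U.mkQ (fun x hx => (Submodule.Quotient.mk_eq_zero _).2
        (hUU ((Submodule.Quotient.mk_eq_zero _).1 hx)))
    obtain ⟨f', hf', hff'⟩ := hE.lift_L hA hmin hle p
      (fun y => by
        obtain ⟨x, rfl⟩ := Submodule.mkQ_surjective _ y
        exact ⟨_, hp x⟩) j
      (by
        rw [← LinearMap.ker_eq_bot, eq_bot_iff]
        intro l hl
        obtain ⟨x, rfl⟩ := hts l
        rw [LinearMap.mem_ker, hj] at hl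
        exact (hU' x).1 ((Submodule.Quotient.mk_eq_zero _).1 hl))
      (fun y => by
        obtain ⟨x, rfl⟩ := Submodule.mkQ_surjective _ y
        rw [hp]
        constructor
        · intro hx
          exact ⟨t ⟨x, (Submodule.Quotient.mk_eq_zero _).1 hx⟩, hj _⟩
        · rintro ⟨l, hl⟩
          obtain ⟨z, rfl⟩ := hts l
          rw [hj] at hl
          have h1 : (z : S.P lam) - x ∈ U' := (Submodule.Quotient.eq _).1 hl
          have h2 := sub_mem z.2 (hUU h1)
          rw [sub_sub_cancel] at h2
          exact (Submodule.Quotient.mk_eq_zero _).2 h2)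
      ⟨n0, hn0 _⟩ s f hff
    refine hUmin U' ⟨fun x hx => (hU' ⟨x, hKU hx⟩).2 (htK _ hx), f', fun x y hxy => ?_, hff'⟩ ?_
    · refine hfq x y ?_
      rw [← hp, hxy, hf']
    · refine lt_of_le_of_ne hUU (fun h => ?_)
      have := IsSimpleModule.nontrivial A (S.L kap)
      obtain ⟨l, hl⟩ := exists_ne (0 : S.L kap)
      obtain ⟨x, rfl⟩ := hts l
      exact hl ((hU' x).1 (by rw [h]; exact x.2))
  subst hU
  -- The image of `F^s` is not in the radical of `Δ(lam)`, so it is everything; multiplying by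
  -- powers of `J` then gives strictness in all degrees.
  have htop : (F.toFun s).map f = ⊤ := by
    have h1 : ((F.toFun s).map f).comap (S.stdKer lam).mkQ = ⊤ := by
      by_contra h
      obtain ⟨y, hy⟩ := Submodule.mkQ_surjective _ (f x0)
      have h2 := S.le_ker_π_of_ne_top h (show y ∈ _ from ⟨x0, hx0, hy.symm⟩)
      exact hqx0 (by rw [← hfq x0 y hy]; exact h2)
    rw [eq_top_iff]
    rintro d -
    obtain ⟨y, rfl⟩ := Submodule.mkQ_surjective _ d
    have : y ∈ ((F.toFun s).map f).comap (S.stdKer lam).mkQ := by rw [h1]; trivial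
    exact this
  refine ⟨lam, s, f, fun d => ?_, fun i d => ⟨fun hd => ?_, ?_⟩⟩
  · obtain ⟨x, -, hx⟩ : d ∈ (F.toFun s).map f := by rw [htop]; trivial
    exact ⟨x, hx⟩
  · refine radFiltration_le_of_smul (N := (F.toFun i).map f) (fun a ha d => ?_) hd
    obtain ⟨x, hx, rfl⟩ : d ∈ (F.toFun s).map f := by rw [htop]; trivial
    exact ⟨a • x, by simpa using F.smul_mem _ _ _ _ ha hx, map_smul _ _ _⟩
  · rintro ⟨x, hx, rfl⟩
    exact hff i x hx

/-- Dual to `StdExtends.quot`: `T` is the pushout of `ker q` and `P lam` over `stdKer lam`. By `hK`,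
a map `ker q → I mu/∇(mu)` lifts on `stdKer lam`, so it extends over `P lam` and glues to a filtered
map on `T`. -/
theorem CostdLifts.ker {T : Type u} [AddCommGroup T] [Module A T] {F : ModFiltration A T}
    (hE : S.CostdLifts F)
    (hK : ∀ mu, S.CostdLifts ((radFiltration A (S.P mu)).sub (S.stdKer mu)))
    {lam : Λ} {s : ℤ} {q : T →ₗ[A] S.Std lam}
    (hq : ∀ i d, d ∈ (radFiltration A (S.Std lam)).toFun (i - s) ↔ ∃ x ∈ F.toFun i, q x = d) :
    S.CostdLifts (F.sub (LinearMap.ker q)) := by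
  intro mu n f hf
  obtain ⟨p0, hp0⟩ := (S.projective lam).exists_lift (q ∘ₗ (F.toFun s).subtype) (S.stdKer lam).mkQ
    (fun x => by
      obtain ⟨y, hy, hyx⟩ := (hq s ((S.stdKer lam).mkQ x)).1
        (radFiltration_of_nonpos (by omega) _)
      exact ⟨⟨y, hy⟩, hyx⟩)
  let p : S.P lam →ₗ[A] T := (F.toFun s).subtype ∘ₗ p0
  have hp : ∀ x, q (p x) = (S.stdKer lam).mkQ x := hp0
  have hpF : ∀ i, ∀ x ∈ (radFiltration A (S.P lam)).toFun i, p x ∈ F.toFun (i + s) :=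
    fun i x hx => F.map_mem_of_mem_rad (fun x => (p0 x).2) hx
  let c : S.stdKer lam →ₗ[A] LinearMap.ker q := (p ∘ₗ (S.stdKer lam).subtype).codRestrict _
    (fun x => by
      rw [LinearMap.mem_ker, LinearMap.comp_apply, hp]
      exact (Submodule.Quotient.mk_eq_zero _).2 x.2)
  obtain ⟨g, hg0, hg⟩ := hK lam mu (n - s) (f ∘ₗ c) (fun i x hx => by
    obtain ⟨y, hy, hyx⟩ := hf (i + s) (c x) (hpF i x hx)
    rw [show n - s - i = n - (i + s) by ring]
    exact ⟨y, hy, hyx⟩)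
  obtain ⟨g', hg0', hg'⟩ := (S.injective mu).exists_extend_filtered (radFiltration A (S.P lam))
    (n - s) (S.stdKer lam).subtype g (fun x hx => hg0 x hx)
  obtain ⟨h, hhf, hhg⟩ := LinearMap.exists_glue (LinearMap.ker q).subtype p
    (fun y => by
      obtain ⟨x, hx⟩ := Submodule.mkQ_surjective _ (q y)
      refine ⟨⟨y - p x, ?_⟩, x, (sub_add_cancel _ _).symm⟩
      rw [LinearMap.mem_ker, map_sub, hp, hx, sub_self]) f ((S.costdSub mu).mkQ ∘ₗ g')
    (fun m x hmx => by
      have hx : x ∈ S.stdKer lam := (Submodule.Quotient.mk_eq_zero _).1 (by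
        change (S.stdKer lam).mkQ x = 0
        rw [← hp, ← hmx]; exact m.2)
      have h1 : m = c ⟨x, hx⟩ := Subtype.ext hmx
      have h2 := hg' ⟨x, hx⟩
      have h3 := hg ⟨x, hx⟩
      rw [← h2] at h3
      rw [h1]
      exact h3.symm)
  obtain ⟨G, hG0, hG⟩ := hE mu n h (fun i t ht => by
    have h1 : q t ∈ (radFiltration A (S.Std lam)).toFun (i - s) := (hq _ _).2 ⟨t, ht, rfl⟩
    rw [← radFiltration_map (Submodule.mkQ_surjective (S.stdKer lam))] at h1
    obtain ⟨x, hx, hxt⟩ := h1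
    have hpx : p x ∈ F.toFun i := by simpa using hpF _ x hx
    obtain ⟨y, hy, hyx⟩ := hf i ⟨t - p x, by
      rw [LinearMap.mem_ker, map_sub, hp, hxt, sub_self]⟩ (sub_mem ht hpx)
    have h2 := (radFiltration A (S.P lam)).map_mem_socPow hg0' hx
    rw [show n - s - (i - s) = n - i by ring] at h2
    refine ⟨y + g' x, add_mem hy h2, ?_⟩
    rw [map_add, hyx, ← hhf, ← LinearMap.comp_apply (S.costdSub mu).mkQ, ← hhg, ← map_add]
    simp)
  exact ⟨G ∘ₗ (LinearMap.ker q).subtype, fun x hx => hG0 _ hx, fun x => by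
    rw [LinearMap.comp_apply, hG, hhf]⟩

theorem CostdLifts.exists_chain [IsArtinianRing A] [IsNoetherianRing A]
    (hA : S.IsQuasiHereditary K)
    (hK : ∀ mu, S.CostdLifts ((radFiltration A (S.P mu)).sub (S.stdKer mu)))
    {T : Type u} [AddCommGroup T] [Module A T] [Module.Finite A T] {F : ModFiltration A T}
    (hF : ∃ n, F.toFun n = ⊥) (hE : S.CostdLifts F) :
    ∃ l, F.Chain (fun lam => radFiltration A (S.Std lam)) ⊥ l ⊤ := by
  let Z : Set (Submodule A T) := {N | (∃ l, F.Chain (fun lam => radFiltration A (S.Std lam))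
    N l ⊤) ∧ S.CostdLifts (F.sub N)}
  have hZ : Z.Nonempty :=
    ⟨⊤, ⟨[], .nil _⟩, hE.of_equiv Submodule.topEquiv.symm (fun i x => Iff.rfl)⟩
  obtain ⟨N, ⟨⟨l, hl⟩, hN⟩, hmin⟩ := IsArtinian.set_has_minimal Z hZ
  by_cases hNb : N = ⊥
  · exact ⟨l, hNb ▸ hl⟩
  exfalso
  have : Nontrivial N := Submodule.nontrivial_iff_ne_bot.2 hNb
  obtain ⟨lam, s, q, hqs, hq⟩ := hN.exists_std hA (by
    obtain ⟨n, hn⟩ := hF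
    exact ⟨n, by simp [ModFiltration.sub, hn]⟩)
  let N' := (LinearMap.ker q).map N.subtype
  have hle : N' ≤ N := by rintro _ ⟨y, -, rfl⟩; exact y.2
  have hN' : ∀ x : N, q x = 0 ↔ (x : T) ∈ N' := fun x => by
    constructor
    · exact fun h => ⟨x, h, rfl⟩
    · rintro ⟨y, hy, hyx⟩
      rw [← show y = x from Subtype.ext hyx]; exact hy
  refine hmin N' ⟨⟨lam :: l, .cons ⟨hle, s, q, hqs, hN', hq⟩ hl⟩, ?_⟩ ?_
  · exact (hN.ker hK hq).of_equiv
      (Submodule.equivMapOfInjective N.subtype N.injective_subtype (LinearMap.ker q))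
      (fun i x => Iff.rfl)
  · refine lt_of_le_of_ne hle (fun h => ?_)
    have hq0 : ∀ x, q x = 0 := fun x => (hN' x).2 (by rw [h]; exact x.2)
    obtain ⟨e, he, -⟩ := S.exists_gen lam
    obtain ⟨x, hx⟩ := hqs ((S.stdKer lam).mkQ e)
    rw [hq0] at hx
    exact he (S.stdKer_le_ker_π lam ((Submodule.Quotient.mk_eq_zero _).1 hx.symm))

end WeightSystem

/-! ### Tilting modules without stretched subquotients -/

theorem LinearEquiv.nonempty_of_ker_eq {A : Type u} [Ring A] {M N Q : Type*} [AddCommGroup M]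
    [Module A M] [AddCommGroup N] [Module A N] [AddCommGroup Q] [Module A Q] (p : M →ₗ[A] N)
    (q : M →ₗ[A] Q) (hp : Function.Surjective p) (hq : Function.Surjective q)
    (h : ∀ x, p x = 0 ↔ q x = 0) : Nonempty (N ≃ₗ[A] Q) :=
  ⟨(p.quotKerEquivOfSurjective hp).symm ≪≫ₗ
    Submodule.quotEquivOfEq (LinearMap.ker p) (LinearMap.ker q) (Submodule.ext h) ≪≫ₗ
      q.quotKerEquivOfSurjective hq⟩

/-- Surjections carry radical filtrations onto radical filtrations, so such an isomorphism makes `F`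
the shifted radical filtration of `E` itself. -/
theorem FilteredIso.mem_rad_iff {A : Type u} [Ring A] {E P : Type*} [AddCommGroup E] [Module A E]
    [AddCommGroup P] [Module A P] {F : ModFiltration A E} {Q : Submodule A P} {r : ℤ}
    (h : FilteredIso F (((radFiltration A P).quot Q).shift r)) (i : ℤ) (x : E) :
    x ∈ F.toFun i ↔ x ∈ (radFiltration A E).toFun (i - r) := by
  obtain ⟨e, he⟩ := h
  have h1 : (F.toFun i).map e.toLinearMap =
      ((radFiltration A E).toFun (i - r)).map e.toLinearMap := by
    rw [he, radFiltration_map e.surjective, ← radFiltration_map (Submodule.mkQ_surjective Q)]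
    rfl
  rw [Submodule.map_injective_of_injective e.injective h1]

theorem FilteredIso.mem_soc_iff {K : Type w} {A : Type u} [Field K] [Ring A] [Algebra K A]
    [FiniteDimensional K A] {E I : Type*} [AddCommGroup E] [Module A E]
    [AddCommGroup I] [Module A I] {F : ModFiltration A E} {Q : Submodule A I} {r : ℤ}
    (h : FilteredIso F (((socFiltration K A I).sub Q).shift r)) (i : ℤ) (x : E) :
    x ∈ F.toFun i ↔ x ∈ socPow A E (r - i).toNat := by
  obtain ⟨e, he⟩ := h
  have h1 : x ∈ F.toFun i ↔ e x ∈ (F.toFun i).map e.toLinearMap := by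
    constructor
    · exact fun h => ⟨x, h, rfl⟩
    · rintro ⟨y, hy, hyx⟩
      rwa [← e.injective hyx]
  rw [h1, he, ← neg_sub i r]
  constructor
  · intro h a ha
    apply e.injective
    rw [map_smul, map_zero]
    exact Subtype.ext (h a ha)
  · intro h a ha
    have := congrArg (fun y => (e y : I)) (h a ha)
    simpa using this

theorem ModFiltration.mkQ_mem_subquot {A : Type u} [Ring A] {M : Type*} [AddCommGroup M]
    [Module A M] (F : ModFiltration A M) {M'' M' : Submodule A M} {i : ℤ} {x : M'}
    (hx : (x : M) ∈ F.toFun i) : (M''.submoduleOf M').mkQ x ∈ (F.subquot M'' M').toFun i :=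
  ⟨x, hx, rfl⟩

namespace WeightSystem

variable {A : Type u} [Ring A] {Λ : Type w} {S : WeightSystem A Λ} [PartialOrder Λ]
  {K : Type v} [Field K] [Algebra K A]

/-- Unfiltered `Ext¹(Δ, T) = 0`, by induction on the costandard filtration; the degree `n0` makes
the filtered condition in `extend_costd` vacuous. -/
theorem IsQuasiHereditary.extend_of_costd_filtration [IsArtinianRing A] [IsNoetherianRing A]
    (hA : S.IsQuasiHereditary K) {T : Type u} [AddCommGroup T] [Module A T] {l : List Λ}
    (hT : HasModFiltration (A := A) (M := T) S.Costd l) {mu : Λ} (f : S.stdKer mu →ₗ[A] T) :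
    ∃ g : S.P mu →ₗ[A] T, ∀ x : S.stdKer mu, g x = f x := by
  obtain ⟨n0, hn0⟩ := exists_radFiltration_eq_bot (A := A)
  obtain ⟨X, hX0, hXl, hX⟩ := hT.exists_steps
  have key : ∀ k ≤ l.length, ∀ f : S.stdKer mu →ₗ[A] T, (∀ x, f x ∈ X k) →
      ∃ g : S.P mu →ₗ[A] T, ∀ x : S.stdKer mu, g x = f x := by
    intro k
    induction k with
    | zero =>
      intro _ f hf
      refine ⟨0, fun x => ?_⟩
      have := hf x
      rw [hX0, Submodule.mem_bot] at this
      rw [this]; rfl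
    | succ k ih =>
      intro hk f hf
      obtain ⟨-, q, hq, hqk⟩ := hX k hk
      obtain ⟨g0, hg0, -, hg0f⟩ := hA.extend_costd n0
        ((S.costdSub _).subtype ∘ₗ q ∘ₗ f.codRestrict _ hf) (fun x => (q _).2) (fun x hx => by
          rw [hn0, Submodule.mem_bot] at hx
          rw [show x = 0 from Subtype.ext hx, map_zero])
      obtain ⟨g1, hg1⟩ := (S.projective mu).exists_lift q (g0.codRestrict _ hg0) (fun x => hq _)
      obtain ⟨g2, hg2⟩ := ih (by omega) (f - (X (k + 1)).subtype ∘ₗ g1 ∘ₗ (S.stdKer mu).subtype)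
        (fun x => by
          refine (hqk (f.codRestrict _ hf x - g1 x)).1 ?_
          rw [map_sub, hg1, sub_eq_zero]
          exact Subtype.ext (hg0f x).symm)
      refine ⟨g2 + (X (k + 1)).subtype ∘ₗ g1, fun x => ?_⟩
      rw [LinearMap.add_apply, hg2]
      simp
  exact key _ le_rfl f (fun x => by rw [hXl]; trivial)

theorem IsQuasiHereditary.lift_of_std_filtration [IsArtinianRing A] [IsNoetherianRing A]
    (hA : S.IsQuasiHereditary K) {T : Type u} [AddCommGroup T] [Module A T] {l : List Λ}
    (hT : HasModFiltration (A := A) (M := T) S.Std l) {mu : Λ}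
    (f : T →ₗ[A] S.I mu ⧸ S.costdSub mu) :
    ∃ g : T →ₗ[A] S.I mu, ∀ x, (S.costdSub mu).mkQ (g x) = f x := by
  obtain ⟨n0, hn0⟩ := exists_radFiltration_eq_bot (A := A)
  obtain ⟨m0, hm0⟩ := exists_socPow_eq_top (A := A)
  obtain ⟨X, hX0, hXl, hX⟩ := hT.exists_steps
  have key : ∀ k ≤ l.length, ∃ g : X k →ₗ[A] S.I mu, ∀ x, (S.costdSub mu).mkQ (g x) = f x := by
    intro k
    induction k with
    | zero =>
      intro _
      refine ⟨0, fun x => ?_⟩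
      have : (x : T) ∈ (⊥ : Submodule A T) := by rw [← hX0]; exact x.2
      rw [(Submodule.mem_bot A).1 this]; simp
    | succ k ih =>
      intro hk
      obtain ⟨g, hg⟩ := ih (by omega)
      obtain ⟨hle, q, hq, hqk⟩ := hX k hk
      obtain ⟨g', hg'⟩ := (S.injective mu).out (Submodule.inclusion hle)
        (Submodule.inclusion_injective hle) g
      obtain ⟨t, ht⟩ := LinearMap.exists_factor_of_surjective q hq
        (f ∘ₗ (X (k + 1)).subtype - (S.costdSub mu).mkQ ∘ₗ g') (fun x hx => by
          have h1 := hg ⟨x, (hqk x).1 hx⟩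
          rw [← hg'] at h1
          rw [LinearMap.sub_apply, sub_eq_zero]
          exact h1.symm)
      -- With shift `n0 + m0` the filtered condition is vacuous: `x = 0` for `i ≥ n0`, and the socle
      -- layer is all of `I mu` otherwise.
      obtain ⟨g1, -, hg1⟩ := hA.costdLifts_std _ mu (n0 + m0) t (fun i x hx => by
        by_cases hi : n0 ≤ i
        · have h1 := (radFiltration A _).antitone hi hx
          rw [hn0, Submodule.mem_bot] at h1
          exact ⟨0, zero_mem _, by rw [h1, map_zero, map_zero]⟩
        · obtain ⟨y, hy⟩ := Submodule.mkQ_surjective _ (t x)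
          exact ⟨y, socPow_mono (i := m0) (by omega) (by rw [hm0]; trivial), hy⟩)
      refine ⟨g' + g1 ∘ₗ q, fun x => ?_⟩
      rw [LinearMap.add_apply, map_add, LinearMap.comp_apply, hg1, ht]
      simp
  obtain ⟨g, hg⟩ := key _ le_rfl
  exact ⟨g ∘ₗ LinearMap.id.codRestrict _ (fun x => by rw [hXl]; trivial), fun x => hg ⟨x, _⟩⟩

/-- The subquotient attached to a map `g : P mu → T` and an irreducible quotient `L nu` of the
image of the kernel of `P mu → Δ mu`. -/
theorem isStdIrr_of_surjective {mu nu : Λ} (hlt : mu < nu) {E : Type u} [AddCommGroup E]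
    [Module A E] (s : S.P mu →ₗ[A] E) (hs : Function.Surjective s) (t : S.stdKer mu →ₗ[A] S.L nu)
    (ht : Function.Surjective t) (hst : ∀ x : S.stdKer mu, s x = 0 ↔ t x = 0) :
    S.IsStdIrr mu nu E := by
  let sK : S.stdKer mu →ₗ[A] E := s ∘ₗ (S.stdKer mu).subtype
  have hN : Nonempty (LinearMap.range sK ≃ₗ[A] S.L nu) :=
    LinearEquiv.nonempty_of_ker_eq sK.rangeRestrict t sK.surjective_rangeRestrict ht
      (fun x => by rw [← hst, ← Subtype.coe_inj]; rfl)
  refine ⟨hlt, LinearMap.range sK, hN, ?_, ?_⟩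
  · let p := (LinearMap.range sK).mkQ ∘ₗ s
    have hpK : S.stdKer mu ≤ LinearMap.ker p := fun x hx =>
      (Submodule.Quotient.mk_eq_zero _).2 ⟨⟨x, hx⟩, rfl⟩
    refine ⟨(LinearMap.ker p).map (S.stdKer mu).mkQ, ?_⟩
    refine LinearEquiv.nonempty_of_ker_eq p
      (((LinearMap.ker p).map (S.stdKer mu).mkQ).mkQ ∘ₗ (S.stdKer mu).mkQ)
      ((Submodule.mkQ_surjective _).comp hs)
      ((Submodule.mkQ_surjective _).comp (Submodule.mkQ_surjective _)) (fun x => ?_)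
    refine Iff.trans ?_ (Submodule.Quotient.mk_eq_zero _).symm
    constructor
    · exact fun h => ⟨x, h, rfl⟩
    · rintro ⟨y, hy, hyx⟩
      have h1 : y - x ∈ S.stdKer mu := (Submodule.Quotient.eq _).1 hyx
      have h2 := sub_mem hy (hpK h1)
      rwa [sub_sub_cancel] at h2
  -- As `P mu` is local, a complement pulls back to all of `P mu` or into `ker π`. The first
  -- contradicts disjointness, the second spanning.
  · rintro ⟨C, hC⟩
    by_cases h : C.comap s = ⊤
    · obtain ⟨e⟩ := hN
      have := IsSimpleModule.nontrivial A (S.L nu)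
      obtain ⟨l, hl⟩ := exists_ne (0 : S.L nu)
      obtain ⟨z, rfl⟩ := e.surjective l
      obtain ⟨x, hx⟩ := hs z
      have h1 : x ∈ C.comap s := by rw [h]; trivial
      have h2 := Submodule.disjoint_def.1 hC.disjoint z z.2 (by rw [← hx]; exact h1)
      exact hl (by rw [show z = 0 from Subtype.ext h2, map_zero])
    · obtain ⟨e, he, -⟩ := S.exists_gen mu
      obtain ⟨_, ⟨k, rfl⟩, c, hc, hkc⟩ := Submodule.mem_sup.1
        (show s e ∈ LinearMap.range sK ⊔ C by rw [hC.sup_eq_top]; trivial)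
      have h1 : e - k ∈ C.comap s := by
        change s (e - k) ∈ C
        rw [map_sub, ← hkc]
        simpa [sK] using hc
      have h2 := add_mem (S.le_ker_π_of_ne_top h h1) (S.stdKer_le_ker_π mu k.2)
      rw [sub_add_cancel] at h2
      exact he h2

theorem stdExtends_of_not_hasStretchedStdIrr [IsArtinianRing A] [IsNoetherianRing A]
    (hA : S.IsQuasiHereditary K) {T : Type u} [AddCommGroup T] [Module A T]
    (hT : ∀ (mu : Λ) (f : S.stdKer mu →ₗ[A] T), ∃ g : S.P mu →ₗ[A] T, ∀ x : S.stdKer mu, g x = f x)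
    (hS : ¬ S.HasStretchedStdIrr T) : S.StdExtends (radFiltration A T) := by
  intro mu r f hf
  by_cases hf0 : f = 0
  · exact ⟨0, fun x => zero_mem _, fun x => by rw [hf0]; rfl⟩
  obtain ⟨n0, hn0⟩ := exists_radFiltration_eq_bot (A := A)
  obtain ⟨g, hg⟩ := hT mu f
  refine ⟨g, ?_, hg⟩
  have : Nontrivial (LinearMap.range f) := by
    rw [Submodule.nontrivial_iff_ne_bot]
    exact fun h => hf0 (LinearMap.range_eq_bot.1 h)
  obtain ⟨nu, q, hq0, hq⟩ := S.exists_map_L_ne_zero (LinearMap.range f)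
  let t : S.stdKer mu →ₗ[A] S.L nu := q ∘ₗ f.rangeRestrict
  have ht : Function.Surjective t := hq.comp f.surjective_rangeRestrict
  have hL := IsSimpleModule.nontrivial A (S.L nu)
  have ht0 : t ≠ 0 := by
    obtain ⟨l, hl⟩ := exists_ne (0 : S.L nu)
    obtain ⟨x, rfl⟩ := ht l
    exact fun h0 => hl (by rw [h0]; rfl)
  have hlt : mu < nu := S.lt_of_map_stdKer_ne_zero hA t ht0
  let M'' : Submodule A T := (LinearMap.ker t).map f
  have hM'' : ∀ x, f x ∈ M'' ↔ t x = 0 := fun x => by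
    constructor
    · rintro ⟨y, hy, hyx⟩
      have : f.rangeRestrict y = f.rangeRestrict x := Subtype.ext hyx
      rw [LinearMap.comp_apply, ← this]; exact hy
    · exact fun h => ⟨x, h, rfl⟩
  let M' : Submodule A T := LinearMap.range g
  have hMM : M'' ≤ M' := by rintro _ ⟨y, -, rfl⟩; exact ⟨y, hg y⟩
  let s : S.P mu →ₗ[A] Subquot M'' M' := (M''.submoduleOf M').mkQ ∘ₗ g.rangeRestrict
  have hs : Function.Surjective s :=
    (Submodule.mkQ_surjective _).comp g.surjective_rangeRestrict
  have hs0 : ∀ x, s x = 0 ↔ g x ∈ M'' := fun x => Submodule.Quotient.mk_eq_zero _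
  have hst : ∀ x : S.stdKer mu, s x = 0 ↔ t x = 0 := fun x => by rw [hs0, hg, hM'']
  have hiso : ∃ (Q : Submodule A (S.P mu)) (r : ℤ),
      FilteredIso ((radFiltration A T).subquot M'' M')
        (((radFiltration A (S.P mu)).quot Q).shift r) := by
    by_contra h
    exact hS ⟨M'', M', mu, nu, hMM, isStdIrr_of_surjective hlt s hs t ht hst, h⟩
  obtain ⟨Q, r', hiso⟩ := hiso
  -- `d` is the deepest radical layer of `P mu` in which `stdKer mu` still hits `L nu`; it measures
  -- the distance from the top allowed by `P mu`.
  obtain ⟨d, ⟨x0, hx0, htx0⟩, hd⟩ := Int.exists_greatest_of_bdd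
    (P := fun i => ∃ x : S.stdKer mu, (x : S.P mu) ∈ (radFiltration A (S.P mu)).toFun i ∧ t x ≠ 0)
    ⟨n0, fun i ⟨x, hx, htx⟩ => by
      by_contra hi
      have := (radFiltration A (S.P mu)).antitone (show (n0 : ℤ) ≤ i by omega) hx
      rw [hn0, Submodule.mem_bot] at this
      exact htx (by rw [show x = 0 from Subtype.ext this, map_zero])⟩
    (by
      obtain ⟨l, hl⟩ := exists_ne (0 : S.L nu)
      obtain ⟨x, rfl⟩ := ht l
      exact ⟨0, x, radFiltration_of_nonpos le_rfl _, hl⟩)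
  -- Otherwise `L nu` would lift to layer `d + 1` of `P mu`. A map `P nu → P mu` realizing this
  -- lands in `stdKer mu`, because `Δ(mu)` has no factor `L nu` with `nu > mu`; this contradicts the
  -- choice of `d`.
  have claim : ∀ x : S.stdKer mu,
      s x ∈ (radFiltration A (Subquot M'' M')).toFun (d + 1) → t x = 0 := by
    intro x1 hx1
    by_contra htx1
    have hsK : ∀ x : S.stdKer mu, ∃ y : (radFiltration A (S.P mu)).toFun (d + 1), s y = s x := by
      intro x
      have h1 : t x ∈ Submodule.span A {t x1} := by
        rw [IsSimpleModule.span_singleton_eq_top A htx1]; trivial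
      obtain ⟨a, ha⟩ := Submodule.mem_span_singleton.1 h1
      have h2 : s x = a • s x1 := by
        rw [← sub_eq_zero, ← map_smul, ← map_sub]
        refine (hst (x - a • x1)).2 ?_
        rw [map_sub, map_smul, ha, sub_self]
      have h3 : s x ∈ (radFiltration A (Subquot M'' M')).toFun (d + 1) := by
        rw [h2]; exact Submodule.smul_mem _ _ hx1
      rw [← radFiltration_map hs] at h3
      obtain ⟨y, hy, hyx⟩ := h3
      exact ⟨⟨y, hy⟩, hyx⟩
    obtain ⟨p, hp⟩ := (S.projective nu).exists_lift t (S.π nu) (fun x => ht _)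
    obtain ⟨y, hy⟩ := (S.projective nu).exists_lift
      (s ∘ₗ ((radFiltration A (S.P mu)).toFun (d + 1)).subtype)
      (s ∘ₗ (S.stdKer mu).subtype ∘ₗ p) (fun x => hsK _)
    let z : S.P nu →ₗ[A] S.P mu := (S.stdKer mu).subtype ∘ₗ p -
      ((radFiltration A (S.P mu)).toFun (d + 1)).subtype ∘ₗ y
    have hz : (S.stdKer mu).mkQ ∘ₗ z = 0 := by
      by_contra h0
      exact absurd (S.factorsLE_iff.1 (S.factorsLE_std mu) nu _ h0) (not_le_of_gt hlt)
    obtain ⟨e, he, -⟩ := S.exists_gen nu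
    have hzK : z e ∈ S.stdKer mu :=
      (Submodule.Quotient.mk_eq_zero _).1 (LinearMap.congr_fun hz e)
    have hyK : (y e : S.P mu) ∈ S.stdKer mu := by
      have := sub_mem (p e).2 hzK
      simpa [z] using this
    apply he
    rw [← hp, show p e = ⟨z e, hzK⟩ + ⟨y e, hyK⟩ from Subtype.ext (by simp [z]), map_add]
    have h1 : t ⟨z e, hzK⟩ = 0 := by
      rw [← hst]
      have := hy e
      simp only [LinearMap.comp_apply, Submodule.subtype_apply] at this
      simp [z, this]
    have h2 : t ⟨y e, hyK⟩ = 0 := by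
      by_contra h
      have := hd (d + 1) ⟨⟨y e, hyK⟩, (y e).2, h⟩
      omega
    rw [h1, h2, add_zero]
  -- `L nu` lies in degree at least `d + r` by filteredness of `f`, and in degree at most `d + r'`
  -- by `claim`.
  have hr : r ≤ r' := by
    by_contra hrr
    apply htx0
    apply claim
    have h1 : s x0 ∈ ((radFiltration A T).subquot M'' M').toFun (d + r) :=
      (radFiltration A T).mkQ_mem_subquot (x := g.rangeRestrict x0)
        (by
          change g x0 ∈ _
          rw [hg]; exact hf d x0 hx0)
    rw [hiso.mem_rad_iff] at h1
    exact (radFiltration A _).antitone (by omega) h1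
  intro x
  obtain ⟨w, hw, hwx⟩ : s x ∈ ((radFiltration A T).subquot M'' M').toFun r := by
    rw [hiso.mem_rad_iff]
    exact radFiltration_of_nonpos (by omega) _
  have h1 : g.rangeRestrict x - w ∈ M''.submoduleOf M' := (Submodule.Quotient.eq _).1 hwx.symm
  obtain ⟨k, -, hk⟩ : g x - w ∈ M'' := h1
  have h2 : f k ∈ (radFiltration A T).toFun r := by
    have := hf 0 k (radFiltration_of_nonpos le_rfl _)
    rwa [zero_add] at this
  rw [hk] at h2
  have := add_mem h2 hw
  rwa [Submodule.subtype_apply, sub_add_cancel] at this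

/-- The subquotient attached to a map `M' → I mu` and an irreducible submodule `L nu` of
`I mu / ∇ mu`. -/
theorem isIrrCostd_of_surjective {mu nu : Λ} (hlt : mu < nu) {M' E : Type u} [AddCommGroup M']
    [Module A M'] [AddCommGroup E] [Module A E] (g : M' →ₗ[A] S.I mu) (s : M' →ₗ[A] E)
    (hs : Function.Surjective s) (hsg : ∀ x, s x = 0 ↔ g x = 0) (t : M' →ₗ[A] S.L nu)
    (ht : Function.Surjective t) (htg : ∀ x, t x = 0 ↔ g x ∈ S.costdSub mu) :
    S.IsIrrCostd mu nu E := by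
  have hL := IsSimpleModule.nontrivial A (S.L nu)
  let u : LinearMap.ker t →ₗ[A] S.Costd mu :=
    (g ∘ₗ (LinearMap.ker t).subtype).codRestrict _ (fun x => (htg x).1 x.2)
  let v : LinearMap.ker t →ₗ[A] E := s ∘ₗ (LinearMap.ker t).subtype
  have hv : ∀ x, s x ∈ LinearMap.range v ↔ t x = 0 := fun x => by
    constructor
    · rintro ⟨y, hy⟩
      have h1 : g (x - y) = 0 := by
        rw [← hsg, map_sub, ← hy]; exact sub_self _
      have h2 : t (x - y) = 0 := (htg _).2 (by rw [h1]; exact zero_mem _)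
      rw [map_sub, show t y = 0 from y.2, sub_zero] at h2
      exact h2
    · exact fun h => ⟨⟨x, h⟩, rfl⟩
  refine ⟨hlt, LinearMap.range v, ⟨LinearMap.range u, ?_⟩, ?_, ?_⟩
  · refine LinearEquiv.nonempty_of_ker_eq v.rangeRestrict u.rangeRestrict
      v.surjective_rangeRestrict u.surjective_rangeRestrict (fun x => ?_)
    rw [← Subtype.coe_inj, ← Subtype.coe_inj, ← Subtype.coe_inj]
    exact hsg x
  · refine LinearEquiv.nonempty_of_ker_eq ((LinearMap.range v).mkQ ∘ₗ s) t
      ((Submodule.mkQ_surjective _).comp hs) ht (fun x => ?_)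
    rw [← hv]
    exact Submodule.Quotient.mk_eq_zero _
  · rintro ⟨C, hC⟩
    obtain ⟨l0, hl0⟩ := exists_ne (0 : S.L nu)
    obtain ⟨y0, rfl⟩ := ht l0
    have hg0 : LinearMap.range g ≠ ⊥ := fun h => hl0 ((htg y0).2 (by
      rw [LinearMap.range_eq_bot.1 h]; exact zero_mem _))
    have hLm := IsSimpleModule.nontrivial A (S.L mu)
    obtain ⟨l, hl⟩ := exists_ne (0 : S.L mu)
    have hιl : S.ι mu l ≠ 0 := fun h => hl (S.ι_injective mu (by rw [h, map_zero]))
    obtain ⟨x, hx⟩ := S.ι_le_of_ne_bot hg0 ⟨l, rfl⟩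
    have hxt : t x = 0 := (htg x).2 (by rw [hx]; exact S.range_ι_le mu ⟨l, rfl⟩)
    -- A complement with nonzero image in `I mu` contains the simple socle, which also lies in the
    -- image of `v`.
    by_cases hgC : (C.comap s).map g = ⊥
    · obtain ⟨_, ⟨k, rfl⟩, c, hc, hkc⟩ := Submodule.mem_sup.1
        (show s y0 ∈ LinearMap.range v ⊔ C by rw [hC.sup_eq_top]; trivial)
      obtain ⟨z, rfl⟩ := hs c
      have h1 : g z ∈ (C.comap s).map g := ⟨z, hc, rfl⟩
      rw [hgC, Submodule.mem_bot, ← hsg] at h1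
      rw [h1, add_zero] at hkc
      exact hl0 ((hv y0).1 ⟨k, hkc⟩)
    · obtain ⟨z, hz, hzl⟩ := S.ι_le_of_ne_bot hgC ⟨l, rfl⟩
      have h1 : s x = s z := by
        rw [← sub_eq_zero, ← map_sub, hsg, map_sub, hx, hzl, sub_self]
      have h2 := Submodule.disjoint_def.1 hC.disjoint (s x) ((hv x).2 hxt) (by rw [h1]; exact hz)
      rw [hsg, hx] at h2
      exact hιl h2

theorem costdLifts_of_not_hasStretchedIrrCostd [FiniteDimensional K A]
    (hA : S.IsQuasiHereditary K) {T : Type u} [AddCommGroup T] [Module A T]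
    (hT : ∀ (mu : Λ) (f : T →ₗ[A] S.I mu ⧸ S.costdSub mu),
      ∃ g : T →ₗ[A] S.I mu, ∀ x, (S.costdSub mu).mkQ (g x) = f x)
    (hS : ¬ S.HasStretchedIrrCostd K T) : S.CostdLifts (radFiltration A T) := by
  classical
  have : IsArtinianRing A := IsArtinianRing.of_finite K A
  have : IsNoetherianRing A := IsNoetherianRing.of_finite K A
  intro mu n f hf
  by_cases hf0 : f = 0
  · exact ⟨0, fun x _ => rfl, fun x => by rw [hf0]; simp⟩
  obtain ⟨m0, hm0⟩ := exists_socPow_eq_top (A := A)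
  obtain ⟨g, hg⟩ := hT mu f
  refine ⟨g, ?_, hg⟩
  have : Nontrivial (LinearMap.range f) := by
    rw [Submodule.nontrivial_iff_ne_bot]
    exact fun h => hf0 (LinearMap.range_eq_bot.1 h)
  obtain ⟨nu, j0, hj0⟩ := S.exists_injective_L (LinearMap.range f)
  have hL := IsSimpleModule.nontrivial A (S.L nu)
  let j : S.L nu →ₗ[A] S.I mu ⧸ S.costdSub mu := (LinearMap.range f).subtype ∘ₗ j0
  have hj : Function.Injective j := (LinearMap.range f).injective_subtype.comp hj0
  let M' : Submodule A T := (LinearMap.range j).comap f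
  let M'' : Submodule A T := LinearMap.ker g
  have hfg : ∀ x, g x ∈ S.costdSub mu ↔ f x = 0 := fun x => by
    rw [← hg]; exact (Submodule.Quotient.mk_eq_zero _).symm
  have hM' : ∀ x, f x = 0 → x ∈ M' := fun x hx => ⟨0, by rw [map_zero, hx]⟩
  have hMM : M'' ≤ M' := fun x hx => hM' x (by
    rw [← hfg, show g x = 0 from hx]; exact zero_mem _)
  obtain ⟨t, ht⟩ := LinearMap.exists_lift_of_injective j hj (f ∘ₗ M'.subtype) (fun x => x.2)
  have htf : ∀ x : M', t x = 0 ↔ f x = 0 := fun x => by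
    rw [← hj.eq_iff, ht, map_zero]; rfl
  have hts : Function.Surjective t := fun l => by
    obtain ⟨x, hx⟩ := (j0 l).2
    have hx' : f x = j l := hx
    exact ⟨⟨x, l, hx'.symm⟩, hj (by rw [ht]; exact hx')⟩
  let s : M' →ₗ[A] Subquot M'' M' := (M''.submoduleOf M').mkQ
  have hs : Function.Surjective s := Submodule.mkQ_surjective _
  have hsg : ∀ x : M', s x = 0 ↔ g x = 0 := fun x => Submodule.Quotient.mk_eq_zero _
  obtain ⟨p, hp⟩ := (S.projective nu).exists_lift t (S.π nu) (fun x => hts _)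
  obtain ⟨e, he, -⟩ := S.exists_gen nu
  have hlt : mu < nu := S.lt_of_map_costd hA (g ∘ₗ M'.subtype ∘ₗ p)
    ⟨e, fun h => he (by rw [← hp, htf]; exact (hfg _).1 h)⟩
    (fun x hx => (hfg _).2 ((htf (p x)).1 (by rw [hp]; exact hx)))
  have hiso : ∃ (Q : Submodule A (S.I mu)) (r : ℤ),
      FilteredIso ((radFiltration A T).subquot M'' M')
        (((socFiltration K A (S.I mu)).sub Q).shift r) := by
    by_contra h
    exact hS ⟨M'', M', mu, nu, hMM, isIrrCostd_of_surjective hlt (g ∘ₗ M'.subtype) s hs hsg t hts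
      (fun x => (htf x).trans (hfg x).symm), h⟩
  obtain ⟨Q, r, hiso⟩ := hiso
  -- The least `d` is the socle layer of `I mu` in which `L nu ⊆ I mu/∇(mu)` first appears.
  have hex : ∃ d, ∃ x : M', t x ≠ 0 ∧ ∃ y ∈ socPow A (S.I mu) d, (S.costdSub mu).mkQ y = f x :=
    ⟨m0, p e, by rw [hp]; exact he, g (p e), by rw [hm0]; trivial, hg _⟩
  obtain ⟨d, ⟨x1, htx1, y1, hy1, hyx1⟩, hd⟩ := Nat.findX hex
  have hdpos : 0 < d := Nat.pos_of_ne_zero fun h => htx1 (by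
    rw [htf, ← hyx1, socPow_zero h hy1, map_zero])
  have hlift : ∀ x : M', ∃ y : socPow A (S.I mu) d, (S.costdSub mu).mkQ y = f x := by
    intro x
    have h1 : t x ∈ Submodule.span A {t x1} := by
      rw [IsSimpleModule.span_singleton_eq_top A htx1]; trivial
    obtain ⟨a, ha⟩ := Submodule.mem_span_singleton.1 h1
    have h2 : f (x - a • x1 : M') = 0 := by
      rw [← htf, map_sub, map_smul, ha, sub_self]
    refine ⟨⟨a • y1, Submodule.smul_mem _ _ hy1⟩, ?_⟩
    rw [map_smul, hyx1, ← map_smul, eq_comm, ← sub_eq_zero, ← map_sub]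
    exact h2
  obtain ⟨y, hy⟩ := (S.projective nu).exists_lift
    ((S.costdSub mu).mkQ ∘ₗ (socPow A (S.I mu) d).subtype) (f ∘ₗ M'.subtype ∘ₗ p)
    (fun x => hlift _)
  let z : S.P nu →ₗ[A] S.costdSub mu := (g ∘ₗ M'.subtype ∘ₗ p -
    (socPow A (S.I mu) d).subtype ∘ₗ y).codRestrict _ (fun x => by
      refine (Submodule.Quotient.mk_eq_zero _).1 ?_
      change (S.costdSub mu).mkQ _ = 0
      rw [LinearMap.sub_apply, map_sub, LinearMap.comp_apply, hg, sub_eq_zero]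
      exact (hy x).symm)
  -- Two lifts of `P nu → L nu` to `I mu` differ by a map to `∇(mu)`, which has no factor `L nu`; so
  -- `g` itself sends `p e` to `soc^d`.
  have hz : z = 0 := by
    by_contra h0
    exact absurd (S.factorsLE_iff.1 (S.factorsLE_costdSub mu) nu _ h0) (not_le_of_gt hlt)
  have hgp : g (p e) = y e := by
    have := congrArg Subtype.val (LinearMap.congr_fun hz e)
    exact sub_eq_zero.1 this
  have hsoc : s (p e) ∈ socPow A (Subquot M'' M') d := by
    intro a ha
    rw [← map_smul, hsg, Submodule.coe_smul, map_smul, hgp]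
    exact (y e).2 a ha
  obtain ⟨w, hw, hwp⟩ : s (p e) ∈ ((radFiltration A T).subquot M'' M').toFun (r - d) := by
    rw [hiso.mem_soc_iff]
    simpa using hsoc
  have htw : t w ≠ 0 := by
    have h1 : s (w - p e) = 0 := by rw [map_sub, sub_eq_zero]; exact hwp
    have h2 : t (w - p e) = 0 := by
      rw [htf, ← hfg, (hsg _).1 h1]; exact zero_mem _
    rw [map_sub, hp, sub_eq_zero] at h2
    rw [h2]; exact he
  -- `w` represents `L nu` in degree `r - d`. If `r > n`, filteredness of `f` would put a lift of it
  -- in a socle layer below `d`.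
  have hr : r ≤ n := by
    by_contra hrn
    obtain ⟨y', hy', hyw⟩ := hf (r - d) w hw
    exact hd (n - (r - d)).toNat (by omega) ⟨w, htw, y', hy', hyw⟩
  intro x hx
  obtain ⟨y', hy', hyx⟩ := hf n x hx
  rw [socPow_zero (by simp) hy', map_zero] at hyx
  have h1 : s ⟨x, hM' x hyx.symm⟩ ∈ ((radFiltration A T).subquot M'' M').toFun n :=
    (radFiltration A T).mkQ_mem_subquot hx
  rw [hiso.mem_soc_iff] at h1
  exact (hsg _).1 (socPow_zero (by omega) h1)

/-- Filtered `Ext²(Δ, ∇) = 0` by dimension shift: the filtration of `Rees (P mu)` below its top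
factor gives a strict standard filtration of `stdKer mu`. -/
theorem IsReesQuasiHereditary.costdLifts_stdKer [IsNoetherianRing A] (hA : S.IsQuasiHereditary K)
    (hRees : S.IsReesQuasiHereditary K) (mu : Λ) :
    S.CostdLifts ((radFiltration A (S.P mu)).sub (S.stdKer mu)) := by
  obtain ⟨l, -, hl⟩ := (hRees mu).2
  obtain ⟨X, hX0, hXl, hX⟩ := hl.exists_steps
  have h1 := CostdLifts.of_steps hA (radFiltration A (S.P mu)) X (l ++ [mu]) hX0 hX l.length
    (by simp)
  have hK : X l.length = S.stdKer mu := by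
    have hs := hX l.length (by simp)
    have hlast : (l ++ [mu])[l.length]'(by simp) = mu := by simp
    simp only [List.length_append, List.length_cons, List.length_nil, zero_add] at hXl
    rw [hlast, hXl] at hs
    obtain ⟨-, -, p, hp, hpk, -⟩ := hs
    ext x
    rw [← S.ker_eq_stdKer (p ∘ₗ LinearMap.id.codRestrict ⊤ (fun _ => trivial)) (fun y => by
      obtain ⟨x, rfl⟩ := hp y
      exact ⟨x, rfl⟩)]
    exact (hpk ⟨x, trivial⟩).symm
  rwa [hK] at h1

end WeightSystem

theorem mainTheorem3 (K : Type v) [Field K] (A : Type u) [Ring A] [Algebra K A]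
    [FiniteDimensional K A] (Λ : Type w) [PartialOrder Λ] (S : WeightSystem A Λ)
    (hA : S.IsQuasiHereditary K) (hRees : S.IsReesQuasiHereditary K)
    (T : Type u) [AddCommGroup T] [Module A T] [Module.Finite A T]
    (hT : S.IsTilting T)
    (hStdIrr : ¬ S.HasStretchedStdIrr T) (hIrrCostd : ¬ S.HasStretchedIrrCostd K T) :
    S.IsReesTilting K (radFiltration A T) := by
  have : IsArtinianRing A := IsArtinianRing.of_finite K A
  have : IsNoetherianRing A := IsNoetherianRing.of_finite K A
  obtain ⟨⟨l, hl⟩, ⟨l', hl'⟩⟩ := hT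
  have hK := WeightSystem.IsReesQuasiHereditary.costdLifts_stdKer hA hRees
  have hF : ∃ n, (radFiltration A T).toFun n = ⊥ := by
    obtain ⟨n, hn⟩ := WeightSystem.exists_radFiltration_eq_bot (A := A)
    exact ⟨n, hn T⟩
  constructor
  · obtain ⟨m, hm⟩ := (WeightSystem.costdLifts_of_not_hasStretchedIrrCostd hA
      (fun _ f => hA.lift_of_std_filtration hl f) hIrrCostd).exists_chain hA hK hF
    obtain ⟨X, h0, h1, hX⟩ := hm.exists_steps
    exact ⟨m, Rees.hasFiltration_of_steps X h0 h1 hX⟩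
  · obtain ⟨m, hm⟩ := (WeightSystem.stdExtends_of_not_hasStretchedStdIrr hA
      (fun _ f => hA.extend_of_costd_filtration hl' f) hStdIrr).exists_chain hA hK hF
    obtain ⟨X, h0, h1, hX⟩ := hm.exists_steps
    exact ⟨m, Rees.hasFiltration_of_steps X h0 h1 hX⟩
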